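/- Let $n\in\mathbb N$, $1<p<n$, $p^*=\frac{np}{n-p}$ and $q\ge p^*-1$. A \emph{Cartan-Hadamard model function} is a $C^2$ convex function $\psi:[0,+\infty)\to[0,+\infty)$ with $\psi(0)=0$, $\psi'(0)=1$. The corresponding model manifold $\mathbb M^n_\psi$ is $\mathbb R^n$ with the metric $dr^2+\psi(r)^2 g_{\mathbb S^{n-1}}$ in polar coordinates about the origin (the pole). Put $$\Theta(r)=\frac{\int_0^r\psi^{n-1}\,ds}{\psi^{n-1}(r)}\qquad (r>0).$$ The manifold is called \emph{$p$-stochastically complete} if $\Theta^{\frac1{p-1}}\notin L^1(0,+\infty)$. A \emph{radial solution} is a function $u=u(r)$ of the distance $r$ from the pole, $u\in W^{1,p}_{\mathrm{loc}}\cap L^\infty_{\mathrm{loc}}(\mathbb M^n_\psi)$, $u>0$, which solves $-\Delta_p u=u^q$ weakly on $\mathbb M^n_\psi$. (i) Let $\psi$ be a Cartan-Hadamard model function such that $$\liminf_{r\to+\infty}\frac{\int_0^r\Theta^{\frac p{p-1}}\,\psi^{n-1}\,ds}{\psi^{n-1}(r)\,\Theta(r)\int_0^r\Theta^{\frac1{p-1}}\,ds}>0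 .\tag{1}$$ Then $\mathbb M^n_\psi$ is $p$-stochastically complete, and for every radial solution $u$ the asymptotic formula $$\lim_{r\to+\infty}\left(\int_0^r\Theta^{\frac1{p-1}}\,ds\right)^{\frac{p-1}{q+1-p}}u(r)=\left(\frac{p-1}{q+1-p}\right)^{\frac{p-1}{q+1-p}}\tag{2}$$ fails. Moreover, (1) holds whenever $\lim_{r\to+\infty}\frac{r\,\psi'(r)}{\psi(r)}=\ell$ for some $\ell\in(0,+\infty)$. (ii) For every $\alpha>0$ there exist a Cartan-Hadamard model function $\psi$, which moreover extends to a smooth odd function on $\mathbb R$ (so that the metric is smooth, also at the pole), such that $\mathbb M^n_\psi$ is $p$-stochastically complete and $$\limsup_{r\to+\infty}\frac{\psi(r)}{e^{\ell r}}=+\infty\qquad\forall \ell>0 ,$$ and a continuous radial solution $u$ on $\mathbb M^n_\psi$ with $u(0)=\alpha$ for which the limit on the left-hand side of (2) does not exist (not even in $[-\infty,+\infty]$). -/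

import Mathlib

open Filter Topology MeasureTheory Set
open scoped ContDiff InnerProductSpace

noncomputable section

namespace CHModel

/-- `ψ` (only its values on `[0, ∞)` matter) is the model function of a Cartan-Hadamard model
manifold `dr² + ψ(r)² g_{S^{n-1}}`: it is regular, `ψ(0) = 0`, `ψ'(0) = 1`, and it is convex, which
is what nonpositivity of the sectional curvatures amounts to. -/
structure IsCartanHadamardModel (ψ : ℝ → ℝ) : Prop where
  contDiffOn : ContDiffOn ℝ 2 ψ (Ici 0)
  map_zero : ψ 0 = 0
  deriv_zero : derivWithin ψ (Ici 0) 0 = 1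
  convexOn : ConvexOn ℝ (Ici 0) ψ

/-- The volume-surface ratio of geodesic balls about the pole. -/
def Theta (n : ℕ) (ψ : ℝ → ℝ) (r : ℝ) : ℝ :=
  (∫ s in (0 : ℝ)..r, ψ s ^ (n - 1)) / ψ r ^ (n - 1)

/-- `p`-stochastic completeness: `Θ^{1/(p-1)} ∉ L¹(ℝ⁺)`. -/
def PStochasticallyComplete (n : ℕ) (p : ℝ) (ψ : ℝ → ℝ) : Prop :=
  ¬ IntegrableOn (fun r => Theta n ψ r ^ (1 / (p - 1))) (Ioi 0) volume

/-! The model manifold is realised on `ℝⁿ` in normal (geodesic polar) coordinates about the pole,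
which is the origin; `‖x‖` is the Riemannian distance of `x` from the pole. -/

/-- The factor `ψ(r) / r` by which lengths tangent to the sphere of radius `r` are stretched. -/
def warp (ψ : ℝ → ℝ) (r : ℝ) : ℝ := if r = 0 then 1 else ψ r / r

/-- The radial unit vector at `x` (zero at the pole). -/
def radialDir {n : ℕ} (x : EuclideanSpace ℝ (Fin n)) : EuclideanSpace ℝ (Fin n) := ‖x‖⁻¹ • x

/-- The metric `dr² + ψ(r)² g_{S^{n-1}}` at `x`, applied to tangent vectors `v` and `w`. -/
def metric {n : ℕ} (ψ : ℝ → ℝ) (x v w : EuclideanSpace ℝ (Fin n)) : ℝ :=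
  ⟪radialDir x, v⟫_ℝ * ⟪radialDir x, w⟫_ℝ
    + warp ψ ‖x‖ ^ 2 * (⟪v, w⟫_ℝ - ⟪radialDir x, v⟫_ℝ * ⟪radialDir x, w⟫_ℝ)

/-- The norm of a tangent vector. -/
def metricNorm {n : ℕ} (ψ : ℝ → ℝ) (x v : EuclideanSpace ℝ (Fin n)) : ℝ :=
  Real.sqrt (metric ψ x v v)

/-- The matrix of the metric in the coordinates of `ℝⁿ`. -/
def metricMatrix {n : ℕ} (ψ : ℝ → ℝ) (x : EuclideanSpace ℝ (Fin n)) : Matrix (Fin n) (Fin n) ℝ :=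
  Matrix.of fun i j => metric ψ x (EuclideanSpace.single i 1) (EuclideanSpace.single j 1)

/-- The Riemannian volume measure `√(det g) dx`. -/
def vol (n : ℕ) (ψ : ℝ → ℝ) : Measure (EuclideanSpace ℝ (Fin n)) :=
  volume.withDensity fun x => ENNReal.ofReal (Real.sqrt (metricMatrix ψ x).det)

/-- The tangent vector that the metric at `x` assigns to the differential with coordinates `η`
(index raising). -/
def sharp {n : ℕ} (ψ : ℝ → ℝ) (x η : EuclideanSpace ℝ (Fin n)) : EuclideanSpace ℝ (Fin n) :=
  ⟪radialDir x, η⟫_ℝ • radialDir x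
    + (warp ψ ‖x‖ ^ 2)⁻¹ • (η - ⟪radialDir x, η⟫_ℝ • radialDir x)

/-- `η` is the weak (distributional) differential of `u`, in the coordinates of `ℝⁿ`. -/
structure HasWeakDifferential {n : ℕ} (u : EuclideanSpace ℝ (Fin n) → ℝ)
    (η : EuclideanSpace ℝ (Fin n) → EuclideanSpace ℝ (Fin n)) : Prop where
  locallyIntegrable : LocallyIntegrable u volume
  locallyIntegrable_diff : LocallyIntegrable η volume
  integral_eq : ∀ ξ : EuclideanSpace ℝ (Fin n) → ℝ, ContDiff ℝ ∞ ξ → HasCompactSupport ξ →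
    ∀ v : EuclideanSpace ℝ (Fin n), ∫ x, u x * fderiv ℝ ξ x v = - ∫ x, ⟪η x, v⟫_ℝ * ξ x

/-- `u` is a positive weak solution of `-Δ_p u = u^q` on the model manifold, of class
`W^{1,p}_loc ∩ L^∞_loc`. -/
def IsWeakSolution (n : ℕ) (p q : ℝ) (ψ : ℝ → ℝ) (u : EuclideanSpace ℝ (Fin n) → ℝ) : Prop :=
  (∀ x, 0 < u x) ∧
  ∃ η : EuclideanSpace ℝ (Fin n) → EuclideanSpace ℝ (Fin n),
    HasWeakDifferential u η ∧
    (∀ K : Set (EuclideanSpace ℝ (Fin n)), IsCompact K →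
      MemLp u (ENNReal.ofReal p) ((vol n ψ).restrict K) ∧
      MemLp (fun x => metricNorm ψ x (sharp ψ x (η x))) (ENNReal.ofReal p)
        ((vol n ψ).restrict K) ∧
      MemLp u ⊤ ((vol n ψ).restrict K)) ∧
    ∀ ξ : EuclideanSpace ℝ (Fin n) → ℝ, ContDiff ℝ ∞ ξ → HasCompactSupport ξ →
      ∫ x, metricNorm ψ x (sharp ψ x (η x)) ^ (p - 2)
          * metric ψ x (sharp ψ x (η x)) (sharp ψ x (gradient ξ x)) ∂(vol n ψ)
        = ∫ x, u x ^ q * ξ x ∂(vol n ψ)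

/-- The radial function with profile `φ` is a solution. -/
def IsRadialSolution (n : ℕ) (p q : ℝ) (ψ φ : ℝ → ℝ) : Prop :=
  IsWeakSolution n p q ψ fun x => φ ‖x‖

/-- The rescaled profile `(∫₀ʳ Θ^{1/(p-1)} ds)^{(p-1)/(q+1-p)} u(r)`. -/
def rescaled (n : ℕ) (p q : ℝ) (ψ φ : ℝ → ℝ) (r : ℝ) : ℝ :=
  (∫ s in (0 : ℝ)..r, Theta n ψ s ^ (1 / (p - 1))) ^ ((p - 1) / (q + 1 - p)) * φ r

/-- The quotient whose lower limit at infinity is asked to be positive. -/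
def ratio (n : ℕ) (p : ℝ) (ψ : ℝ → ℝ) (r : ℝ) : ℝ :=
  (∫ s in (0 : ℝ)..r, Theta n ψ s ^ (p / (p - 1)) * ψ s ^ (n - 1)) /
    (ψ r ^ (n - 1) * Theta n ψ r * ∫ s in (0 : ℝ)..r, Theta n ψ s ^ (1 / (p - 1)))

/-- `liminf_{r → ∞} ratio(r) > 0`. -/
def LiminfCondition (n : ℕ) (p : ℝ) (ψ : ℝ → ℝ) : Prop :=
  0 < liminf (fun r : ℝ => ((ratio n p ψ r : ℝ) : EReal)) atTop

theorem inner_radialDir_self {n : ℕ} {x : EuclideanSpace ℝ (Fin n)} (hx : x ≠ 0) :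
    ⟪radialDir x, radialDir x⟫_ℝ = 1 := by
  have h : ‖x‖ ≠ 0 := norm_ne_zero_iff.2 hx
  simp only [radialDir, inner_smul_left, inner_smul_right, real_inner_self_eq_norm_sq]
  simp
  field_simp

/-- `sharp` does raise indices with respect to `metric`. -/
theorem metric_sharp {n : ℕ} {ψ : ℝ → ℝ} {x : EuclideanSpace ℝ (Fin n)} (h : warp ψ ‖x‖ ≠ 0)
    (η v : EuclideanSpace ℝ (Fin n)) : metric ψ x (sharp ψ x η) v = ⟪η, v⟫_ℝ := by
  rcases eq_or_ne x 0 with rfl | hx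
  · simp [metric, sharp, radialDir, warp]
  · have h1 := inner_radialDir_self hx
    simp only [metric, sharp, inner_add_left, inner_add_right, inner_sub_left, inner_sub_right,
      inner_smul_left, inner_smul_right, h1]
    simp
    field_simp
    ring

/-- The volume density is `(ψ(r) / r)^{n-1}`, that is `dV = ψ(r)^{n-1} dr dθ`. -/
theorem sqrt_det_metricMatrix {n : ℕ} (hn : 1 ≤ n) {ψ : ℝ → ℝ} {x : EuclideanSpace ℝ (Fin n)}
    (h : 0 < warp ψ ‖x‖) :
    Real.sqrt (metricMatrix ψ x).det = warp ψ ‖x‖ ^ (n - 1) := by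
  set c := warp ψ ‖x‖ with hc
  have key : metricMatrix ψ x = (c ^ 2) • (1 + Matrix.replicateCol Unit
      (fun i => ((c ^ 2)⁻¹ * (1 - c ^ 2)) * radialDir x i) *
      Matrix.replicateRow Unit (fun i => radialDir x i)) := by
    ext i j
    simp [metricMatrix, metric, Matrix.mul_apply, Matrix.one_apply, ← hc,
      EuclideanSpace.inner_single_right, eq_comm]
    field_simp
    ring
  have hdot : (fun i => radialDir x i) ⬝ᵥ
      (fun i => ((c ^ 2)⁻¹ * (1 - c ^ 2)) * radialDir x i)
      = ((c ^ 2)⁻¹ * (1 - c ^ 2)) * ⟪radialDir x, radialDir x⟫_ℝ := by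
    simp only [dotProduct, PiLp.inner_apply, Finset.mul_sum]
    refine Finset.sum_congr rfl fun i _ => ?_
    simp
    ring
  rw [key, Matrix.det_smul, Matrix.det_one_add_replicateCol_mul_replicateRow, hdot,
    Fintype.card_fin]
  obtain ⟨m, rfl⟩ : ∃ m, n = m + 1 := ⟨n - 1, by omega⟩
  have : (c ^ 2) ^ (m + 1) * (1 + (c ^ 2)⁻¹ * (1 - c ^ 2) * ⟪radialDir x, radialDir x⟫_ℝ)
      = (c ^ m) ^ 2 := by
    rcases eq_or_ne x 0 with rfl | hx
    · have : c = 1 := by simp [hc, warp]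
      simp [this]
    · rw [inner_radialDir_self hx]
      field_simp
      ring
  rw [this, Real.sqrt_sq (by positivity)]
  simp

end CHModel

end

noncomputable section

namespace CHModel

/-! ### Calculus on the half-line -/

/-! Write b = 1/(p-1), k = (q+1-p)/(p-1), V = `ballVol`, H = `thetaInt` (the primitive of Θ^b) and F
= `flux`, the primitive of ψ^{n-1} u^q. A radial solution satisfies u' = -(F/ψ^{n-1})^b, so that
(u^{-k})' = k X^b with X = F/(ψ^{n-1} u^q), called `relFlux`. As u decreases, X ≥ Θ, and u^{-k}
always grows at least like k H. Formula (2), raised to the power k, says u^k H → 1/k, that is,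
asymptotically nothing is lost in X ≥ Θ. Everything turns on this loss.

Part (i). The loss is F - u^q V, the integral of q u^{q-1} |u'| V, and it is at least q u(r)^{q+k}
times the integral of Θ^b V. That integral is the numerator of `ratio`, so (1) bounds it below by ε
V H. If u^k H stayed above (1-δ)/k, the loss would be a fixed fraction of u^q V, giving X ≥ (1+a) Θ,
and integration would push u^k H below 1/k by a fixed factor. Hence u^k H ≤ (1-δ)/k at arbitrarily
large radii (`exists_frequently_rpow_mul_thetaInt_le`), with δ depending only on p, q, ε. When r
ψ'/ψ converges, ψ is doubling and (1) follows with ε depending only on n, p and the limit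
(`exists_le_ratio_of_tendsto`).

Part (ii). When ψ'/ψ has a positive limit, u^k H does come back close to 1/k
(`IsProfile.eventually_le_rpow_mul_thetaInt`). The model is built by prescribing γ = ψ''/ψ' and
alternating long stretches with γ = 0, where ψ is affine and u^k H drops below (1-δ)/k, with long
stretches with γ = N+1, where u^k H exceeds (1-1/(N+1))/k and ψ beats e^{Nr}. The values of u on [0,
r] depend only on ψ on [0, r], so later stretches do not disturb earlier ones, and δ is the same on
all stretches because all affine ends have r ψ'/ψ → 1.

Two tools support this. A Pohozaev inequality (`Theta_mul_speed_le`), valid because q is at least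
critical and ψ is convex, bounds -u'/u by a multiple of 1/Θ; it keeps solutions positive for all
radii and starts the analysis for exponential growth. An equivalence between weak radial solutions
and `IsProfile` carries the results over to the manifold: one direction integrates by parts along
rays; the other shows that the weak differential of a radial function is radial, and recovers the
integrated equation from radial test functions. -/

theorem intervalIntegrable_of_bdd {f : ℝ → ℝ} {r C : ℝ} (hr : 0 ≤ r)
    (hc : ContinuousOn f (Ioc 0 r)) (hb : ∀ s ∈ Ioc 0 r, ‖f s‖ ≤ C) :
    IntervalIntegrable f volume 0 r := by
  rw [intervalIntegrable_iff_integrableOn_Ioc_of_le hr]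
  refine Integrable.of_bound (C := C) ?_ ?_
  · exact hc.aestronglyMeasurable measurableSet_Ioc
  · exact (ae_restrict_iff' measurableSet_Ioc).2 (Eventually.of_forall hb)

theorem hasDerivAt_integral_of_continuousOn {f : ℝ → ℝ} {a r : ℝ} {U : Set ℝ} (hU : IsOpen U)
    (hc : ContinuousOn f U) (hr : r ∈ U) (hi : IntervalIntegrable f volume a r) :
    HasDerivAt (fun r => ∫ s in a..r, f s) (f r) r :=
  intervalIntegral.integral_hasDerivAt_right hi (hc.stronglyMeasurableAtFilter hU _ hr)
    (hc.continuousAt (hU.mem_nhds hr))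

theorem sub_le_sub_of_hasDerivAt_le {f g f' g' : ℝ → ℝ} {a b : ℝ} (hab : a ≤ b)
    (hf : ∀ x ∈ Icc a b, HasDerivAt f (f' x) x) (hg : ∀ x ∈ Icc a b, HasDerivAt g (g' x) x)
    (h : ∀ x ∈ Ioo a b, f' x ≤ g' x) : f b - f a ≤ g b - g a := by
  have hd : ∀ x ∈ Icc a b, HasDerivAt (fun x => g x - f x) (g' x - f' x) x :=
    fun x hx => (hg x hx).sub (hf x hx)
  have := monotoneOn_of_deriv_nonneg (convex_Icc a b)
    (fun x hx => (hd x hx).continuousAt.continuousWithinAt)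
    (fun x hx => (hd x (interior_subset hx)).differentiableAt.differentiableWithinAt)
    (fun x hx => by
      rw [interior_Icc] at hx
      rw [(hd x (Ioo_subset_Icc_self hx)).deriv]
      linarith [h x hx]) (left_mem_Icc.2 hab) (right_mem_Icc.2 hab) hab
  simp only at this
  linarith

theorem le_of_hasDerivAt_nonneg {f f' : ℝ → ℝ} {a b : ℝ} (hab : a ≤ b)
    (hf : ∀ x ∈ Icc a b, HasDerivAt f (f' x) x) (h : ∀ x ∈ Ioo a b, 0 ≤ f' x) : f a ≤ f b := by
  have := sub_le_sub_of_hasDerivAt_le hab (fun x _ => hasDerivAt_const x (0 : ℝ)) hf h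
  simpa using this

theorem le_of_hasDerivAt_nonpos {f f' : ℝ → ℝ} {a b : ℝ} (hab : a ≤ b)
    (hf : ∀ x ∈ Icc a b, HasDerivAt f (f' x) x) (h : ∀ x ∈ Ioo a b, f' x ≤ 0) : f b ≤ f a := by
  have := sub_le_sub_of_hasDerivAt_le hab hf (fun x _ => hasDerivAt_const x (0 : ℝ)) h
  simpa using this

/-! ### Model functions -/

namespace IsCartanHadamardModel

variable {ψ : ℝ → ℝ}

theorem continuousOn (h : IsCartanHadamardModel ψ) : ContinuousOn ψ (Ici 0) :=
  h.contDiffOn.continuousOn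

theorem contDiffAt (h : IsCartanHadamardModel ψ) {r : ℝ} (hr : 0 < r) : ContDiffAt ℝ 2 ψ r :=
  h.contDiffOn.contDiffAt (Ici_mem_nhds hr)

theorem hasDerivAt (h : IsCartanHadamardModel ψ) {r : ℝ} (hr : 0 < r) :
    HasDerivAt ψ (deriv ψ r) r :=
  ((h.contDiffAt hr).differentiableAt (by norm_num)).hasDerivAt

theorem convexOn_Ioi (h : IsCartanHadamardModel ψ) : ConvexOn ℝ (Ioi 0) ψ :=
  h.convexOn.subset Ioi_subset_Ici_self (convex_Ioi 0)

theorem monotoneOn_deriv (h : IsCartanHadamardModel ψ) : MonotoneOn (deriv ψ) (Ioi 0) :=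
  h.convexOn_Ioi.monotoneOn_deriv fun _ hx => (h.hasDerivAt hx).differentiableAt

theorem hasDerivWithinAt_zero (h : IsCartanHadamardModel ψ) :
    HasDerivWithinAt ψ 1 (Ici 0) 0 := by
  have := (h.contDiffOn.differentiableOn (by norm_num) 0 self_mem_Ici).hasDerivWithinAt
  rwa [h.deriv_zero] at this

theorem le_self (h : IsCartanHadamardModel ψ) {r : ℝ} (hr : 0 ≤ r) : r ≤ ψ r := by
  rcases hr.eq_or_lt with rfl | hr
  · exact h.map_zero.ge
  have := h.convexOn.le_slope_of_hasDerivWithinAt self_mem_Ici (mem_Ici.2 hr.le) hr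
    h.hasDerivWithinAt_zero
  rw [slope_def_field, h.map_zero, le_div_iff₀ (by linarith)] at this
  linarith

theorem pos (h : IsCartanHadamardModel ψ) {r : ℝ} (hr : 0 < r) : 0 < ψ r :=
  hr.trans_le (h.le_self hr.le)

theorem nonneg (h : IsCartanHadamardModel ψ) {r : ℝ} (hr : 0 ≤ r) : 0 ≤ ψ r :=
  hr.trans (h.le_self hr)

theorem le_mul_deriv (h : IsCartanHadamardModel ψ) {r : ℝ} (hr : 0 < r) :
    ψ r ≤ r * deriv ψ r := by
  have := h.convexOn.slope_le_of_hasDerivAt self_mem_Ici (mem_Ici.2 hr.le) hr (h.hasDerivAt hr)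
  rw [slope_def_field, h.map_zero, div_le_iff₀ (by linarith)] at this
  linarith

theorem one_le_deriv (h : IsCartanHadamardModel ψ) {r : ℝ} (hr : 0 < r) : 1 ≤ deriv ψ r := by
  have := h.le_mul_deriv hr
  have := h.le_self hr.le
  nlinarith

theorem monotoneOn (h : IsCartanHadamardModel ψ) : MonotoneOn ψ (Ici 0) := by
  intro a ha b hb hab
  rcases (mem_Ici.1 ha).eq_or_lt with rfl | ha'
  · rw [h.map_zero]; exact h.nonneg hb
  exact le_of_hasDerivAt_nonneg hab (fun x hx => h.hasDerivAt (ha'.trans_le hx.1))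
    (fun x hx => zero_le_one.trans (h.one_le_deriv (ha'.trans hx.1)))

end IsCartanHadamardModel

/-! ### Volume of balls, `Theta` and its primitive -/

/-- The volume of geodesic balls, up to a dimensional factor. -/
def ballVol (n : ℕ) (ψ : ℝ → ℝ) (r : ℝ) : ℝ := ∫ s in (0 : ℝ)..r, ψ s ^ (n - 1)

/-- The primitive of `Θ^{1/(p-1)}`. -/
def thetaInt (n : ℕ) (p : ℝ) (ψ : ℝ → ℝ) (r : ℝ) : ℝ :=
  ∫ s in (0 : ℝ)..r, Theta n ψ s ^ (1 / (p - 1))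

theorem Theta_eq (n : ℕ) (ψ : ℝ → ℝ) (r : ℝ) : Theta n ψ r = ballVol n ψ r / ψ r ^ (n - 1) := rfl

namespace IsCartanHadamardModel

variable {ψ : ℝ → ℝ} {n : ℕ} {p : ℝ}

theorem continuousOn_pow (h : IsCartanHadamardModel ψ) (m : ℕ) :
    ContinuousOn (fun s => ψ s ^ m) (Ici 0) := h.continuousOn.pow m

theorem intervalIntegrable_pow (h : IsCartanHadamardModel ψ) (m : ℕ) {a b : ℝ} (ha : 0 ≤ a)
    (hb : 0 ≤ b) : IntervalIntegrable (fun s => ψ s ^ m) volume a b :=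
  ((h.continuousOn_pow m).mono (fun _ hx => (le_min ha hb).trans hx.1)).intervalIntegrable

theorem hasDerivAt_ballVol (h : IsCartanHadamardModel ψ) {r : ℝ} (hr : 0 < r) :
    HasDerivAt (ballVol n ψ) (ψ r ^ (n - 1)) r :=
  hasDerivAt_integral_of_continuousOn isOpen_Ioi ((h.continuousOn_pow _).mono Ioi_subset_Ici_self) hr
    (h.intervalIntegrable_pow _ le_rfl hr.le)

theorem ballVol_pos (h : IsCartanHadamardModel ψ) {r : ℝ} (hr : 0 < r) : 0 < ballVol n ψ r :=
  intervalIntegral.intervalIntegral_pos_of_pos_on (h.intervalIntegrable_pow _ le_rfl hr.le)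
    (fun _ hx => pow_pos (h.pos hx.1) _) hr

theorem ballVol_le (h : IsCartanHadamardModel ψ) {r : ℝ} (hr : 0 ≤ r) :
    ballVol n ψ r ≤ r * ψ r ^ (n - 1) := by
  have := intervalIntegral.integral_mono_on hr (h.intervalIntegrable_pow (n - 1) le_rfl hr)
    (intervalIntegrable_const (c := ψ r ^ (n - 1))) (fun x hx => by
      exact pow_le_pow_left₀ (h.nonneg hx.1) (h.monotoneOn hx.1 hr hx.2) _)
  simpa [ballVol] using this

theorem ballVol_sub (h : IsCartanHadamardModel ψ) {s r : ℝ} (hs : 0 ≤ s) (hr : 0 ≤ r) :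
    ballVol n ψ r - ballVol n ψ s = ∫ t in s..r, ψ t ^ (n - 1) := by
  have := intervalIntegral.integral_add_adjacent_intervals
    (h.intervalIntegrable_pow (n - 1) le_rfl hs) (h.intervalIntegrable_pow (n - 1) hs hr)
  simp only [ballVol]
  linarith

theorem le_ballVol_sub (h : IsCartanHadamardModel ψ) {s r : ℝ} (hs : 0 ≤ s) (hr : s ≤ r) :
    (r - s) * ψ s ^ (n - 1) ≤ ballVol n ψ r - ballVol n ψ s := by
  rw [h.ballVol_sub hs (hs.trans hr)]
  have := intervalIntegral.integral_mono_on hr (intervalIntegrable_const (c := ψ s ^ (n - 1)))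
    (h.intervalIntegrable_pow (n - 1) hs (hs.trans hr)) (fun x hx => by
      exact pow_le_pow_left₀ (h.nonneg hs) (h.monotoneOn hs (hs.trans hx.1) hx.1) _)
  simpa using this

theorem monotoneOn_ballVol (h : IsCartanHadamardModel ψ) :
    MonotoneOn (ballVol n ψ) (Ici 0) := by
  intro a ha b hb hab
  have := h.le_ballVol_sub (n := n) ha hab
  have h2 : 0 ≤ (b - a) * ψ a ^ (n - 1) :=
    mul_nonneg (by linarith) (pow_nonneg (h.nonneg ha) _)
  linarith

theorem tendsto_ballVol (h : IsCartanHadamardModel ψ) :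
    Tendsto (ballVol n ψ) atTop atTop := by
  refine tendsto_atTop_mono' _ ?_ (tendsto_atTop_add_const_right _ (-1 : ℝ) tendsto_id)
  filter_upwards [eventually_ge_atTop 1] with r hr
  have h1 := h.le_ballVol_sub (n := n) zero_le_one hr
  have h2 := h.ballVol_pos (n := n) zero_lt_one
  have h3 : 1 ≤ ψ 1 ^ (n - 1) := one_le_pow₀ (h.le_self zero_le_one)
  simp only [id]
  nlinarith

theorem continuousOn_ballVol (h : IsCartanHadamardModel ψ) :
    ContinuousOn (ballVol n ψ) (Ici 0) := by
  intro r hr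
  have := intervalIntegral.continuousOn_primitive_interval'
    (h.intervalIntegrable_pow (n - 1) le_rfl (by linarith [mem_Ici.1 hr] : 0 ≤ r + 1))
    (left_mem_uIcc)
  have hr0 := mem_Ici.1 hr
  rw [uIcc_of_le (by linarith)] at this
  refine (this r ⟨hr, by linarith⟩).mono_of_mem_nhdsWithin ?_
  rw [← Ici_inter_Iic]
  exact inter_mem self_mem_nhdsWithin (mem_nhdsWithin_of_mem_nhds (Iic_mem_nhds (by linarith)))

/-- Convexity makes ψ' increasing, so (ψ^n)' = n ψ^{n-1} ψ' is at most n ψ'(r) V' on (0, r];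
integrating from s and letting s → 0 gives the bound. It is the geometric input of the Pohozaev
inequality. -/
theorem pow_le_deriv_mul_ballVol (h : IsCartanHadamardModel ψ) (hn : 1 ≤ n) {r : ℝ} (hr : 0 < r) :
    ψ r ^ n ≤ n * (deriv ψ r * ballVol n ψ r) := by
  have hlim : ∀ s ∈ Ioo 0 r, ψ r ^ n - ψ s ^ n ≤
      n * (deriv ψ r * ballVol n ψ r) - n * (deriv ψ r * ballVol n ψ s) := by
    intro s hs
    refine sub_le_sub_of_hasDerivAt_le hs.2.le (f := fun x => ψ x ^ n)
      (fun x hx => (h.hasDerivAt (hs.1.trans_le hx.1)).pow n)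
      (fun x hx => ((h.hasDerivAt_ballVol (hs.1.trans_le hx.1)).const_mul _).const_mul _) ?_
    intro x hx
    have hx0 := hs.1.trans hx.1
    have h1 := h.monotoneOn_deriv hx0 hr hx.2.le
    have h2 : 0 ≤ ψ x ^ (n - 1) := pow_nonneg (h.nonneg hx0.le) _
    have h3 : (0 : ℝ) ≤ n := n.cast_nonneg
    calc (n : ℝ) * ψ x ^ (n - 1) * deriv ψ x = n * (deriv ψ x * ψ x ^ (n - 1)) := by ring
      _ ≤ _ := by gcongr
  have t1 : Tendsto (fun s => ψ r ^ n - ψ s ^ n) (𝓝[>] 0) (𝓝 (ψ r ^ n - ψ 0 ^ n)) :=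
    tendsto_const_nhds.sub (((h.continuousOn_pow n) 0 self_mem_Ici).mono_left
      (nhdsWithin_mono _ Ioi_subset_Ici_self))
  have t2 : Tendsto (fun s => n * (deriv ψ r * ballVol n ψ r) - n * (deriv ψ r * ballVol n ψ s))
      (𝓝[>] 0) (𝓝 (n * (deriv ψ r * ballVol n ψ r) - n * (deriv ψ r * ballVol n ψ 0))) :=
    tendsto_const_nhds.sub ((((h.continuousOn_ballVol 0 self_mem_Ici).mono_left
      (nhdsWithin_mono _ Ioi_subset_Ici_self)).const_mul _).const_mul _)
  have := le_of_tendsto_of_tendsto t1 t2 (by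
    filter_upwards [Ioo_mem_nhdsGT hr] with s hs using hlim s hs)
  rw [h.map_zero, zero_pow (by omega)] at this
  have h0 : ballVol n ψ 0 = 0 := by simp [ballVol]
  simpa [h0] using this

theorem Theta_pos (h : IsCartanHadamardModel ψ) {r : ℝ} (hr : 0 < r) : 0 < Theta n ψ r :=
  div_pos (h.ballVol_pos hr) (pow_pos (h.pos hr) _)

theorem Theta_nonneg (h : IsCartanHadamardModel ψ) {r : ℝ} (hr : 0 ≤ r) : 0 ≤ Theta n ψ r := by
  rcases hr.eq_or_lt with rfl | hr
  · simp [Theta]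
  · exact (h.Theta_pos hr).le

theorem Theta_le (h : IsCartanHadamardModel ψ) {r : ℝ} (hr : 0 ≤ r) : Theta n ψ r ≤ r := by
  rcases hr.eq_or_lt with rfl | hr
  · simp [Theta]
  · rw [Theta_eq, div_le_iff₀ (pow_pos (h.pos hr) _)]
    exact h.ballVol_le hr.le

theorem Theta_mul (h : IsCartanHadamardModel ψ) {r : ℝ} (hr : 0 < r) :
    Theta n ψ r * ψ r ^ (n - 1) = ballVol n ψ r := by
  rw [Theta_eq, div_mul_cancel₀]
  exact (pow_pos (h.pos hr) _).ne'

/-- Division by ψ^{n-1} turns a primitive into the solution of a linear first order equation.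
Applied to V it governs Θ, applied to the flux it governs the power p-1 of the speed. -/
theorem hasDerivAt_inv_pow (h : IsCartanHadamardModel ψ) {f : ℝ → ℝ} {f' r : ℝ} (hr : 0 < r)
    (hf : HasDerivAt f f' r) :
    HasDerivAt (fun x => f x / ψ x ^ (n - 1))
      (f' / ψ r ^ (n - 1) - (n - 1 : ℕ) * (deriv ψ r / ψ r) * (f r / ψ r ^ (n - 1))) r := by
  have hψ := h.pos hr
  refine HasDerivAt.congr_deriv (hf.div ((h.hasDerivAt hr).pow (n - 1)) (pow_pos hψ _).ne') ?_
  rcases Nat.eq_zero_or_pos (n - 1) with h0 | h0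
  · simp [h0]
  · obtain ⟨m, hm⟩ : ∃ m, n - 1 = m + 1 := ⟨n - 1 - 1, by omega⟩
    rw [hm]
    field_simp
    simp
    ring

theorem hasDerivAt_Theta (h : IsCartanHadamardModel ψ) {r : ℝ} (hr : 0 < r) :
    HasDerivAt (Theta n ψ) (1 - (n - 1 : ℕ) * (deriv ψ r / ψ r) * Theta n ψ r) r := by
  have := h.hasDerivAt_inv_pow (n := n) hr (h.hasDerivAt_ballVol (n := n) hr)
  rwa [div_self (pow_pos (h.pos hr) _).ne'] at this

theorem continuousOn_Theta (h : IsCartanHadamardModel ψ) : ContinuousOn (Theta n ψ) (Ioi 0) :=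
  fun _ hr => (h.hasDerivAt_Theta hr).continuousAt.continuousWithinAt

theorem continuousOn_Theta_rpow (h : IsCartanHadamardModel ψ) (s : ℝ) :
    ContinuousOn (fun r => Theta n ψ r ^ s) (Ioi 0) :=
  h.continuousOn_Theta.rpow_const fun _ hr => Or.inl (h.Theta_pos hr).ne'

theorem intervalIntegrable_Theta_rpow (h : IsCartanHadamardModel ψ) {s r : ℝ} (hs : 0 ≤ s)
    (hr : 0 ≤ r) : IntervalIntegrable (fun t => Theta n ψ t ^ s) volume 0 r := by
  refine intervalIntegrable_of_bdd hr
    ((h.continuousOn_Theta_rpow s).mono Ioc_subset_Ioi_self) (C := r ^ s) fun t ht => ?_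
  rw [Real.norm_of_nonneg (Real.rpow_nonneg (h.Theta_nonneg ht.1.le) _)]
  exact Real.rpow_le_rpow (h.Theta_nonneg ht.1.le) ((h.Theta_le ht.1.le).trans ht.2) hs

theorem hasDerivAt_thetaInt (h : IsCartanHadamardModel ψ) (hp : 1 < p) {r : ℝ} (hr : 0 < r) :
    HasDerivAt (thetaInt n p ψ) (Theta n ψ r ^ (1 / (p - 1))) r :=
  hasDerivAt_integral_of_continuousOn isOpen_Ioi (h.continuousOn_Theta_rpow _) hr
    (h.intervalIntegrable_Theta_rpow (by have : 0 < p - 1 := by linarith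
                                         positivity) hr.le)

theorem thetaInt_pos (h : IsCartanHadamardModel ψ) (hp : 1 < p) {r : ℝ} (hr : 0 < r) :
    0 < thetaInt n p ψ r := by
  have : 0 < p - 1 := by linarith
  exact intervalIntegral.intervalIntegral_pos_of_pos_on
    (h.intervalIntegrable_Theta_rpow (by positivity) hr.le)
    (fun _ hx => Real.rpow_pos_of_pos (h.Theta_pos hx.1) _) hr

theorem thetaInt_le (h : IsCartanHadamardModel ψ) (hp : 1 < p) {r s : ℝ} (hr : 0 < r)
    (hrs : r ≤ s) : thetaInt n p ψ r ≤ thetaInt n p ψ s :=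
  le_of_hasDerivAt_nonneg hrs (fun _ hx => h.hasDerivAt_thetaInt hp (hr.trans_le hx.1))
    fun _ hx => Real.rpow_nonneg (h.Theta_nonneg (hr.trans hx.1).le) _

end IsCartanHadamardModel

/-! ### Comparison at infinity -/

/-- An integrated form of l'Hôpital's rule: the inequality of derivatives integrates up to an
additive constant, which ε g absorbs because g tends to infinity. -/
theorem eventually_le_mul_of_deriv_le {f g f' g' : ℝ → ℝ} {c ε : ℝ} (hε : 0 < ε)
    (hf : ∀ᶠ r in atTop, HasDerivAt f (f' r) r) (hg : ∀ᶠ r in atTop, HasDerivAt g (g' r) r)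
    (h : ∀ᶠ r in atTop, f' r ≤ c * g' r) (hlim : Tendsto g atTop atTop) :
    ∀ᶠ r in atTop, f r ≤ (c + ε) * g r := by
  obtain ⟨R, hR⟩ := eventually_atTop.1 (hf.and (hg.and h))
  filter_upwards [eventually_ge_atTop R, hlim.eventually_ge_atTop ((f R - c * g R) / ε)]
    with r hr hgr
  have := sub_le_sub_of_hasDerivAt_le hr (fun x hx => (hR x hx.1).1)
    (fun x hx => ((hR x hx.1).2.1).const_mul c) (fun x hx => (hR x hx.1.le).2.2)
  rw [div_le_iff₀ hε] at hgr
  linarith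

theorem eventually_mul_le_of_le_deriv {f g f' g' : ℝ → ℝ} {c ε : ℝ} (hε : 0 < ε)
    (hf : ∀ᶠ r in atTop, HasDerivAt f (f' r) r) (hg : ∀ᶠ r in atTop, HasDerivAt g (g' r) r)
    (h : ∀ᶠ r in atTop, c * g' r ≤ f' r) (hlim : Tendsto g atTop atTop) :
    ∀ᶠ r in atTop, (c - ε) * g r ≤ f r := by
  have := eventually_le_mul_of_deriv_le (f := fun x => -f x) (f' := fun x => -f' x) (c := -c) hε
    (hf.mono fun _ hx => hx.neg) hg (h.mono fun _ hx => by linarith) hlim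
  filter_upwards [this] with r hr
  linarith

/-! ### Radial profiles -/

/-- The exponent `k = (q+1-p)/(p-1)` for which `u^{-k}` is comparable with the primitive of
`Θ^{1/(p-1)}`. -/
def decayExp (p q : ℝ) : ℝ := (q + 1 - p) / (p - 1)

theorem decayExp_pos {p q : ℝ} (hp : 1 < p) (hpq : p - 1 < q) : 0 < decayExp p q :=
  div_pos (by linarith) (by linarith)

theorem decayExp_add_one {p q : ℝ} (hp : 1 < p) : decayExp p q + 1 = q * (1 / (p - 1)) := by
  have : p - 1 ≠ 0 := by linarith
  rw [decayExp]
  field_simp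
  ring

/-- `∫₀ʳ ψ^{n-1} u^q`. -/
def flux (n : ℕ) (q : ℝ) (ψ u : ℝ → ℝ) (r : ℝ) : ℝ := ∫ s in (0 : ℝ)..r, ψ s ^ (n - 1) * u s ^ q

/-- The modulus of the derivative of a radial solution. -/
def speed (n : ℕ) (p q : ℝ) (ψ u : ℝ → ℝ) (r : ℝ) : ℝ :=
  (flux n q ψ u r / ψ r ^ (n - 1)) ^ (1 / (p - 1))

/-- `u` is a positive solution on `(0, ∞)` of the integrated radial equation. -/
structure IsProfile (n : ℕ) (p q : ℝ) (ψ u : ℝ → ℝ) : Prop where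
  pos : ∀ r, 0 < r → 0 < u r
  integrable : ∀ r, 0 < r → IntervalIntegrable (fun s => ψ s ^ (n - 1) * u s ^ q) volume 0 r
  hasDerivAt : ∀ r, 0 < r → HasDerivAt u (-speed n p q ψ u r) r

/-- The flux normalised by its integrand. -/
def relFlux (n : ℕ) (q : ℝ) (ψ u : ℝ → ℝ) (r : ℝ) : ℝ :=
  flux n q ψ u r / ψ r ^ (n - 1) / u r ^ q

namespace IsProfile

variable {n : ℕ} {p q : ℝ} {ψ u : ℝ → ℝ}

theorem continuousOn (hu : IsProfile n p q ψ u) : ContinuousOn u (Ioi 0) :=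
  fun r hr => (hu.hasDerivAt r hr).continuousAt.continuousWithinAt

theorem continuousOn_integrand (hu : IsProfile n p q ψ u) (h : IsCartanHadamardModel ψ) :
    ContinuousOn (fun s => ψ s ^ (n - 1) * u s ^ q) (Ioi 0) :=
  ((h.continuousOn_pow _).mono Ioi_subset_Ici_self).mul
    (hu.continuousOn.rpow_const fun r hr => Or.inl (hu.pos r hr).ne')

theorem hasDerivAt_flux (hu : IsProfile n p q ψ u) (h : IsCartanHadamardModel ψ) {r : ℝ}
    (hr : 0 < r) : HasDerivAt (flux n q ψ u) (ψ r ^ (n - 1) * u r ^ q) r :=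
  hasDerivAt_integral_of_continuousOn isOpen_Ioi (hu.continuousOn_integrand h) hr (hu.integrable r hr)

theorem flux_pos (hu : IsProfile n p q ψ u) (h : IsCartanHadamardModel ψ) {r : ℝ}
    (hr : 0 < r) : 0 < flux n q ψ u r :=
  intervalIntegral.intervalIntegral_pos_of_pos_on (hu.integrable r hr)
    (fun x hx => mul_pos (pow_pos (h.pos hx.1) _) (Real.rpow_pos_of_pos (hu.pos x hx.1) _)) hr

theorem speed_pos (hu : IsProfile n p q ψ u) (h : IsCartanHadamardModel ψ) {r : ℝ}
    (hr : 0 < r) : 0 < speed n p q ψ u r :=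
  Real.rpow_pos_of_pos (div_pos (hu.flux_pos h hr) (pow_pos (h.pos hr) _)) _

theorem le_of_le (hu : IsProfile n p q ψ u) (h : IsCartanHadamardModel ψ) {s r : ℝ}
    (hs : 0 < s) (hsr : s ≤ r) : u r ≤ u s :=
  le_of_hasDerivAt_nonpos hsr (fun x hx => hu.hasDerivAt x (hs.trans_le hx.1))
    fun _ hx => neg_nonpos.2 (hu.speed_pos h (hs.trans hx.1)).le

theorem rpow_mul_ballVol_le_flux (hu : IsProfile n p q ψ u) (h : IsCartanHadamardModel ψ)
    (hq : 0 ≤ q) {r : ℝ} (hr : 0 < r) : u r ^ q * ballVol n ψ r ≤ flux n q ψ u r := by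
  rw [ballVol, ← intervalIntegral.integral_const_mul]
  refine intervalIntegral.integral_mono_on_of_le_Ioo hr.le
    ((h.intervalIntegrable_pow _ le_rfl hr.le).const_mul _) (hu.integrable r hr) fun x hx => ?_
  rw [mul_comm]
  exact mul_le_mul_of_nonneg_left
    (Real.rpow_le_rpow (hu.pos r hr).le (hu.le_of_le h hx.1 hx.2.le) hq)
    (pow_nonneg (h.nonneg hx.1.le) _)

theorem relFlux_pos (hu : IsProfile n p q ψ u) (h : IsCartanHadamardModel ψ) {r : ℝ}
    (hr : 0 < r) : 0 < relFlux n q ψ u r :=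
  div_pos (div_pos (hu.flux_pos h hr) (pow_pos (h.pos hr) _)) (Real.rpow_pos_of_pos (hu.pos r hr) _)

/-- Monotonicity of u gives flux ≥ u^q V. Together with `hasDerivAt_rpow_neg` this yields (u^{-k})'
≥ k Θ^b for every profile, the half of the asymptotics that needs no assumption on the growth of ψ.
-/
theorem Theta_le_relFlux (hu : IsProfile n p q ψ u) (h : IsCartanHadamardModel ψ)
    (hq : 0 ≤ q) {r : ℝ} (hr : 0 < r) : Theta n ψ r ≤ relFlux n q ψ u r := by
  have h1 := Real.rpow_pos_of_pos (hu.pos r hr) q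
  rw [relFlux, le_div_iff₀ h1, Theta_eq, div_mul_eq_mul_div]
  gcongr
  · exact pow_nonneg (h.nonneg hr.le) _
  · rw [mul_comm]; exact hu.rpow_mul_ballVol_le_flux h hq hr

theorem speed_eq (hu : IsProfile n p q ψ u) (h : IsCartanHadamardModel ψ) (hp : 1 < p) {r : ℝ}
    (hr : 0 < r) : speed n p q ψ u r =
      u r ^ (decayExp p q + 1) * relFlux n q ψ u r ^ (1 / (p - 1)) := by
  have h1 := Real.rpow_pos_of_pos (hu.pos r hr) q
  rw [decayExp_add_one hp, Real.rpow_mul (hu.pos r hr).le,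
    ← Real.mul_rpow h1.le (hu.relFlux_pos h hr).le, relFlux, mul_div_cancel₀ _ h1.ne', speed]

/-- The exponent -k is the one for which the factor u^{k+1} in `speed_eq` cancels, so that u enters
the derivative only through `relFlux`. -/
theorem hasDerivAt_rpow_neg (hu : IsProfile n p q ψ u) (h : IsCartanHadamardModel ψ) (hp : 1 < p)
    {r : ℝ} (hr : 0 < r) : HasDerivAt (fun x => u x ^ (-decayExp p q))
      (decayExp p q * relFlux n q ψ u r ^ (1 / (p - 1))) r := by
  have h1 := hu.pos r hr
  refine ((hu.hasDerivAt r hr).rpow_const (Or.inl h1.ne')).congr_deriv ?_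
  rw [hu.speed_eq h hp hr]
  have : u r ^ (decayExp p q + 1) * u r ^ (-decayExp p q - 1) = 1 := by
    rw [← Real.rpow_add h1]; simp
  linear_combination decayExp p q * relFlux n q ψ u r ^ (1 / (p - 1)) * this

theorem rpow_mul_le_iff (hu : IsProfile n p q ψ u) {r x y : ℝ} (hr : 0 < r) :
    u r ^ decayExp p q * x ≤ y ↔ x ≤ y * u r ^ (-decayExp p q) := by
  rw [Real.rpow_neg (hu.pos r hr).le, ← div_eq_mul_inv,
    le_div_iff₀ (Real.rpow_pos_of_pos (hu.pos r hr) _), mul_comm]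

/-- The difference flux - u^q V measures how far `relFlux` exceeds Θ; in its derivative the terms
ψ^{n-1} u^q cancel and only the contribution of u' remains. -/
theorem hasDerivAt_flux_sub (hu : IsProfile n p q ψ u) (h : IsCartanHadamardModel ψ) {r : ℝ}
    (hr : 0 < r) : HasDerivAt (fun x => flux n q ψ u x - u x ^ q * ballVol n ψ x)
      (q * u r ^ (q - 1) * speed n p q ψ u r * ballVol n ψ r) r := by
  have h1 := hu.pos r hr
  refine ((hu.hasDerivAt_flux h hr).sub (((hu.hasDerivAt r hr).rpow_const (p := q)
    (Or.inl h1.ne')).mul (h.hasDerivAt_ballVol hr))).congr_deriv ?_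
  ring

end IsProfile

/-! ### The lower limit condition -/

/-- The numerator of `ratio`. -/
def ratioNum (n : ℕ) (p : ℝ) (ψ : ℝ → ℝ) (r : ℝ) : ℝ :=
  ∫ s in (0 : ℝ)..r, Theta n ψ s ^ (p / (p - 1)) * ψ s ^ (n - 1)

namespace IsCartanHadamardModel

variable {n : ℕ} {p : ℝ} {ψ : ℝ → ℝ}

theorem ratio_eq (h : IsCartanHadamardModel ψ) {r : ℝ} (hr : 0 < r) :
    ratio n p ψ r = ratioNum n p ψ r / (ballVol n ψ r * thetaInt n p ψ r) := by
  rw [ratio, mul_comm (ψ r ^ (n - 1)), h.Theta_mul hr]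
  rfl

theorem intervalIntegrable_ratioNum (h : IsCartanHadamardModel ψ) (hp : 1 < p) {r : ℝ}
    (hr : 0 ≤ r) : IntervalIntegrable (fun s => Theta n ψ s ^ (p / (p - 1)) * ψ s ^ (n - 1))
      volume 0 r :=
  (h.intervalIntegrable_Theta_rpow (by have : 0 < p - 1 := by linarith
                                       positivity) hr).mul_continuousOn
    ((h.continuousOn_pow _).mono (by rw [uIcc_of_le hr]; exact Icc_subset_Ici_self))

/-- Since Θ ψ^{n-1} = V, the numerator of `ratio` is the integral of V against dH. So `ratio`
compares the mean of V with respect to dH on (0, r) with its final value V(r). -/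
theorem hasDerivAt_ratioNum (h : IsCartanHadamardModel ψ) (hp : 1 < p) {r : ℝ} (hr : 0 < r) :
    HasDerivAt (ratioNum n p ψ) (Theta n ψ r ^ (1 / (p - 1)) * ballVol n ψ r) r := by
  have h1 := h.Theta_pos (n := n) hr
  refine (hasDerivAt_integral_of_continuousOn isOpen_Ioi ((h.continuousOn_Theta_rpow _).mul
    ((h.continuousOn_pow _).mono Ioi_subset_Ici_self)) hr
    (h.intervalIntegrable_ratioNum hp hr.le)).congr_deriv ?_
  have h2 : p / (p - 1) = 1 / (p - 1) + 1 := by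
    have : p - 1 ≠ 0 := by linarith
    field_simp
    ring
  simp only [Pi.mul_apply]
  rw [h2, Real.rpow_add h1, Real.rpow_one, mul_assoc, h.Theta_mul hr]

theorem ratioNum_nonneg (h : IsCartanHadamardModel ψ) {r : ℝ} (hr : 0 ≤ r) :
    0 ≤ ratioNum n p ψ r :=
  intervalIntegral.integral_nonneg hr fun _ hx =>
    mul_nonneg (Real.rpow_nonneg (h.Theta_nonneg hx.1) _) (pow_nonneg (h.nonneg hx.1) _)

theorem le_ratio_iff (h : IsCartanHadamardModel ψ) (hp : 1 < p) {r ε : ℝ} (hr : 0 < r) :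
    ε ≤ ratio n p ψ r ↔ ε * (ballVol n ψ r * thetaInt n p ψ r) ≤ ratioNum n p ψ r := by
  rw [h.ratio_eq hr, le_div_iff₀ (mul_pos (h.ballVol_pos hr) (h.thetaInt_pos hp hr))]

theorem ratioNum_sub_le (h : IsCartanHadamardModel ψ) (hp : 1 < p) {s r : ℝ} (hs : 0 < s)
    (hsr : s ≤ r) : ratioNum n p ψ r - ratioNum n p ψ s ≤
      ballVol n ψ r * (thetaInt n p ψ r - thetaInt n p ψ s) := by
  rw [mul_sub]
  refine sub_le_sub_of_hasDerivAt_le hsr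
    (fun x hx => h.hasDerivAt_ratioNum hp (hs.trans_le hx.1))
    (fun x hx => (h.hasDerivAt_thetaInt hp (hs.trans_le hx.1)).const_mul _) fun x hx => ?_
  have hx0 := hs.trans hx.1
  rw [mul_comm]
  exact mul_le_mul_of_nonneg_right (h.monotoneOn_ballVol hx0.le (hx0.trans hx.2).le hx.2.le)
    (Real.rpow_nonneg (h.Theta_nonneg hx0.le) _)

theorem le_ratioNum_sub (h : IsCartanHadamardModel ψ) (hp : 1 < p) {s r : ℝ} (hs : 0 < s)
    (hsr : s ≤ r) : ballVol n ψ s * (thetaInt n p ψ r - thetaInt n p ψ s) ≤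
      ratioNum n p ψ r - ratioNum n p ψ s := by
  rw [mul_sub]
  refine sub_le_sub_of_hasDerivAt_le hsr
    (fun x hx => (h.hasDerivAt_thetaInt hp (hs.trans_le hx.1)).const_mul _)
    (fun x hx => h.hasDerivAt_ratioNum hp (hs.trans_le hx.1)) fun x hx => ?_
  have hx0 := hs.trans hx.1
  rw [mul_comm (Theta n ψ x ^ _)]
  exact mul_le_mul_of_nonneg_right (h.monotoneOn_ballVol hs.le hx0.le hx.1.le)
    (Real.rpow_nonneg (h.Theta_nonneg hx0.le) _)

/-- If H were bounded, nearly all of its mass would lie in a fixed interval (0, R]. The part of the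
numerator beyond R is at most V(r) (H(r) - H(R)), a small multiple of V(r), and the part before R is
a constant, negligible because V → ∞; this contradicts the lower bound on `ratio`. -/
theorem tendsto_thetaInt_of_le_ratio (h : IsCartanHadamardModel ψ) (hp : 1 < p) {ε : ℝ}
    (hε : 0 < ε) (hr : ∀ᶠ r in atTop, ε ≤ ratio n p ψ r) :
    Tendsto (thetaInt n p ψ) atTop atTop := by
  by_contra hcon
  have hbdd : ∃ B, ∀ r, 1 ≤ r → thetaInt n p ψ r ≤ B := by
    by_contra! hB
    refine hcon (tendsto_atTop.2 fun b => ?_)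
    obtain ⟨r, hr, hb⟩ := hB b
    filter_upwards [eventually_ge_atTop r] with s hs
    exact hb.le.trans (h.thetaInt_le hp (by linarith) hs)
  obtain ⟨B, hB⟩ := hbdd
  set S := (thetaInt n p ψ) '' Ici 1 with hS
  have hSne : S.Nonempty := ⟨_, 1, self_mem_Ici, rfl⟩
  have hSb : BddAbove S := ⟨B, by rintro _ ⟨r, hr, rfl⟩; exact hB r hr⟩
  have hle : ∀ r, 1 ≤ r → thetaInt n p ψ r ≤ sSup S := fun r hr => le_csSup hSb ⟨r, hr, rfl⟩
  set M := sSup S with hM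
  have hMpos : 0 < M := (h.thetaInt_pos hp one_pos).trans_le (hle 1 le_rfl)
  -- R is chosen so that H(R) > M/2, which bounds the denominator of `ratio` from below, and so that
  -- H increases by less than εM/4 after R.
  have hc : max (M / 2) (M - ε * M / 4) < M := by
    apply max_lt <;> nlinarith [mul_pos hε hMpos]
  obtain ⟨_, ⟨R, hR1, rfl⟩, hR⟩ := exists_lt_of_lt_csSup hSne hc
  have hR0 : 0 < R := one_pos.trans_le hR1
  obtain ⟨r, hrR, hrε, hrV⟩ := ((eventually_ge_atTop R).and (hr.and
    ((h.tendsto_ballVol (n := n)).eventually_ge_atTop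
      (ratioNum n p ψ R * 8 / (ε * M))))).exists
  have hr0 := hR0.trans_le hrR
  rw [h.le_ratio_iff hp hr0] at hrε
  rw [div_le_iff₀ (by positivity)] at hrV
  have h1 := h.ratioNum_sub_le (n := n) hp hR0 hrR
  have h2 := h.thetaInt_le (n := n) hp hR0 hrR
  have h3 := hle r (hR1.trans hrR)
  have hV := h.ballVol_pos (n := n) hr0
  have h4 : M / 2 < thetaInt n p ψ R := (le_max_left _ _).trans_lt hR
  have h5 : M - ε * M / 4 < thetaInt n p ψ R := (le_max_right _ _).trans_lt hR
  have h6 : ballVol n ψ r * (thetaInt n p ψ r - thetaInt n p ψ R) ≤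
      ballVol n ψ r * (ε * M / 4) := by gcongr; linarith
  have h7 : ε * (ballVol n ψ r * (M / 2)) ≤ ε * (ballVol n ψ r * thetaInt n p ψ r) := by
    gcongr; linarith
  have h8 : 0 < ballVol n ψ r * (ε * M) := by positivity
  nlinarith

theorem pStochasticallyComplete (h : IsCartanHadamardModel ψ)
    (hlim : Tendsto (thetaInt n p ψ) atTop atTop) : PStochasticallyComplete n p ψ := by
  intro hint
  obtain ⟨r, hr0, hr⟩ := ((eventually_ge_atTop 0).and (hlim.eventually_gt_atTop
    (∫ s in Ioi 0, Theta n ψ s ^ (1 / (p - 1))))).exists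
  refine hr.not_ge ?_
  rw [thetaInt, intervalIntegral.integral_of_le hr0]
  refine setIntegral_mono_set hint ?_ Ioc_subset_Ioi_self.eventuallyLE
  exact (ae_restrict_iff' measurableSet_Ioi).2 (Eventually.of_forall fun x hx =>
    Real.rpow_nonneg (h.Theta_nonneg (le_of_lt hx)) _)

end IsCartanHadamardModel

theorem LiminfCondition.exists_le_ratio {n : ℕ} {p : ℝ} {ψ : ℝ → ℝ}
    (h : LiminfCondition n p ψ) : ∃ ε > 0, ∀ᶠ r in atTop, ε ≤ ratio n p ψ r := by
  obtain ⟨ε, h1, h2⟩ := EReal.lt_iff_exists_real_btwn.1 h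
  refine ⟨ε, by exact_mod_cast h1, (eventually_lt_of_lt_liminf h2).mono fun r hr => ?_⟩
  exact_mod_cast hr.le

theorem LiminfCondition.of_le_ratio {n : ℕ} {p ε : ℝ} {ψ : ℝ → ℝ} (hε : 0 < ε)
    (h : ∀ᶠ r in atTop, ε ≤ ratio n p ψ r) : LiminfCondition n p ψ := by
  refine lt_of_lt_of_le (b := (ε : EReal)) (by exact_mod_cast hε) ?_
  exact le_liminf_of_le (h := h.mono fun r hr => by exact_mod_cast hr)

/-- If `ratio` is bounded below then no profile has the expected asymptotics, quantitatively. -/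
theorem exists_frequently_rpow_mul_thetaInt_le {p q ε : ℝ} (hp : 1 < p) (hpq : p - 1 < q)
    (hε : 0 < ε) : ∃ δ, 0 < δ ∧ δ < 1 ∧ ∀ (n : ℕ) (ψ u : ℝ → ℝ), IsCartanHadamardModel ψ →
      IsProfile n p q ψ u → (∀ᶠ r in atTop, ε ≤ ratio n p ψ r) →
      ∃ᶠ r in atTop, u r ^ decayExp p q * thetaInt n p ψ r ≤ (1 - δ) / decayExp p q := by
  have hk := decayExp_pos hp hpq
  set k := decayExp p q with hkdef
  have hp1 : 0 < p - 1 := by linarith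
  have hq : 0 < q := by linarith
  have hb : 0 < 1 / (p - 1) := by positivity
  set b := 1 / (p - 1) with hbdef
  -- The relative gain in `relFlux`: q ε comes from the lower bound on `ratio`, 1/(2k) from the
  -- assumed lower bound on u^k H, and a last factor 1/2 pays for integrating from R instead of 0.
  set a := q * ε / (4 * k) with ha
  have ha0 : 0 < a := by positivity
  set A := (1 + a) ^ b with hA
  have hA1 : 1 < A := Real.one_lt_rpow (by linarith) hb
  set A' := (1 + A) / 2 with hA'
  have hA'1 : 1 < A' := by linarith
  have hA'inv : 1 / A' < 1 := by rw [div_lt_one (by linarith)]; exact hA'1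
  have hA'inv0 : 0 < 1 / A' := by positivity
  -- δ ≤ 1/2 turns u^k H > (1-δ)/k into u^k H ≥ 1/(2k); the other bound gives 1/A' ≤ 1-δ, which
  -- contradicts the improved growth of u^{-k}.
  refine ⟨min (1 / 2) ((1 - 1 / A') / 2), lt_min (by norm_num) (by linarith),
    (min_le_left _ _).trans_lt (by norm_num), fun n ψ u h hu hr => ?_⟩
  set δ := min (1 / 2) ((1 - 1 / A') / 2) with hδ
  have hlim := h.tendsto_thetaInt_of_le_ratio hp hε hr
  by_contra hfr
  rw [not_frequently] at hfr
  push Not at hfr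
  obtain ⟨R, hR⟩ := eventually_atTop.1 ((eventually_ge_atTop 1).and hr)
  have hR0 : ∀ r, R ≤ r → 0 < r := fun r hRr => one_pos.trans_le (hR r hRr).1
  have hJlim : Tendsto (ratioNum n p ψ) atTop atTop := by
    have : Tendsto (fun r => ε * (ballVol n ψ r * thetaInt n p ψ r)) atTop atTop :=
      ((h.tendsto_ballVol).atTop_mul_atTop₀ hlim).const_mul_atTop hε
    refine tendsto_atTop_mono' _ ?_ this
    filter_upwards [eventually_ge_atTop R] with r hRr
    exact (h.le_ratio_iff hp (hR0 r hRr)).1 (hR r hRr).2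
  have key : ∀ᶠ r in atTop, (1 + a) * Theta n ψ r ≤ relFlux n q ψ u r := by
    filter_upwards [eventually_ge_atTop R, hfr,
      hJlim.eventually_ge_atTop (2 * ratioNum n p ψ R)] with r hRr hr1 hr2
    have hr0 := hR0 r hRr
    have hur := hu.pos r hr0
    have hV := h.ballVol_pos (n := n) hr0
    -- Integration over [R, r] with the coefficient u^{q+k} frozen at its smallest value, attained
    -- at r, and with `relFlux` replaced by Θ.
    have hD := sub_le_sub_of_hasDerivAt_le hRr
      (fun x hx => (h.hasDerivAt_ratioNum (n := n) hp (hR0 x hx.1)).const_mul (q * u r ^ (q + k)))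
      (fun x hx => hu.hasDerivAt_flux_sub h (hR0 x hx.1)) (by
        intro x hx
        have hx0 := hR0 x hx.1.le
        have hux := hu.pos x hx0
        have e1 := hu.speed_eq h hp hx0
        have e2 : u x ^ (q - 1) * u x ^ (k + 1) = u x ^ (q + k) := by
          rw [← Real.rpow_add hux]; congr 1; ring
        have e3 : u r ^ (q + k) ≤ u x ^ (q + k) :=
          Real.rpow_le_rpow hur.le (hu.le_of_le h hx0 hx.2.le) (by positivity)
        have e4 : Theta n ψ x ^ b ≤ relFlux n q ψ u x ^ b :=
          Real.rpow_le_rpow (h.Theta_nonneg hx0.le) (hu.Theta_le_relFlux h hq.le hx0) hb.le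
        have e5 := h.ballVol_pos (n := n) hx0
        have e6 := Real.rpow_nonneg (h.Theta_nonneg (n := n) hx0.le) b
        calc q * u r ^ (q + k) * (Theta n ψ x ^ b * ballVol n ψ x)
            ≤ q * u x ^ (q + k) * (relFlux n q ψ u x ^ b * ballVol n ψ x) := by gcongr
          _ = _ := by rw [e1, ← e2]; ring)
    have hD0 := hu.rpow_mul_ballVol_le_flux h hq.le (hR0 R le_rfl)
    have hJ := (h.le_ratio_iff hp hr0).1 (hR r hRr).2
    have hq0 : 0 ≤ q * u r ^ (q + k) := by positivity
    have hD1 : q * u r ^ (q + k) * (ε * (ballVol n ψ r * thetaInt n p ψ r) / 2) ≤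
        flux n q ψ u r - u r ^ q * ballVol n ψ r := by
      have : q * u r ^ (q + k) * (ε * (ballVol n ψ r * thetaInt n p ψ r) / 2) ≤
        q * u r ^ (q + k) * (ratioNum n p ψ r - ratioNum n p ψ R) := by
        gcongr; linarith
      linarith
    have hδ2 : δ ≤ 1 / 2 := min_le_left _ _
    have hD2 : 1 / (2 * k) ≤ u r ^ k * thetaInt n p ψ r := by
      refine le_trans ?_ hr1.le
      rw [div_le_div_iff₀ (by positivity) hk]
      nlinarith
    have hD3 : u r ^ q * ballVol n ψ r * a ≤ flux n q ψ u r - u r ^ q * ballVol n ψ r := by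
      refine le_trans ?_ hD1
      rw [Real.rpow_add hur]
      have hc : 0 ≤ q * u r ^ q * ε * ballVol n ψ r / 2 := by positivity
      calc u r ^ q * ballVol n ψ r * a
          = q * u r ^ q * ε * ballVol n ψ r / 2 * (1 / (2 * k)) := by
            rw [ha]; field_simp; ring
        _ ≤ q * u r ^ q * ε * ballVol n ψ r / 2 * (u r ^ k * thetaInt n p ψ r) := by gcongr
        _ = _ := by ring
    have hψ := pow_pos (h.pos hr0) (n - 1)
    have huq := Real.rpow_pos_of_pos hur q
    rw [relFlux, div_div, Theta_eq, ← mul_div_assoc, div_le_div_iff₀ hψ (by positivity)]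
    nlinarith
  -- From X ≥ (1+a) Θ one has (u^{-k})' ≥ k A H'. Lowering A to A' absorbs the integration constant
  -- and leaves u^{-k} ≥ k A' H.
  have hw := eventually_mul_le_of_le_deriv (f := fun x => u x ^ (-k)) (c := k * A)
    (ε := k * A - k * A') (by have : A' < A := by linarith
                              nlinarith)
    ((eventually_gt_atTop 0).mono fun r hr0 => hu.hasDerivAt_rpow_neg h hp hr0)
    ((eventually_gt_atTop 0).mono fun r hr0 => h.hasDerivAt_thetaInt hp hr0) (by
      filter_upwards [key, eventually_gt_atTop 0] with r hr1 hr0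
      rw [mul_assoc, hA, ← Real.mul_rpow (by positivity) (h.Theta_nonneg hr0.le)]
      have := h.Theta_nonneg (n := n) hr0.le
      gcongr) hlim
  obtain ⟨r, hr1, hr2, hr0⟩ := (hw.and (hfr.and (eventually_gt_atTop 0))).exists
  refine hr2.not_ge ((hu.rpow_mul_le_iff hr0).2 ?_)
  have h1 : δ ≤ (1 - 1 / A') / 2 := min_le_right _ _
  have h2 : 1 / (k * A') ≤ (1 - δ) / k := by
    rw [mul_comm, ← div_div]; gcongr; linarith
  have h3 : 0 ≤ u r ^ (-k) := Real.rpow_nonneg (hu.pos r hr0).le _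
  calc thetaInt n p ψ r = 1 / (k * A') * ((k * A - (k * A - k * A')) * thetaInt n p ψ r) := by
        field_simp; ring
    _ ≤ 1 / (k * A') * u r ^ (-k) := by gcongr
    _ ≤ _ := by gcongr

/-- Models of power growth satisfy the lower limit condition, quantitatively. -/
theorem exists_le_ratio_of_tendsto {p l : ℝ} (n : ℕ) (hp : 1 < p) :
    ∃ ε > 0, ∀ ψ : ℝ → ℝ, IsCartanHadamardModel ψ →
      Tendsto (fun r => r * deriv ψ r / ψ r) atTop (𝓝 l) →
      ∀ᶠ r in atTop, ε ≤ ratio n p ψ r := by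
  have hp1 : 0 < p - 1 := by linarith
  have hb : 0 < 1 / (p - 1) := by positivity
  set b := 1 / (p - 1) with hbdef
  -- The doubling constant of ψ: far out (log ψ)' ≤ (l+1)/r, which integrates to ψ(r) ≤ 2^{l+1}
  -- ψ(r/2).
  set C : ℝ := 2 ^ (l + 1) with hC
  have hC0 : 0 < C := by positivity
  set c := (C ^ (n - 1))⁻¹ with hc
  have hc0 : 0 < c := by positivity
  -- The first factor is the share of V(r) already present at r/2, the second the share of H(r)
  -- gained on [r/2, r]. Their product bounds `ratio`, since V ≥ V(r/2) on that interval.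
  refine ⟨c ^ 2 / 4 * ((c / 4) ^ b / 2), by positivity, fun ψ h hlim => ?_⟩
  obtain ⟨R, hR⟩ := eventually_atTop.1 ((eventually_ge_atTop 1).and
    (hlim.eventually_le_const (show l < l + 1 by linarith)))
  have hdouble : ∀ r, 2 * R ≤ r → c * ψ r ^ (n - 1) ≤ ψ (r / 2) ^ (n - 1) := by
    intro r hr
    have hR1 := (hR R le_rfl).1
    have hr2 : 0 < r / 2 := by linarith
    have hr0 : 0 < r := by linarith
    have := sub_le_sub_of_hasDerivAt_le (show r / 2 ≤ r by linarith)
      (fun x hx => (h.hasDerivAt (hr2.trans_le hx.1)).log (h.pos (hr2.trans_le hx.1)).ne')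
      (fun x hx => (Real.hasDerivAt_log (hr2.trans_le hx.1).ne').const_mul (l + 1)) (by
        intro x hx
        have hx0 := hr2.trans hx.1
        have := (hR x (by linarith [hx.1])).2
        have hψ := h.pos hx0
        rw [div_le_iff₀ hψ] at this
        rw [← div_eq_mul_inv, div_le_div_iff₀ hψ hx0]
        linarith)
    rw [← mul_sub, ← Real.log_div hr0.ne' hr2.ne', ← Real.log_div (h.pos hr0).ne' (h.pos hr2).ne',
      show r / (r / 2) = 2 by field_simp, ← Real.log_rpow two_pos,
      Real.log_le_log_iff (div_pos (h.pos hr0) (h.pos hr2)) hC0, div_le_iff₀ (h.pos hr2)] at this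
    rw [hc, inv_mul_le_iff₀ (by positivity), ← mul_pow]
    exact pow_le_pow_left₀ (h.pos hr0).le this _
  filter_upwards [eventually_ge_atTop (4 * R)] with r hr
  have hR1 := (hR R le_rfl).1
  have hr0 : 0 < r := by linarith
  have hr2 : 0 < r / 2 := by linarith
  rw [h.le_ratio_iff hp hr0]
  have hVol : ∀ s, 2 * R ≤ s → s / 2 * (c * ψ s ^ (n - 1)) ≤ ballVol n ψ s := by
    intro s hs
    have hs2 : 0 < s / 2 := by linarith
    have h1 := h.le_ballVol_sub (n := n) hs2.le (show s / 2 ≤ s by linarith)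
    have h2 := h.ballVol_pos (n := n) hs2
    have h3 := mul_le_mul_of_nonneg_left (hdouble s hs) hs2.le
    linarith
  have hV : c ^ 2 / 4 * ballVol n ψ r ≤ ballVol n ψ (r / 2) := by
    have h1 := hVol (r / 2) (by linarith)
    have h2 := hdouble r (by linarith)
    have h3 := h.ballVol_le (n := n) hr0.le
    calc c ^ 2 / 4 * ballVol n ψ r ≤ c ^ 2 / 4 * (r * ψ r ^ (n - 1)) := by gcongr
      _ = r / 4 * (c * (c * ψ r ^ (n - 1))) := by ring
      _ ≤ r / 4 * (c * ψ (r / 2) ^ (n - 1)) := by gcongr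
      _ = r / 2 / 2 * (c * ψ (r / 2) ^ (n - 1)) := by ring
      _ ≤ _ := h1
  have hH1 : thetaInt n p ψ r ≤ r * r ^ b := by
    have := intervalIntegral.integral_mono_on hr0.le
      (h.intervalIntegrable_Theta_rpow (n := n) hb.le hr0.le)
      (intervalIntegrable_const (c := r ^ b)) (fun x hx =>
        Real.rpow_le_rpow (h.Theta_nonneg hx.1) ((h.Theta_le hx.1).trans hx.2) hb.le)
    rw [intervalIntegral.integral_const, sub_zero, smul_eq_mul] at this
    exact this
  have hH2 : (c / 4) ^ b / 2 * thetaInt n p ψ r ≤ thetaInt n p ψ r - thetaInt n p ψ (r / 2) := by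
    have := sub_le_sub_of_hasDerivAt_le (show r / 2 ≤ r by linarith)
      (fun x _ => (hasDerivAt_id x).const_mul ((c / 4 * r) ^ b))
      (fun x hx => h.hasDerivAt_thetaInt (n := n) hp (hr2.trans_le hx.1)) (by
        intro x hx
        have hx0 := hr2.trans hx.1
        rw [mul_one]
        refine Real.rpow_le_rpow (by positivity) ?_ hb.le
        have h1 := hVol x (by linarith [hx.1])
        have hψ := pow_pos (h.pos hx0) (n - 1)
        rw [Theta_eq, le_div_iff₀ hψ]
        have h2 : r / 2 * (c * ψ x ^ (n - 1)) ≤ x * (c * ψ x ^ (n - 1)) := by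
          gcongr; exact hx.1.le
        linarith)
    rw [Real.mul_rpow (by positivity) hr0.le] at this
    simp only [id] at this
    have h2 : (c / 4) ^ b / 2 * thetaInt n p ψ r ≤ (c / 4) ^ b / 2 * (r * r ^ b) := by gcongr
    linarith
  have hJ := h.le_ratioNum_sub (n := n) hp hr2 (show r / 2 ≤ r by linarith)
  have hJ0 := h.ratioNum_nonneg (n := n) (p := p) hr2.le
  have hVp := h.ballVol_pos (n := n) hr0
  have hHp := h.thetaInt_pos (n := n) hp hr0
  calc c ^ 2 / 4 * ((c / 4) ^ b / 2) * (ballVol n ψ r * thetaInt n p ψ r)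
      = c ^ 2 / 4 * ballVol n ψ r * ((c / 4) ^ b / 2 * thetaInt n p ψ r) := by ring
    _ ≤ ballVol n ψ (r / 2) * (thetaInt n p ψ r - thetaInt n p ψ (r / 2)) := by
        gcongr
        exact (h.ballVol_pos hr2).le
    _ ≤ _ := by linarith

/-! ### Volterra equations -/

theorem exists_rpow_lipschitz {a b : ℝ} (ha : 0 < a) (s : ℝ) :
    ∃ C, 0 ≤ C ∧ ∀ x ∈ Icc a b, ∀ y ∈ Icc a b, |x ^ s - y ^ s| ≤ C * |x - y| := by
  have hc : ContinuousOn (fun x : ℝ => s * x ^ (s - 1)) (Icc a b) :=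
    (continuousOn_id.rpow_const fun x hx => Or.inl (ha.trans_le hx.1).ne').const_smul s
  obtain ⟨C, hC⟩ := isCompact_Icc.exists_bound_of_continuousOn hc
  refine ⟨max C 0, le_max_right _ _, fun x hx y hy => ?_⟩
  exact (convex_Icc a b).norm_image_sub_le_of_norm_hasDerivWithin_le
    (fun z hz => (Real.hasDerivAt_rpow_const (Or.inl (ha.trans_le hz.1).ne')).hasDerivWithinAt)
    (fun z hz => (hC z hz).trans (le_max_left _ _)) hy hx

theorem integral_exp_mul_le {M r : ℝ} (hM : 0 < M) :
    ∫ s in (0 : ℝ)..r, Real.exp (M * s) ≤ Real.exp (M * r) / M := by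
  rw [intervalIntegral.integral_comp_mul_left (fun x => Real.exp x) hM.ne', integral_exp,
    smul_eq_mul, mul_zero, Real.exp_zero, div_eq_inv_mul]
  gcongr
  linarith

/-- The operator looks only at the past, so a bound e^{Mt} d on the difference of the arguments
survives inside the integral, and integrating e^{Ms} gains a factor 1/M. In the sup norm weighted by
e^{-Mt} the Lipschitz constant is therefore at most Λ/M. -/
theorem volterra_sub_le {V : (ℝ → ℝ) → ℝ → ℝ} {R Λ M d r : ℝ} {u₁ u₂ : ℝ → ℝ} (hM : 0 < M)
    (hr : r ∈ Icc 0 R) (hΛ0 : 0 ≤ Λ) (hd : 0 ≤ d)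
    (h₁ : IntervalIntegrable (V u₁) volume 0 r) (h₂ : IntervalIntegrable (V u₂) volume 0 r)
    (hΛ : ∀ d, ∀ s ∈ Ioc 0 R, (∀ t ∈ Icc 0 s, |u₁ t - u₂ t| ≤ d) → |V u₁ s - V u₂ s| ≤ Λ * d)
    (hle : ∀ t ∈ Icc 0 R, |u₁ t - u₂ t| ≤ Real.exp (M * t) * d) :
    |(∫ s in (0 : ℝ)..r, V u₁ s) - ∫ s in (0 : ℝ)..r, V u₂ s| ≤
      Λ * d / M * Real.exp (M * r) := by
  rw [← intervalIntegral.integral_sub h₁ h₂]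
  have hbd : ∀ s ∈ Ioc 0 r, ‖V u₁ s - V u₂ s‖ ≤ Λ * d * Real.exp (M * s) := by
    intro s hs
    have hsR : s ≤ R := hs.2.trans hr.2
    rw [Real.norm_eq_abs, mul_assoc, mul_comm d]
    refine hΛ _ s ⟨hs.1, hsR⟩ fun t ht => (hle t ⟨ht.1, ht.2.trans hsR⟩).trans ?_
    have := ht.2
    gcongr
  have hi : IntervalIntegrable (fun s => Λ * d * Real.exp (M * s)) volume 0 r :=
    Continuous.intervalIntegrable (by fun_prop) _ _
  have := intervalIntegral.norm_integral_le_of_norm_le hr.1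
    (Eventually.of_forall fun s hs => hbd s hs) hi
  refine this.trans ?_
  rw [intervalIntegral.integral_const_mul]
  calc Λ * d * ∫ s in (0 : ℝ)..r, Real.exp (M * s) ≤ Λ * d * (Real.exp (M * r) / M) := by
        gcongr; exact integral_exp_mul_le hM
    _ = _ := by ring

/-- Banach's fixed point theorem in the weighted norm of `volterra_sub_le`, with no smallness
assumption on R. The bounds are required for all continuous arguments, so the equation has to be
truncated before this is applied. -/
theorem exists_volterra {V : (ℝ → ℝ) → ℝ → ℝ} {α R B Λ : ℝ} (hR : 0 ≤ R) (hΛ0 : 0 ≤ Λ)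
    (hint : ∀ u, Continuous u → IntervalIntegrable (V u) volume 0 R)
    (hB : ∀ u, Continuous u → ∀ s ∈ Ioc 0 R, |V u s| ≤ B)
    (hΛ : ∀ u₁ u₂, Continuous u₁ → Continuous u₂ → ∀ d, ∀ s ∈ Ioc 0 R,
      (∀ t ∈ Icc 0 s, |u₁ t - u₂ t| ≤ d) → |V u₁ s - V u₂ s| ≤ Λ * d) :
    ∃ u, Continuous u ∧ ∀ r ∈ Icc 0 R, u r = α - ∫ s in (0 : ℝ)..r, V u s := by
  set M := 2 * Λ + 1 with hMdef
  have hM : 0 < M := by linarith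
  -- Clamping to [0, R] makes the iterates bounded continuous functions on all of ℝ; the unknown y
  -- is related to the solution by u = e^{Ms} y.
  set ρ : ℝ → ℝ := fun r => max 0 (min r R) with hρ
  have hρc : Continuous ρ := by fun_prop
  have hρm : ∀ r, ρ r ∈ Icc 0 R := fun r => ⟨le_max_left _ _, max_le hR (min_le_right _ _)⟩
  have hρe : ∀ r ∈ Icc 0 R, ρ r = r := fun r hr => by
    rw [hρ]; simp only; rw [min_eq_left hr.2, max_eq_right hr.1]
  set E : BoundedContinuousFunction ℝ ℝ → ℝ → ℝ := fun y s => Real.exp (M * s) * y s with hE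
  have hEc : ∀ y, Continuous (E y) := fun y => by
    have := y.continuous
    fun_prop
  have hint' : ∀ y, ∀ r ∈ Icc 0 R, IntervalIntegrable (V (E y)) volume 0 r := fun y r hr =>
    (hint _ (hEc y)).mono_set (by
      rw [uIcc_of_le hr.1, uIcc_of_le hR]; exact Icc_subset_Icc_right hr.2)
  have hprim : ∀ y, Continuous fun r => ∫ s in (0 : ℝ)..ρ r, V (E y) s := fun y => by
    have := intervalIntegral.continuousOn_primitive_interval' (hint _ (hEc y)) left_mem_uIcc
    rw [uIcc_of_le hR] at this
    exact this.comp_continuous hρc hρm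
  have hbound : ∀ y r, ‖Real.exp (-(M * ρ r)) * (α - ∫ s in (0 : ℝ)..ρ r, V (E y) s)‖ ≤
      |α| + |B| * R := by
    intro y r
    rw [norm_mul, Real.norm_of_nonneg (Real.exp_pos _).le]
    have h1 : Real.exp (-(M * ρ r)) ≤ 1 := by
      rw [Real.exp_le_one_iff, neg_nonpos]
      exact mul_nonneg hM.le (hρm r).1
    have h2 : ‖∫ s in (0 : ℝ)..ρ r, V (E y) s‖ ≤ |B| * |ρ r - 0| := by
      refine intervalIntegral.norm_integral_le_of_norm_le_const fun s hs => ?_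
      rw [uIoc_of_le (hρm r).1] at hs
      exact (hB _ (hEc y) s ⟨hs.1, hs.2.trans (hρm r).2⟩).trans (le_abs_self B)
    rw [sub_zero, abs_of_nonneg (hρm r).1] at h2
    have h3 := mul_le_mul_of_nonneg_left (hρm r).2 (abs_nonneg B)
    have h4 := norm_sub_le α (∫ s in (0 : ℝ)..ρ r, V (E y) s)
    have h5 : ‖α‖ = |α| := rfl
    calc _ ≤ 1 * ‖α - ∫ s in (0 : ℝ)..ρ r, V (E y) s‖ := by gcongr
      _ ≤ _ := by linarith
  set T : BoundedContinuousFunction ℝ ℝ → BoundedContinuousFunction ℝ ℝ := fun y =>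
    BoundedContinuousFunction.ofNormedAddCommGroup
      (fun r => Real.exp (-(M * ρ r)) * (α - ∫ s in (0 : ℝ)..ρ r, V (E y) s))
      ((by fun_prop : Continuous fun r => Real.exp (-(M * ρ r))).mul
        (continuous_const.sub (hprim y))) (|α| + |B| * R) (hbound y) with hT
  have hcontr : ContractingWith (1 / 2) T := by
    refine ⟨by rw [← NNReal.coe_lt_coe]; norm_num, LipschitzWith.of_dist_le_mul fun y₁ y₂ => ?_⟩
    refine (BoundedContinuousFunction.dist_le (by positivity)).2 fun r => ?_
    have hd : 0 ≤ dist y₁ y₂ := dist_nonneg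
    have hle : ∀ t ∈ Icc 0 R, |E y₁ t - E y₂ t| ≤ Real.exp (M * t) * dist y₁ y₂ := by
      intro t _
      simp only [hE]
      rw [← mul_sub, abs_mul, abs_of_pos (Real.exp_pos _)]
      gcongr
      exact BoundedContinuousFunction.dist_coe_le_dist (f := y₁) (g := y₂) t
    have := volterra_sub_le hM (hρm r) hΛ0 hd (hint' y₁ _ (hρm r)) (hint' y₂ _ (hρm r))
      (hΛ _ _ (hEc y₁) (hEc y₂)) hle
    simp only [hT, BoundedContinuousFunction.coe_ofNormedAddCommGroup, Real.dist_eq]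
    rw [← mul_sub, abs_mul, abs_of_pos (Real.exp_pos _), sub_sub_sub_cancel_left, abs_sub_comm]
    calc Real.exp (-(M * ρ r)) * _
        ≤ Real.exp (-(M * ρ r)) * (Λ * dist y₁ y₂ / M * Real.exp (M * ρ r)) := by gcongr
      _ = Λ / M * dist y₁ y₂ := by
          rw [Real.exp_neg]; field_simp
      _ ≤ (1 / 2 : ℝ) * dist y₁ y₂ := by
          refine mul_le_mul_of_nonneg_right ?_ hd
          rw [div_le_div_iff₀ hM two_pos]; linarith
      _ = _ := by norm_num
  set y := hcontr.fixedPoint T with hy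
  have hfix : T y = y := hcontr.fixedPoint_isFixedPt
  refine ⟨E y, hEc y, fun r hr => ?_⟩
  have h1 : y r = Real.exp (-(M * ρ r)) * (α - ∫ s in (0 : ℝ)..ρ r, V (E y) s) := by
    conv_lhs => rw [← hfix]
    rfl
  rw [hρe r hr] at h1
  have h2 : E y r = Real.exp (M * r) * y r := rfl
  rw [h2, h1, ← mul_assoc, ← Real.exp_add, add_neg_cancel, Real.exp_zero, one_mul]

theorem volterra_unique {V : (ℝ → ℝ) → ℝ → ℝ} {α R Λ : ℝ} {u₁ u₂ : ℝ → ℝ}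
    (hΛ0 : 0 ≤ Λ) (hc₁ : Continuous u₁) (hc₂ : Continuous u₂)
    (hi₁ : ∀ r ∈ Icc 0 R, IntervalIntegrable (V u₁) volume 0 r)
    (hi₂ : ∀ r ∈ Icc 0 R, IntervalIntegrable (V u₂) volume 0 r)
    (hΛ : ∀ d, ∀ s ∈ Ioc 0 R, (∀ t ∈ Icc 0 s, |u₁ t - u₂ t| ≤ d) → |V u₁ s - V u₂ s| ≤ Λ * d)
    (h₁ : ∀ r ∈ Icc 0 R, u₁ r = α - ∫ s in (0 : ℝ)..r, V u₁ s)
    (h₂ : ∀ r ∈ Icc 0 R, u₂ r = α - ∫ s in (0 : ℝ)..r, V u₂ s) :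
    EqOn u₁ u₂ (Icc 0 R) := by
  intro r hr
  set M := 2 * Λ + 1 with hMdef
  have hM : 0 < M := by linarith
  obtain ⟨x, hx, hmax⟩ := isCompact_Icc.exists_isMaxOn ⟨r, hr⟩
    (f := fun t => Real.exp (-(M * t)) * |u₁ t - u₂ t|)
    (Continuous.continuousOn (by fun_prop))
  set d := Real.exp (-(M * x)) * |u₁ x - u₂ x| with hd
  have hd0 : 0 ≤ d := by positivity
  have hle : ∀ t ∈ Icc 0 R, |u₁ t - u₂ t| ≤ Real.exp (M * t) * d := by
    intro t ht
    have := mul_le_mul_of_nonneg_left (hmax ht) (Real.exp_pos (M * t)).le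
    simp only at this
    rwa [← mul_assoc, ← Real.exp_add, add_neg_cancel, Real.exp_zero, one_mul] at this
  have := volterra_sub_le hM hx hΛ0 hd0 (hi₁ x hx) (hi₂ x hx) hΛ hle
  have e : |u₁ x - u₂ x| = Real.exp (M * x) * d := by
    rw [hd, ← mul_assoc, ← Real.exp_add, add_neg_cancel, Real.exp_zero, one_mul]
  rw [abs_sub_comm, ← sub_sub_sub_cancel_left _ _ α, ← h₁ x hx, ← h₂ x hx, e] at this
  have h3 : d ≤ Λ * d / M := by
    have hpos := Real.exp_pos (M * x)
    rw [mul_comm] at this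
    exact le_of_mul_le_mul_right this hpos
  rw [le_div_iff₀ hM] at h3
  have h4 : d = 0 := by nlinarith
  have h5 := hle r hr
  rw [h4, mul_zero] at h5
  exact sub_eq_zero.1 (abs_eq_zero.1 (le_antisymm h5 (abs_nonneg _)))

/-! ### The Pohozaev inequality -/

/-- `-u'/u ≤ C / Θ` for positive solutions of the radial equation, at and above the critical
exponent. -/
theorem Theta_mul_speed_le {n : ℕ} {p q R α : ℝ} {ψ u : ℝ → ℝ} (h : IsCartanHadamardModel ψ)
    (hp : 1 < p) (hpn : p < n) (hq : (n : ℝ) * p / ((n : ℝ) - p) - 1 ≤ q)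
    (hpos : ∀ r ∈ Ioo 0 R, 0 < u r) (hbd : ∀ r ∈ Ioo 0 R, u r ≤ α)
    (hder : ∀ r ∈ Ioo 0 R, HasDerivAt u (-speed n p q ψ u r) r) {r : ℝ} (hr : r ∈ Ioo 0 R) :
    Theta n ψ r * speed n p q ψ u r ≤ p / ((p - 1) * (q + 1)) * u r := by
  have hn0 : (0 : ℝ) < n := by linarith
  have hn1 : 1 ≤ n := by exact_mod_cast hn0
  have hp1 : 0 < p - 1 := by linarith
  have hnp : (0 : ℝ) < n - p := by linarith
  have hq1 : (n : ℝ) * p / (n - p) ≤ q + 1 := by linarith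
  have hq0 : 0 < q := by
    have : p < (n : ℝ) * p / (n - p) := by
      rw [lt_div_iff₀ hnp]; nlinarith
    linarith
  set b := 1 / (p - 1) with hb
  have hb0 : 0 < b := by positivity
  have hpb : p / (p - 1) = b + 1 := by rw [hb]; field_simp; ring
  have hu0 : ∀ r ∈ Ioo 0 R, ∀ s ∈ Ioc 0 r, s ∈ Ioo 0 R := fun r hr s hs =>
    ⟨hs.1, hs.2.trans_lt hr.2⟩
  have hcu : ContinuousOn u (Ioo 0 R) := fun r hr => (hder r hr).continuousAt.continuousWithinAt
  have hci : ContinuousOn (fun s => ψ s ^ (n - 1) * u s ^ q) (Ioo 0 R) :=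
    ((h.continuousOn_pow _).mono fun x hx => hx.1.le).mul
      (hcu.rpow_const fun r hr => Or.inl (hpos r hr).ne')
  have hα : ∀ r ∈ Ioo 0 R, u r ^ q ≤ α ^ q := fun r hr =>
    Real.rpow_le_rpow (hpos r hr).le (hbd r hr) hq0.le
  have hint : ∀ r ∈ Ioo 0 R,
      IntervalIntegrable (fun s => ψ s ^ (n - 1) * u s ^ q) volume 0 r := by
    intro r hr
    refine intervalIntegrable_of_bdd hr.1.le (hci.mono (hu0 r hr))
      (C := ψ r ^ (n - 1) * α ^ q) fun s hs => ?_
    have hsR := hu0 r hr s hs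
    have h1 := pow_nonneg (h.nonneg hs.1.le) (n - 1)
    rw [Real.norm_of_nonneg (mul_nonneg h1 (Real.rpow_nonneg (hpos s hsR).le _))]
    exact mul_le_mul (pow_le_pow_left₀ (h.nonneg hs.1.le) (h.monotoneOn hs.1.le hr.1.le hs.2) _)
      (hα s hsR) (Real.rpow_nonneg (hpos s hsR).le _) (pow_nonneg (h.nonneg hr.1.le) _)
  have hF : ∀ r ∈ Ioo 0 R, HasDerivAt (flux n q ψ u) (ψ r ^ (n - 1) * u r ^ q) r := fun r hr =>
    hasDerivAt_integral_of_continuousOn isOpen_Ioo hci hr (hint r hr)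
  have hFpos : ∀ r ∈ Ioo 0 R, 0 < flux n q ψ u r := fun r hr =>
    intervalIntegral.intervalIntegral_pos_of_pos_on (hint r hr) (fun x hx =>
      mul_pos (pow_pos (h.pos hx.1) _) (Real.rpow_pos_of_pos (hpos x ⟨hx.1, hx.2.trans hr.2⟩) _))
      hr.1
  have hFle : ∀ r ∈ Ioo 0 R, flux n q ψ u r ≤ α ^ q * ballVol n ψ r := by
    intro r hr
    rw [ballVol, ← intervalIntegral.integral_const_mul]
    refine intervalIntegral.integral_mono_on_of_le_Ioo hr.1.le (hint r hr)
      ((h.intervalIntegrable_pow _ le_rfl hr.1.le).const_mul _) fun x hx => ?_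
    rw [mul_comm]
    exact mul_le_mul_of_nonneg_right (hα x ⟨hx.1, hx.2.trans hr.2⟩) (pow_nonneg (h.nonneg hx.1.le) _)
  set G : ℝ → ℝ := fun r => flux n q ψ u r / ψ r ^ (n - 1) with hG
  have hGpos : ∀ r ∈ Ioo 0 R, 0 < G r := fun r hr =>
    div_pos (hFpos r hr) (pow_pos (h.pos hr.1) _)
  -- The Pohozaev function: V times the energy (p-1)/p |u'|^p + u^{q+1}/(q+1), minus F u/(q+1). Here
  -- G = |u'|^{p-1}, and the last term is chosen so that the contributions of u^q u' cancel in P'.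
  set P : ℝ → ℝ := fun r => ballVol n ψ r * ((p - 1) / p * G r ^ (p / (p - 1))
    + u r ^ (q + 1) / (q + 1)) - flux n q ψ u r * u r / (q + 1) with hP
  have hPd : ∀ r ∈ Ioo 0 R, HasDerivAt P
      (speed n p q ψ u r * G r * (ψ r ^ (n - 1) * ((p - 1) / p + 1 / (q + 1))
        - (n - 1 : ℕ) * (deriv ψ r / ψ r) * ballVol n ψ r)) r := by
    intro r hr
    have hψ := h.pos hr.1
    have hGd := h.hasDerivAt_inv_pow (n := n) hr.1 (hF r hr)
    have d1 := (hGd.rpow_const (p := p / (p - 1)) (Or.inl (hGpos r hr).ne')).const_mul ((p - 1) / p)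
    have d2 := ((hder r hr).rpow_const (p := q + 1) (Or.inl (hpos r hr).ne')).div_const (q + 1)
    have d3 := ((hF r hr).mul (hder r hr)).div_const (q + 1)
    refine (((h.hasDerivAt_ballVol hr.1).mul (d1.add d2)).sub d3).congr_deriv ?_
    have e1 : flux n q ψ u r = G r * ψ r ^ (n - 1) := by
      rw [hG]; field_simp
    have e2 : (flux n q ψ u r / ψ r ^ (n - 1)) = G r := rfl
    have e3 : speed n p q ψ u r = G r ^ b := rfl
    have e4 : G r ^ (p / (p - 1)) = G r ^ b * G r := by
      rw [hpb, Real.rpow_add (hGpos r hr), Real.rpow_one]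
    have e5 : p / (p - 1) - 1 = b := by rw [hpb]; ring
    have e6 : u r ^ (q + 1) = u r ^ q * u r := by
      rw [Real.rpow_add (hpos r hr), Real.rpow_one]
    have e7 : q + 1 - 1 = q := by ring
    simp only [Pi.add_apply]
    rw [e2, e3, e4, e5, e6, e7, e1, mul_div_cancel_left₀ _ (pow_pos hψ _).ne']
    have hp0 : p ≠ 0 := by linarith
    have hqq : q + 1 ≠ 0 := by linarith
    field_simp
    ring
  have hPneg : ∀ r ∈ Ioo 0 R, speed n p q ψ u r * G r * (ψ r ^ (n - 1) * ((p - 1) / p + 1 / (q + 1))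
        - (n - 1 : ℕ) * (deriv ψ r / ψ r) * ballVol n ψ r) ≤ 0 := by
    intro r hr
    have hψ := h.pos hr.1
    refine mul_nonpos_of_nonneg_of_nonpos (mul_nonneg (Real.rpow_nonneg (hGpos r hr).le _)
      (hGpos r hr).le) (sub_nonpos.2 ?_)
    have h1 := h.pow_le_deriv_mul_ballVol hn1 hr.1
    have h2 : ψ r ^ n = ψ r ^ (n - 1) * ψ r := by rw [← pow_succ, Nat.sub_add_cancel hn1]
    have h3 : ψ r ^ (n - 1) ≤ n * (deriv ψ r / ψ r * ballVol n ψ r) := by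
      rw [h2, ← le_div_iff₀ hψ] at h1
      calc _ ≤ _ := h1
        _ = _ := by ring
    -- This is q + 1 ≥ np/(n-p) rewritten, with equality at the critical exponent; combined with ψ^n
    -- ≤ n ψ' V it gives P' ≤ 0.
    have h4 : (p - 1) / p + 1 / (q + 1) ≤ ((n - 1 : ℕ) : ℝ) / n := by
      rw [Nat.cast_sub hn1, Nat.cast_one]
      have : 1 / (q + 1) ≤ (n - p) / (n * p) := by
        rw [← one_div_div ((n : ℝ) * p)]
        exact one_div_le_one_div_of_le (by positivity) hq1
      calc _ ≤ (p - 1) / p + (n - p) / (n * p) := by gcongr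
        _ = _ := by field_simp; ring
    calc ψ r ^ (n - 1) * ((p - 1) / p + 1 / (q + 1))
        ≤ (n * (deriv ψ r / ψ r * ballVol n ψ r)) * (((n - 1 : ℕ) : ℝ) / n) := by
          gcongr
          exact (pow_nonneg hψ.le _).trans h3
      _ = _ := by field_simp
  -- P(r) ≤ P(s), and the energy stays bounded near the pole, so P(s) is bounded above by a constant
  -- times V(s), which tends to 0 with s. Hence P(r) ≤ 0.
  have hPle : ∀ s ∈ Ioo 0 r, P r ≤ ballVol n ψ s *
      ((p - 1) / p * (α ^ q * r) ^ (p / (p - 1)) + α ^ (q + 1) / (q + 1)) := by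
    intro s hs
    have hsR : s ∈ Ioo 0 R := ⟨hs.1, hs.2.trans hr.2⟩
    have h1 : P r ≤ P s := le_of_hasDerivAt_nonpos hs.2.le
      (fun x hx => hPd x ⟨hs.1.trans_le hx.1, hx.2.trans_lt hr.2⟩)
      (fun x hx => hPneg x ⟨hs.1.trans hx.1, hx.2.trans hr.2⟩)
    refine h1.trans ?_
    have h2 : 0 ≤ flux n q ψ u s * u s / (q + 1) :=
      div_nonneg (mul_nonneg (hFpos s hsR).le (hpos s hsR).le) (by linarith)
    have h3 : G s ≤ α ^ q * r := by
      rw [hG]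
      simp only
      rw [div_le_iff₀ (pow_pos (h.pos hs.1) _)]
      have := h.ballVol_le (n := n) hs.1.le
      have h5 : 0 ≤ α ^ q := (Real.rpow_nonneg (hpos s hsR).le _).trans (hα s hsR)
      calc _ ≤ _ := hFle s hsR
        _ ≤ α ^ q * (s * ψ s ^ (n - 1)) := by gcongr
        _ ≤ α ^ q * (r * ψ s ^ (n - 1)) := by
          have := h.nonneg hs.1.le
          gcongr
          exact hs.2.le
        _ = _ := by ring
    have h4 : G s ^ (p / (p - 1)) ≤ (α ^ q * r) ^ (p / (p - 1)) :=
      Real.rpow_le_rpow (hGpos s hsR).le h3 (by positivity)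
    have h5 : u s ^ (q + 1) ≤ α ^ (q + 1) :=
      Real.rpow_le_rpow (hpos s hsR).le (hbd s hsR) (by linarith)
    have h6 := (h.ballVol_pos (n := n) hs.1).le
    calc P s ≤ ballVol n ψ s * ((p - 1) / p * G s ^ (p / (p - 1))
          + u s ^ (q + 1) / (q + 1)) := by rw [hP]; linarith
      _ ≤ _ := by gcongr
  have hP0 : P r ≤ 0 := by
    have t : Tendsto (fun s => ballVol n ψ s *
        ((p - 1) / p * (α ^ q * r) ^ (p / (p - 1)) + α ^ (q + 1) / (q + 1))) (𝓝[>] 0)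
        (𝓝 (ballVol n ψ 0 *
        ((p - 1) / p * (α ^ q * r) ^ (p / (p - 1)) + α ^ (q + 1) / (q + 1)))) :=
      ((h.continuousOn_ballVol 0 self_mem_Ici).mono_left
        (nhdsWithin_mono _ Ioi_subset_Ici_self)).mul_const _
    have h0 : ballVol n ψ 0 = 0 := by simp [ballVol]
    rw [h0, zero_mul] at t
    refine ge_of_tendsto t ?_
    filter_upwards [Ioo_mem_nhdsGT hr.1] with s hs using hPle s hs
  have hψ := pow_pos (h.pos hr.1) (n - 1)
  have hGr := hGpos r hr
  have hur := Real.rpow_pos_of_pos (hpos r hr) (q + 1)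
  have hV := h.ballVol_pos (n := n) hr.1
  have e1 : flux n q ψ u r = G r * ψ r ^ (n - 1) := by
    rw [hG]; field_simp
  have e4 : G r ^ (p / (p - 1)) = speed n p q ψ u r * G r := by
    rw [hpb, Real.rpow_add hGr, Real.rpow_one]; rfl
  -- The positive term u^{q+1}/(q+1) in P ≤ 0 is dropped; the remaining inequality is divided by G
  -- ψ^{n-1} below.
  have h1 : ballVol n ψ r * ((p - 1) / p * (speed n p q ψ u r * G r)) ≤
      G r * ψ r ^ (n - 1) * u r / (q + 1) := by
    rw [← e4, ← e1]
    have : 0 ≤ ballVol n ψ r * (u r ^ (q + 1) / (q + 1)) := by positivity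
    simp only [hP] at hP0
    linarith
  rw [← h.Theta_mul hr.1] at h1
  have h2 : Theta n ψ r * speed n p q ψ u r * ((p - 1) / p) ≤ u r / (q + 1) := by
    have hc : 0 < G r * ψ r ^ (n - 1) := by positivity
    refine le_of_mul_le_mul_right ?_ hc
    calc _ = Theta n ψ r * ψ r ^ (n - 1) * ((p - 1) / p * (speed n p q ψ u r * G r)) := by ring
      _ ≤ _ := h1
      _ = _ := by ring
  calc Theta n ψ r * speed n p q ψ u r
      = Theta n ψ r * speed n p q ψ u r * ((p - 1) / p) * (p / (p - 1)) := by field_simp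
    _ ≤ u r / (q + 1) * (p / (p - 1)) := by gcongr
    _ = _ := by field_simp

/-! ### Existence and uniqueness of the radial solution with given value at the pole -/

section Bounds

variable {n : ℕ} {p q R c α : ℝ} {ψ w : ℝ → ℝ}

theorem continuousOn_flux_integrand (h : IsCartanHadamardModel ψ) (hc : 0 < c)
    (hw : ContinuousOn w (Icc 0 R)) (hwm : ∀ t ∈ Icc 0 R, w t ∈ Icc c α) :
    ContinuousOn (fun s => ψ s ^ (n - 1) * w s ^ q) (Icc 0 R) :=
  ((h.continuousOn_pow _).mono Icc_subset_Ici_self).mul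
    (hw.rpow_const fun t ht => Or.inl (hc.trans_le (hwm t ht).1).ne')

theorem intervalIntegrable_flux_integrand (h : IsCartanHadamardModel ψ) (hc : 0 < c)
    (hw : ContinuousOn w (Icc 0 R)) (hwm : ∀ t ∈ Icc 0 R, w t ∈ Icc c α) {r : ℝ}
    (hr : r ∈ Icc 0 R) :
    IntervalIntegrable (fun s => ψ s ^ (n - 1) * w s ^ q) volume 0 r := by
  refine ((continuousOn_flux_integrand h hc hw hwm).mono ?_).intervalIntegrable
  rw [uIcc_of_le hr.1]
  exact Icc_subset_Icc_right hr.2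

theorem flux_mem (h : IsCartanHadamardModel ψ) (hq : 0 ≤ q) (hc : 0 < c)
    (hw : ContinuousOn w (Icc 0 R)) (hwm : ∀ t ∈ Icc 0 R, w t ∈ Icc c α) {r : ℝ}
    (hr : r ∈ Icc 0 R) :
    flux n q ψ w r ∈ Icc (c ^ q * ballVol n ψ r) (α ^ q * ballVol n ψ r) := by
  have hi := intervalIntegrable_flux_integrand (n := n) (q := q) h hc hw hwm hr
  have hj := h.intervalIntegrable_pow (n - 1) le_rfl hr.1
  have hm : ∀ x ∈ Icc 0 r, w x ∈ Icc c α := fun x hx => hwm x ⟨hx.1, hx.2.trans hr.2⟩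
  rw [ballVol, ← intervalIntegral.integral_const_mul, ← intervalIntegral.integral_const_mul]
  constructor
  · refine intervalIntegral.integral_mono_on hr.1 (hj.const_mul _) hi fun x hx => ?_
    rw [mul_comm]
    exact mul_le_mul_of_nonneg_left (Real.rpow_le_rpow hc.le (hm x hx).1 hq)
      (pow_nonneg (h.nonneg hx.1) _)
  · refine intervalIntegral.integral_mono_on hr.1 hi (hj.const_mul _) fun x hx => ?_
    rw [mul_comm]
    exact mul_le_mul_of_nonneg_right
      (Real.rpow_le_rpow (hc.le.trans (hm x hx).1) (hm x hx).2 hq) (pow_nonneg (h.nonneg hx.1) _)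

theorem flux_div_mem (h : IsCartanHadamardModel ψ) (hq : 0 ≤ q) (hc : 0 < c)
    (hw : ContinuousOn w (Icc 0 R)) (hwm : ∀ t ∈ Icc 0 R, w t ∈ Icc c α) {r : ℝ}
    (hr : r ∈ Ioc 0 R) : flux n q ψ w r / ballVol n ψ r ∈ Icc (c ^ q) (α ^ q) := by
  have := flux_mem (n := n) h hq hc hw hwm (Ioc_subset_Icc_self hr)
  have hV := h.ballVol_pos (n := n) hr.1
  exact ⟨(le_div_iff₀ hV).2 this.1, (div_le_iff₀ hV).2 this.2⟩

/-- The power 1/(p-1) need not be Lipschitz at 0, where the normalised flux F/ψ^{n-1} vanishes.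
Splitting off Θ, which does not depend on w, leaves F/V, a mean of w^q confined to [c^q, α^q], away
from 0. -/
theorem speed_eq_Theta_mul (h : IsCartanHadamardModel ψ) (hq : 0 ≤ q) (hc : 0 < c)
    (hw : ContinuousOn w (Icc 0 R)) (hwm : ∀ t ∈ Icc 0 R, w t ∈ Icc c α) {r : ℝ}
    (hr : r ∈ Ioc 0 R) : speed n p q ψ w r =
      Theta n ψ r ^ (1 / (p - 1)) * (flux n q ψ w r / ballVol n ψ r) ^ (1 / (p - 1)) := by
  have hV := h.ballVol_pos (n := n) hr.1
  have hm := flux_div_mem (n := n) h hq hc hw hwm hr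
  rw [← Real.mul_rpow (h.Theta_nonneg hr.1.le)
    ((Real.rpow_nonneg hc.le _).trans hm.1), speed, Theta_eq]
  congr 1
  have := pow_pos (h.pos hr.1) (n - 1)
  field_simp

theorem speed_nonneg (h : IsCartanHadamardModel ψ) {r : ℝ} (hr : 0 ≤ r)
    (hw : ∀ t ∈ Icc 0 r, 0 ≤ w t) : 0 ≤ speed n p q ψ w r :=
  Real.rpow_nonneg (div_nonneg (intervalIntegral.integral_nonneg hr fun t ht =>
    mul_nonneg (pow_nonneg (h.nonneg ht.1) _) (Real.rpow_nonneg (hw t ht) _))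
    (pow_nonneg (h.nonneg hr) _)) _

theorem speed_le (h : IsCartanHadamardModel ψ) (hp : 1 < p) (hq : 0 ≤ q) (hc : 0 < c)
    (hw : ContinuousOn w (Icc 0 R)) (hwm : ∀ t ∈ Icc 0 R, w t ∈ Icc c α) {r : ℝ}
    (hr : r ∈ Ioc 0 R) : speed n p q ψ w r ≤ (α ^ q * r) ^ (1 / (p - 1)) := by
  have hp1 : 0 < p - 1 := by linarith
  have hm := flux_div_mem (n := n) h hq hc hw hwm hr
  have h0 : 0 ≤ flux n q ψ w r / ballVol n ψ r := (Real.rpow_nonneg hc.le _).trans hm.1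
  have hT := h.Theta_nonneg (n := n) hr.1.le
  rw [speed_eq_Theta_mul h hq hc hw hwm hr, ← Real.mul_rpow hT h0, mul_comm]
  refine Real.rpow_le_rpow (mul_nonneg h0 hT) ?_ (by positivity)
  exact mul_le_mul hm.2 (h.Theta_le hr.1.le) hT (h0.trans hm.2)

theorem continuousOn_speed (h : IsCartanHadamardModel ψ) (hp : 1 < p) (hc : 0 < c)
    (hw : ContinuousOn w (Icc 0 R)) (hwm : ∀ t ∈ Icc 0 R, w t ∈ Icc c α) :
    ContinuousOn (speed n p q ψ w) (Ioc 0 R) := by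
  have hp1 : 0 < p - 1 := by linarith
  rcases lt_or_ge R 0 with hR | hR
  · rw [Ioc_eq_empty (by linarith)]; exact continuousOn_empty _
  have hF : ContinuousOn (flux n q ψ w) (Icc 0 R) := by
    have := intervalIntegral.continuousOn_primitive_interval'
      (intervalIntegrable_flux_integrand (n := n) (q := q) h hc hw hwm (right_mem_Icc.2 hR))
      left_mem_uIcc
    rwa [uIcc_of_le hR] at this
  exact ((hF.mono Ioc_subset_Icc_self).div ((h.continuousOn_pow _).mono fun x hx => hx.1.le)
    fun x hx => (pow_pos (h.pos hx.1) _).ne').rpow_const fun _ _ => Or.inr (by positivity)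

theorem intervalIntegrable_speed (h : IsCartanHadamardModel ψ) (hp : 1 < p) (hq : 0 ≤ q)
    (hc : 0 < c) (hw : ContinuousOn w (Icc 0 R)) (hwm : ∀ t ∈ Icc 0 R, w t ∈ Icc c α) {r : ℝ}
    (hr : r ∈ Icc 0 R) : IntervalIntegrable (speed n p q ψ w) volume 0 r := by
  have hp1 : 0 < p - 1 := by linarith
  have hsub : ∀ s ∈ Ioc 0 r, s ∈ Ioc 0 R := fun s hs => ⟨hs.1, hs.2.trans hr.2⟩
  refine intervalIntegrable_of_bdd hr.1 ((continuousOn_speed h hp hc hw hwm).mono hsub)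
    (C := (α ^ q * r) ^ (1 / (p - 1))) fun s hs => ?_
  have hα : 0 ≤ α := hc.le.trans ((hwm s (Ioc_subset_Icc_self (hsub s hs))).1.trans
    (hwm s (Ioc_subset_Icc_self (hsub s hs))).2)
  rw [Real.norm_of_nonneg (speed_nonneg h hs.1.le fun t ht =>
    hc.le.trans (hwm t ⟨ht.1, ht.2.trans (hsub s hs).2⟩).1)]
  refine (speed_le h hp hq hc hw hwm (hsub s hs)).trans (Real.rpow_le_rpow ?_ ?_ (by positivity))
  · exact mul_nonneg (Real.rpow_nonneg hα _) hs.1.le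
  · exact mul_le_mul_of_nonneg_left hs.2 (Real.rpow_nonneg hα _)

end Bounds

theorem exists_speed_lipschitz {n : ℕ} {p q c α : ℝ} {ψ : ℝ → ℝ} (R : ℝ)
    (h : IsCartanHadamardModel ψ) (hp : 1 < p) (hq : 0 ≤ q) (hc : 0 < c) :
    ∃ Λ, 0 ≤ Λ ∧ ∀ w₁ w₂ : ℝ → ℝ, ContinuousOn w₁ (Icc 0 R) → ContinuousOn w₂ (Icc 0 R) →
      (∀ t ∈ Icc 0 R, w₁ t ∈ Icc c α) → (∀ t ∈ Icc 0 R, w₂ t ∈ Icc c α) →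
      ∀ d, ∀ s ∈ Ioc 0 R, (∀ t ∈ Icc 0 s, |w₁ t - w₂ t| ≤ d) →
      |speed n p q ψ w₁ s - speed n p q ψ w₂ s| ≤ Λ * d := by
  obtain ⟨Λ₁, h₁, hΛ₁⟩ := exists_rpow_lipschitz (b := α) hc q
  obtain ⟨Λ₂, h₂, hΛ₂⟩ := exists_rpow_lipschitz (b := α ^ q) (Real.rpow_pos_of_pos hc q)
    (1 / (p - 1))
  have hp1 : 0 < p - 1 := by linarith
  refine ⟨|R| ^ (1 / (p - 1)) * (Λ₂ * Λ₁), by positivity, fun w₁ w₂ hw₁ hw₂ hm₁ hm₂ d s hs hd => ?_⟩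
  have hV := h.ballVol_pos (n := n) hs.1
  have hsR : ∀ t ∈ Icc 0 s, t ∈ Icc 0 R := fun t ht => ⟨ht.1, ht.2.trans hs.2⟩
  have hF : |flux n q ψ w₁ s - flux n q ψ w₂ s| ≤ Λ₁ * d * ballVol n ψ s := by
    have hsI := Ioc_subset_Icc_self hs
    rw [flux, flux, ← intervalIntegral.integral_sub
      (intervalIntegrable_flux_integrand h hc hw₁ hm₁ hsI)
      (intervalIntegrable_flux_integrand h hc hw₂ hm₂ hsI), ballVol,
      ← intervalIntegral.integral_const_mul, ← Real.norm_eq_abs]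
    refine intervalIntegral.norm_integral_le_of_norm_le hs.1.le (Eventually.of_forall fun t ht => ?_)
      ((h.intervalIntegrable_pow _ le_rfl hs.1.le).const_mul _)
    have htI := hsR t (Ioc_subset_Icc_self ht)
    have hψ := pow_nonneg (h.nonneg ht.1.le) (n - 1)
    rw [← mul_sub, norm_mul, Real.norm_of_nonneg hψ, mul_comm]
    refine mul_le_mul_of_nonneg_right ((hΛ₁ _ (hm₁ t htI) _ (hm₂ t htI)).trans ?_) hψ
    exact mul_le_mul_of_nonneg_left (hd t (Ioc_subset_Icc_self ht)) h₁
  have hA : |flux n q ψ w₁ s / ballVol n ψ s - flux n q ψ w₂ s / ballVol n ψ s| ≤ Λ₁ * d := by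
    rw [← sub_div, abs_div, abs_of_pos hV, div_le_iff₀ hV]
    exact hF
  rw [speed_eq_Theta_mul h hq hc hw₁ hm₁ hs, speed_eq_Theta_mul h hq hc hw₂ hm₂ hs, ← mul_sub,
    abs_mul, abs_of_nonneg (Real.rpow_nonneg (h.Theta_nonneg hs.1.le) _), mul_assoc, mul_assoc]
  have h3 := hΛ₂ _ (flux_div_mem (n := n) h hq hc hw₁ hm₁ hs) _
    (flux_div_mem (n := n) h hq hc hw₂ hm₂ hs)
  have h4 := h3.trans (mul_le_mul_of_nonneg_left hA h₂)
  refine mul_le_mul (Real.rpow_le_rpow (h.Theta_nonneg hs.1.le) ?_ (by positivity)) h4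
    (abs_nonneg _) (by positivity)
  exact (h.Theta_le hs.1.le).trans (hs.2.trans (le_abs_self R))

theorem speed_congr {n : ℕ} {p q r : ℝ} {ψ₁ ψ₂ u₁ u₂ : ℝ → ℝ} (hr : 0 ≤ r)
    (hψ : EqOn ψ₁ ψ₂ (Icc 0 r)) (hu : EqOn u₁ u₂ (Icc 0 r)) :
    speed n p q ψ₁ u₁ r = speed n p q ψ₂ u₂ r := by
  rw [speed, speed, flux, flux, hψ (right_mem_Icc.2 hr)]
  congr 2
  refine intervalIntegral.integral_congr fun t ht => ?_
  rw [uIcc_of_le hr] at ht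
  simp only [hψ ht, hu ht]

/-- `u` is a positive solution on `[0, R]` of the radial equation with value `α` at the pole. -/
structure IsSolutionOn (n : ℕ) (p q : ℝ) (ψ u : ℝ → ℝ) (α R : ℝ) : Prop where
  continuousOn : ContinuousOn u (Icc 0 R)
  pos : ∀ r ∈ Icc 0 R, 0 < u r
  eq : ∀ r ∈ Icc 0 R, u r = α - ∫ s in (0 : ℝ)..r, speed n p q ψ u s

namespace IsSolutionOn

variable {n : ℕ} {p q α R : ℝ} {ψ u : ℝ → ℝ}

theorem mono (hu : IsSolutionOn n p q ψ u α R) {R' : ℝ} (hR : R' ≤ R) :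
    IsSolutionOn n p q ψ u α R' :=
  ⟨hu.continuousOn.mono (Icc_subset_Icc_right hR), fun r hr => hu.pos r ⟨hr.1, hr.2.trans hR⟩,
    fun r hr => hu.eq r ⟨hr.1, hr.2.trans hR⟩⟩

theorem congr (hu : IsSolutionOn n p q ψ u α R) {v : ℝ → ℝ} (h : EqOn v u (Icc 0 R)) :
    IsSolutionOn n p q ψ v α R := by
  refine ⟨hu.continuousOn.congr h, fun r hr => h hr ▸ hu.pos r hr, fun r hr => ?_⟩
  rw [h hr, hu.eq r hr]
  congr 1
  refine intervalIntegral.integral_congr fun t ht => ?_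
  rw [uIcc_of_le hr.1] at ht
  exact speed_congr ht.1 (fun _ _ => rfl) fun s hs => (h ⟨hs.1, hs.2.trans (ht.2.trans hr.2)⟩).symm

theorem exists_mem_Icc (hu : IsSolutionOn n p q ψ u α R) (h : IsCartanHadamardModel ψ)
    (hR : 0 ≤ R) : ∃ c, 0 < c ∧ ∀ t ∈ Icc 0 R, u t ∈ Icc c α := by
  obtain ⟨x, hx, hmin⟩ := isCompact_Icc.exists_isMinOn ⟨0, left_mem_Icc.2 hR⟩ hu.continuousOn
  refine ⟨u x, hu.pos x hx, fun t ht => ⟨hmin ht, ?_⟩⟩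
  rw [hu.eq t ht, sub_le_self_iff]
  exact intervalIntegral.integral_nonneg ht.1 fun s hs => speed_nonneg h hs.1 fun y hy =>
    (hu.pos y ⟨hy.1, hy.2.trans (hs.2.trans ht.2)⟩).le

/-- Two different models are allowed, as long as they agree on [0, R]: this causality is what lets a
model be modified far out without changing its solution near the pole. Both solutions stay in a
common [c, α], where the speed is Lipschitz, so the Volterra uniqueness applies. -/
theorem eqOn {ψ' v : ℝ → ℝ} (hu : IsSolutionOn n p q ψ u α R) (hv : IsSolutionOn n p q ψ' v α R)
    (h : IsCartanHadamardModel ψ) (h' : IsCartanHadamardModel ψ') (hψ : EqOn ψ ψ' (Icc 0 R))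
    (hp : 1 < p) (hq : 0 ≤ q) : EqOn u v (Icc 0 R) := by
  rcases lt_or_ge R 0 with hR | hR
  · rw [Icc_eq_empty (by linarith)]; exact eqOn_empty _ _
  obtain ⟨c₁, hc₁, hm₁⟩ := hu.exists_mem_Icc h hR
  obtain ⟨c₂, hc₂, hm₂⟩ := hv.exists_mem_Icc h' hR
  set c := min c₁ c₂
  have hc : 0 < c := lt_min hc₁ hc₂
  obtain ⟨Λ, hΛ0, hΛ⟩ := exists_speed_lipschitz (n := n) (α := α) R h hp hq hc
  set ρ : ℝ → ℝ := fun r => max 0 (min r R) with hρ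
  have hρc : Continuous ρ := by fun_prop
  have hρm : ∀ r, ρ r ∈ Icc 0 R := fun r => ⟨le_max_left _ _, max_le hR (min_le_right _ _)⟩
  have hρe : ∀ r ∈ Icc 0 R, ρ r = r := fun r hr => by
    rw [hρ]; simp only; rw [min_eq_left hr.2, max_eq_right hr.1]
  have hm₁' : ∀ t ∈ Icc 0 R, u (ρ t) ∈ Icc c α := fun t _ =>
    ⟨(min_le_left _ _).trans (hm₁ _ (hρm t)).1, (hm₁ _ (hρm t)).2⟩
  have hm₂' : ∀ t ∈ Icc 0 R, v (ρ t) ∈ Icc c α := fun t _ =>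
    ⟨(min_le_right _ _).trans (hm₂ _ (hρm t)).1, (hm₂ _ (hρm t)).2⟩
  have hcu : Continuous fun t => u (ρ t) := hu.continuousOn.comp_continuous hρc hρm
  have hcv : Continuous fun t => v (ρ t) := hv.continuousOn.comp_continuous hρc hρm
  have key := volterra_unique (V := fun w => speed n p q ψ w) (α := α) (R := R) hΛ0 hcu hcv
    (fun r hr => intervalIntegrable_speed h hp hq hc hcu.continuousOn hm₁' hr)
    (fun r hr => intervalIntegrable_speed h hp hq hc hcv.continuousOn hm₂' hr)
    (hΛ _ _ hcu.continuousOn hcv.continuousOn hm₁' hm₂')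
    (fun r hr => by
      rw [hρe r hr, hu.eq r hr]
      congr 1
      refine intervalIntegral.integral_congr fun t ht => ?_
      rw [uIcc_of_le hr.1] at ht
      refine speed_congr ht.1 (fun _ _ => rfl) fun s hs => ?_
      simp only [hρe s ⟨hs.1, hs.2.trans (ht.2.trans hr.2)⟩])
    (fun r hr => by
      rw [hρe r hr, hv.eq r hr]
      congr 1
      refine intervalIntegral.integral_congr fun t ht => ?_
      rw [uIcc_of_le hr.1] at ht
      refine speed_congr ht.1 (fun s hs => (hψ ⟨hs.1, hs.2.trans (ht.2.trans hr.2)⟩).symm)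
        fun s hs => ?_
      simp only [hρe s ⟨hs.1, hs.2.trans (ht.2.trans hr.2)⟩])
  intro r hr
  have := key hr
  simpa only [hρe r hr] using this

end IsSolutionOn

theorem IsProfile.isSolutionOn {n : ℕ} {p q α R : ℝ} {ψ u : ℝ → ℝ} (hu : IsProfile n p q ψ u)
    (h : IsCartanHadamardModel ψ) (hp : 1 < p) (hq : 0 ≤ q) (hα : 0 < α)
    (hc : ContinuousOn u (Ici 0)) (h0 : u 0 = α) : IsSolutionOn n p q ψ u α R := by
  have hpos : ∀ r, 0 ≤ r → 0 < u r := fun r hr => by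
    rcases hr.eq_or_lt with rfl | hr
    · rwa [h0]
    · exact hu.pos r hr
  refine ⟨hc.mono Icc_subset_Ici_self, fun r hr => hpos r hr.1, fun r hr => ?_⟩
  have hcr : ContinuousOn u (Icc 0 r) := hc.mono Icc_subset_Ici_self
  obtain ⟨x, hx, hmin⟩ := isCompact_Icc.exists_isMinOn ⟨0, left_mem_Icc.2 hr.1⟩ hcr
  obtain ⟨y, hy, hmax⟩ := isCompact_Icc.exists_isMaxOn ⟨0, left_mem_Icc.2 hr.1⟩ hcr
  have hi := intervalIntegrable_speed (n := n) h hp hq (hpos x hx.1) hcr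
    (fun t ht => ⟨hmin ht, hmax ht⟩) (right_mem_Icc.2 hr.1)
  have := intervalIntegral.integral_eq_sub_of_hasDerivAt_of_le hr.1 hcr
    (fun t ht => hu.hasDerivAt t ht.1) hi.neg
  rw [intervalIntegral.integral_neg, h0] at this
  linarith

theorem critical_lt {n : ℕ} {p q : ℝ} (hp : 1 < p) (hpn : p < n)
    (hq : (n : ℝ) * p / ((n : ℝ) - p) - 1 ≤ q) : p - 1 < q := by
  have : p < (n : ℝ) * p / (n - p) := by
    rw [lt_div_iff₀ (by linarith)]; nlinarith
  linarith

/-- The equation truncated to values in [c, α] is solvable; the point is that the truncation is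
never felt. Up to a point where u = c the function solves the true equation, so the Pohozaev
inequality applies and gives u ≥ 2c there, which is absurd. -/
theorem exists_isSolutionOn {n : ℕ} {p q α R : ℝ} {ψ : ℝ → ℝ} (h : IsCartanHadamardModel ψ)
    (hp : 1 < p) (hpn : p < n) (hq : (n : ℝ) * p / ((n : ℝ) - p) - 1 ≤ q) (hα : 0 < α)
    (hR : 0 < R) : ∃ u, IsSolutionOn n p q ψ u α R ∧ u 0 = α := by
  have hpq := critical_lt hp hpn hq
  have hp1 : 0 < p - 1 := by linarith
  have hq0 : 0 < q := by linarith
  set b := 1 / (p - 1) with hb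
  have hb0 : 0 < b := by positivity
  -- Near the pole Θ vanishes and the Pohozaev bound is useless; there the crude bound on the speed
  -- keeps u ≥ α/2. On [r₀, R] the ratio Θ is at least θ, and -u'/u ≤ C/θ = K.
  obtain ⟨r₀, ⟨hr₀, hr₀R⟩, hr₀α⟩ : ∃ r₀ ∈ Ioo 0 R, r₀ * (α ^ q * r₀) ^ b < α / 2 := by
    have hcont : Continuous fun r : ℝ => r * (α ^ q * r) ^ b :=
      continuous_id.mul (Continuous.rpow_const (by fun_prop) fun _ => Or.inr hb0.le)
    have := (hcont.tendsto 0).eventually_lt_const (show 0 * (α ^ q * 0) ^ b < α / 2 by simpa)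
    obtain ⟨r, h1, h2⟩ := ((this.filter_mono nhdsWithin_le_nhds).and (Ioo_mem_nhdsGT hR)).exists
    exact ⟨r, h2, h1⟩
  set θ := ballVol n ψ r₀ / ψ R ^ (n - 1) with hθ
  have hθ0 : 0 < θ := div_pos (h.ballVol_pos hr₀) (pow_pos (h.pos hR) _)
  have hθle : ∀ r ∈ Icc r₀ R, θ ≤ Theta n ψ r := fun r hr => by
    have h0 := hr₀.trans_le hr.1
    exact _root_.div_le_div₀ (h.ballVol_pos h0).le (h.monotoneOn_ballVol hr₀.le h0.le hr.1)
      (pow_pos (h.pos h0) _)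
      (pow_le_pow_left₀ (h.nonneg h0.le) (h.monotoneOn h0.le hR.le hr.2) _)
  set C := p / ((p - 1) * (q + 1)) with hC
  have hC0 : 0 < C := by positivity
  set K := C / θ with hK
  have hK0 : 0 < K := by positivity
  -- Half of the a priori lower bound (α/2) e^{-KR}.
  set c := α / 4 * Real.exp (-(K * R)) with hcdef
  have hc : 0 < c := by positivity
  have hc2 : 2 * c ≤ α / 2 := by
    have : Real.exp (-(K * R)) ≤ 1 := by
      rw [Real.exp_le_one_iff, neg_nonpos]; positivity
    rw [hcdef]; nlinarith
  have hcα : c < α := by linarith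
  set tr : (ℝ → ℝ) → ℝ → ℝ := fun u t => max c (min (u t) α) with htr
  have htrc : ∀ u, Continuous u → ContinuousOn (tr u) (Icc 0 R) := fun u hu => by
    rw [htr]; fun_prop
  have htrm : ∀ u, ∀ t ∈ Icc 0 R, tr u t ∈ Icc c α := fun u t _ =>
    ⟨le_max_left _ _, max_le hcα.le (min_le_right _ _)⟩
  obtain ⟨Λ, hΛ0, hΛ⟩ := exists_speed_lipschitz (n := n) (α := α) R h hp hq0.le hc
  have hsp0 : ∀ u, ∀ s, 0 ≤ s → 0 ≤ speed n p q ψ (tr u) s := fun u s hs =>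
    speed_nonneg h hs fun t _ => hc.le.trans (le_max_left _ _)
  obtain ⟨u, hu, hueq⟩ := exists_volterra (V := fun u => speed n p q ψ (tr u)) (α := α)
    (B := (α ^ q * R) ^ b) hR.le hΛ0
    (fun u hu => intervalIntegrable_speed h hp hq0.le hc (htrc u hu) (htrm u)
      (right_mem_Icc.2 hR.le))
    (fun u hu s hs => by
      rw [abs_of_nonneg (hsp0 u s hs.1.le)]
      refine (speed_le h hp hq0.le hc (htrc u hu) (htrm u) hs).trans ?_
      have := hs.1
      have := hs.2
      exact Real.rpow_le_rpow (by positivity) (by gcongr) hb0.le)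
    (fun u₁ u₂ hu₁ hu₂ d s hs hd => by
      refine hΛ _ _ (htrc u₁ hu₁) (htrc u₂ hu₂) (htrm u₁) (htrm u₂) d s hs fun t ht => ?_
      refine le_trans ?_ (hd t ht)
      rw [htr]
      simp only
      rw [max_comm c, max_comm c]
      exact (abs_max_sub_max_le_abs _ _ _).trans (abs_min_sub_min_le_max _ _ _ _ |>.trans (by simp)))
  have hi : ∀ r ∈ Icc 0 R, IntervalIntegrable (speed n p q ψ (tr u)) volume 0 r := fun r hr =>
    intervalIntegrable_speed h hp hq0.le hc (htrc u hu) (htrm u) hr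
  have hu0 : u 0 = α := by
    rw [hueq 0 (left_mem_Icc.2 hR.le), intervalIntegral.integral_same, sub_zero]
  have hder : ∀ r ∈ Ioo 0 R, HasDerivAt u (-speed n p q ψ (tr u) r) r := by
    intro r hr
    have h1 := (hasDerivAt_integral_of_continuousOn isOpen_Ioo
      ((continuousOn_speed (q := q) h hp hc (htrc u hu) (htrm u)).mono Ioo_subset_Ioc_self) hr
      (hi r (Ioo_subset_Icc_self hr))).const_sub α
    refine h1.congr_of_eventuallyEq ?_
    filter_upwards [isOpen_Ioo.mem_nhds hr] with x hx using hueq x (Ioo_subset_Icc_self hx)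
  have hanti : ∀ x ∈ Icc 0 R, ∀ y ∈ Icc 0 R, x ≤ y → u y ≤ u x := by
    intro x hx y hy hxy
    rw [hueq x hx, hueq y hy]
    refine sub_le_sub_left ?_ _
    refine intervalIntegral.integral_mono_interval le_rfl hx.1 hxy ?_ (hi y hy)
    exact (ae_restrict_iff' measurableSet_Ioc).2 (Eventually.of_forall fun s hs =>
      hsp0 u s hs.1.le)
  have huα : ∀ x ∈ Icc 0 R, u x ≤ α := fun x hx =>
    hu0 ▸ hanti 0 (left_mem_Icc.2 hR.le) x hx hx.1
  have hgt : ∀ x ∈ Icc 0 R, c < u x := by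
    intro x hx
    by_contra hle
    rw [not_lt] at hle
    -- The point r₁ need not be the first with u = c: u is nonincreasing, so u ≥ c on all of [0, r₁]
    -- in any case.
    obtain ⟨r₁, hr₁, hur₁⟩ := intermediate_value_Icc' hx.1 hu.continuousOn
      (show c ∈ Icc (u x) (u 0) from ⟨hle, by rw [hu0]; exact hcα.le⟩)
    have hr₁0 : 0 < r₁ := by
      refine lt_of_le_of_ne hr₁.1 fun h0 => ?_
      rw [← h0, hu0] at hur₁
      exact hcα.ne' hur₁
    have hr₁R : r₁ ≤ R := hr₁.2.trans hx.2
    have hge : ∀ t ∈ Icc 0 r₁, c ≤ u t := fun t ht =>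
      hur₁ ▸ hanti t ⟨ht.1, ht.2.trans hr₁R⟩ r₁ ⟨hr₁.1, hr₁R⟩ ht.2
    have htru : EqOn (tr u) u (Icc 0 r₁) := fun t ht => by
      simp only [htr]
      rw [min_eq_left (huα t ⟨ht.1, ht.2.trans hr₁R⟩), max_eq_right (hge t ht)]
    have hder' : ∀ r ∈ Ioo 0 r₁, HasDerivAt u (-speed n p q ψ u r) r := by
      intro r hr
      rw [← speed_congr hr.1.le (fun _ _ => rfl) (htru.mono (Icc_subset_Icc_right hr.2.le))]
      exact hder r ⟨hr.1, hr.2.trans_le hr₁R⟩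
    have hposr : ∀ r ∈ Ioo 0 r₁, 0 < u r := fun r hr =>
      hc.trans_le (hge r (Ioo_subset_Icc_self hr))
    have hsmall : ∀ r ∈ Icc 0 R, r ≤ r₀ → α / 2 ≤ u r := by
      intro r hr hrr
      have h1 := intervalIntegral.integral_mono_on_of_le_Ioo hr.1 (hi r hr)
        (intervalIntegrable_const (c := (α ^ q * r₀) ^ b)) fun s hs => by
          refine (speed_le h hp hq0.le hc (htrc u hu) (htrm u)
            ⟨hs.1, hs.2.le.trans hr.2⟩).trans ?_
          have := hs.1
          exact Real.rpow_le_rpow (by positivity) (by gcongr; linarith [hs.2]) hb0.le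
      rw [intervalIntegral.integral_const, sub_zero, smul_eq_mul] at h1
      rw [hueq r hr]
      have h2 : r * (α ^ q * r₀) ^ b ≤ r₀ * (α ^ q * r₀) ^ b := by gcongr
      linarith
    have hlow : ∀ r ∈ Ioo 0 r₁, 2 * c ≤ u r := by
      intro r hr
      have hrR : r < R := hr.2.trans_le hr₁R
      rcases le_or_gt r r₀ with hrr | hrr
      · exact hc2.trans (hsmall r ⟨hr.1.le, hrR.le⟩ hrr)
      · have hmono := le_of_hasDerivAt_nonneg hrr.le (f := fun x => u x * Real.exp (K * x))
          (f' := fun x => Real.exp (K * x) * (K * u x - speed n p q ψ u x)) (fun x hx => by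
            have hx' : x ∈ Ioo 0 r₁ := ⟨hr₀.trans_le hx.1, hx.2.trans_lt hr.2⟩
            refine ((hder' x hx').mul (((hasDerivAt_id x).const_mul K).exp)).congr_deriv ?_
            simp only [id]
            ring) (fun x hx => by
            have hx' : x ∈ Ioo 0 r₁ := ⟨hr₀.trans hx.1, hx.2.trans hr.2⟩
            refine mul_nonneg (Real.exp_pos _).le (sub_nonneg.2 ?_)
            have h1 := Theta_mul_speed_le h hp hpn hq hposr
              (fun r hr => huα r ⟨hr.1.le, hr.2.le.trans hr₁R⟩) hder' hx'
            have h2 := hθle x ⟨hx.1.le, (hx.2.trans hrR).le⟩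
            have h3 := speed_nonneg (n := n) (p := p) (q := q) h hx'.1.le fun t ht =>
              hc.le.trans (hge t ⟨ht.1, ht.2.trans hx'.2.le⟩)
            rw [hK, div_mul_eq_mul_div, le_div_iff₀ hθ0]
            nlinarith)
        have h4 := hsmall r₀ ⟨hr₀.le, hr₀R.le⟩ le_rfl
        have h5 : 1 ≤ Real.exp (K * r₀) := Real.one_le_exp (by positivity)
        have h6 : Real.exp (-(K * R)) * Real.exp (K * r) ≤ 1 := by
          rw [← Real.exp_add, Real.exp_le_one_iff]; nlinarith
        have h7 : α / 2 ≤ u r * Real.exp (K * r) := by nlinarith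
        refine le_of_mul_le_mul_right ?_ (Real.exp_pos (K * r))
        refine le_trans ?_ h7
        rw [hcdef]
        nlinarith
    have hlim : Tendsto u (𝓝[<] r₁) (𝓝 (u r₁)) := hu.continuousAt.mono_left nhdsWithin_le_nhds
    have := ge_of_tendsto hlim (by
      filter_upwards [Ioo_mem_nhdsLT hr₁0] with r hr using hlow r hr)
    linarith
  have htru : EqOn (tr u) u (Icc 0 R) := fun t ht => by
    simp only [htr]
    rw [min_eq_left (huα t ht), max_eq_right (hgt t ht).le]
  refine ⟨u, ⟨hu.continuousOn, fun r hr => hc.trans (hgt r hr), fun r hr => ?_⟩, hu0⟩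
  rw [hueq r hr]
  congr 1
  refine intervalIntegral.integral_congr fun t ht => ?_
  rw [uIcc_of_le hr.1] at ht
  exact speed_congr ht.1 (fun _ _ => rfl) (htru.mono (Icc_subset_Icc_right (ht.2.trans hr.2)))

theorem exists_isProfile {n : ℕ} {p q α : ℝ} {ψ : ℝ → ℝ} (h : IsCartanHadamardModel ψ)
    (hp : 1 < p) (hpn : p < n) (hq : (n : ℝ) * p / ((n : ℝ) - p) - 1 ≤ q) (hα : 0 < α) :
    ∃ u, IsProfile n p q ψ u ∧ ContinuousOn u (Ici 0) ∧ u 0 = α := by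
  have hpq := critical_lt hp hpn hq
  have hq0 : 0 ≤ q := by linarith
  -- Solving up to N + 1 rather than N leaves r in the interior of the interval indexed by ⌈r⌉₊, so
  -- derivatives at r can be taken there; uniqueness makes the pieces agree.
  choose v hv hv0 using fun N : ℕ => exists_isSolutionOn (R := N + 1) h hp hpn hq hα (by positivity)
  set u : ℝ → ℝ := fun r => v ⌈r⌉₊ r with hu
  have hsol : ∀ N : ℕ, IsSolutionOn n p q ψ u α (N + 1) := by
    intro N
    refine (hv N).congr fun r hr => ?_
    have hle : r ≤ ((⌈r⌉₊ : ℕ) : ℝ) + 1 := (Nat.le_ceil r).trans (by linarith)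
    exact ((hv ⌈r⌉₊).mono hle).eqOn ((hv N).mono hr.2) h h (fun _ _ => rfl) hp hq0
      (right_mem_Icc.2 hr.1)
  have hpos : ∀ r, 0 ≤ r → 0 < u r := fun r hr =>
    (hsol ⌈r⌉₊).pos r ⟨hr, (Nat.le_ceil r).trans (by linarith)⟩
  have hnhds : ∀ r : ℝ, r < (⌈r⌉₊ : ℝ) + 1 := fun r => (Nat.le_ceil r).trans_lt (by linarith)
  refine ⟨u, ⟨fun r hr => hpos r hr.le, fun r hr => ?_, fun r hr => ?_⟩, fun r hr => ?_, ?_⟩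
  · obtain ⟨c, hc, hm⟩ := (hsol ⌈r⌉₊).exists_mem_Icc h (by positivity)
    exact intervalIntegrable_flux_integrand h hc (hsol _).continuousOn hm ⟨hr.le, (hnhds r).le⟩
  · obtain ⟨c, hc, hm⟩ := (hsol ⌈r⌉₊).exists_mem_Icc h (by positivity)
    have h1 := (hasDerivAt_integral_of_continuousOn isOpen_Ioo
      ((continuousOn_speed (q := q) (n := n) h hp hc (hsol _).continuousOn hm).mono
        Ioo_subset_Ioc_self) (show r ∈ Ioo 0 ((⌈r⌉₊ : ℝ) + 1) from ⟨hr, hnhds r⟩)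
      (intervalIntegrable_speed h hp hq0 hc (hsol _).continuousOn hm
        ⟨hr.le, (hnhds r).le⟩)).const_sub α
    refine h1.congr_of_eventuallyEq ?_
    filter_upwards [isOpen_Ioo.mem_nhds
      (show r ∈ Ioo 0 ((⌈r⌉₊ : ℝ) + 1) from ⟨hr, hnhds r⟩)] with x hx
    exact (hsol ⌈r⌉₊).eq x (Ioo_subset_Icc_self hx)
  · refine ((hsol ⌈r⌉₊).continuousOn r ⟨hr, (hnhds r).le⟩).mono_of_mem_nhdsWithin ?_
    rw [← Ici_inter_Iic]
    exact inter_mem self_mem_nhdsWithin (mem_nhdsWithin_of_mem_nhds (Iic_mem_nhds (hnhds r)))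
  · rw [hu]; exact hv0 _

/-! ### Asymptotics for models of exponential growth -/

theorem eventually_le_of_deriv_le {X X' : ℝ → ℝ} {b κ ε : ℝ} (hκ : 0 < κ) (hε : 0 < ε)
    (hX : ∀ᶠ r in atTop, HasDerivAt X (X' r) r) (h : ∀ᶠ r in atTop, X' r ≤ b - κ * X r) :
    ∀ᶠ r in atTop, X r ≤ b / κ + ε := by
  obtain ⟨R, hR⟩ := eventually_atTop.1 (hX.and h)
  have hlim : Tendsto (fun r => Real.exp (κ * r)) atTop atTop :=
    Real.tendsto_exp_atTop.comp (tendsto_id.const_mul_atTop hκ)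
  filter_upwards [eventually_ge_atTop R,
    hlim.eventually_ge_atTop ((X R - b / κ) * Real.exp (κ * R) / ε)] with r hr hr2
  have := le_of_hasDerivAt_nonpos hr (f := fun x => (X x - b / κ) * Real.exp (κ * x))
    (f' := fun x => (X' x - (b - κ * X x)) * Real.exp (κ * x)) (fun x hx => by
      refine (((hR x hx.1).1.sub_const (b / κ)).mul
        (((hasDerivAt_id x).const_mul κ).exp)).congr_deriv ?_
      simp only [id]
      field_simp
      ring) (fun x hx => mul_nonpos_of_nonpos_of_nonneg
        (sub_nonpos.2 (hR x hx.1.le).2) (Real.exp_pos _).le)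
  rw [div_le_iff₀ hε] at hr2
  have h3 : X r - b / κ ≤ ε := by
    refine le_of_mul_le_mul_right ?_ (Real.exp_pos (κ * r))
    linarith
  linarith

/-- Because X ≥ 0, the coefficients may be replaced by constants l ± d and β ∓ d, and the constant
coefficient comparison `eventually_le_of_deriv_le` is applied to -X and to X. The number d is chosen
so that the perturbed equilibrium stays on the required side of t. -/
theorem tendsto_of_linear_ode {X a b : ℝ → ℝ} {l β : ℝ} (hl : 0 < l) (hβ : 0 ≤ β)
    (hX : ∀ᶠ r in atTop, HasDerivAt X (b r - a r * X r) r) (hX0 : ∀ᶠ r in atTop, 0 ≤ X r)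
    (ha : Tendsto a atTop (𝓝 l)) (hb : Tendsto b atTop (𝓝 β)) :
    Tendsto X atTop (𝓝 (β / l)) := by
  refine tendsto_order.2 ⟨fun t ht => ?_, fun t ht => ?_⟩
  · rcases lt_or_ge t 0 with h0 | h0
    · exact hX0.mono fun r hr => h0.trans_le hr
    rw [lt_div_iff₀ hl] at ht
    set d := (β - t * l) / (2 * (1 + t)) with hd
    have hd0 : 0 < d := div_pos (by linarith) (by linarith)
    have hd1 : d * (2 * (1 + t)) = β - t * l := div_mul_cancel₀ _ (by linarith)
    have hlt : t < (β - d) / (l + d) := by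
      rw [lt_div_iff₀ (by linarith)]; nlinarith
    have := eventually_le_of_deriv_le (X := fun r => -X r) (b := -(β - d)) (κ := l + d)
      (ε := ((β - d) / (l + d) - t) / 2) (by linarith) (by linarith) (hX.mono fun r hr => hr.neg)
      (by
        filter_upwards [hX0, ha.eventually_le_const (show l < l + d by linarith),
          hb.eventually_const_le (show β - d < β by linarith)] with r h1 h2 h3
        nlinarith)
    filter_upwards [this] with r hr
    rw [neg_div] at hr
    linarith
  · have ht0 : 0 < t := (div_nonneg hβ hl.le).trans_lt ht
    rw [gt_iff_lt, div_lt_iff₀ hl] at ht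
    set d := min (l / 2) ((t * l - β) / (2 * (1 + t))) with hd
    have hd0 : 0 < d := lt_min (by linarith) (div_pos (by linarith) (by linarith))
    have hd1 : d * (2 * (1 + t)) ≤ t * l - β := by
      rw [← le_div_iff₀ (by linarith)]; exact min_le_right _ _
    have hd2 : d ≤ l / 2 := min_le_left _ _
    have hlt : (β + d) / (l - d) < t := by
      rw [div_lt_iff₀ (by linarith)]; nlinarith
    have := eventually_le_of_deriv_le (X := X) (b := β + d) (κ := l - d)
      (ε := (t - (β + d) / (l - d)) / 2) (by linarith) (by linarith) hX
      (by
        filter_upwards [hX0, ha.eventually_const_le (show l - d < l by linarith),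
          hb.eventually_le_const (show β < β + d by linarith)] with r h1 h2 h3
        nlinarith)
    filter_upwards [this] with r hr
    linarith

/-- With l = (n-1)L, both Θ and `relFlux` solve linear equations whose equilibrium is 1/l, provided
y = -u'/u tends to 0. The Pohozaev bound alone does not give y → 0; it gives enough damping in the
equation of y^{p-1} for this to follow. Then X/Θ → 1 and nothing is lost in X ≥ Θ. -/
theorem IsProfile.eventually_le_rpow_mul_thetaInt {n : ℕ} {p q α L η : ℝ} {ψ u : ℝ → ℝ}
    (hu : IsProfile n p q ψ u) (h : IsCartanHadamardModel ψ) (hp : 1 < p) (hpn : p < n)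
    (hq : (n : ℝ) * p / ((n : ℝ) - p) - 1 ≤ q) (hbd : ∀ r, 0 < r → u r ≤ α) (hL : 0 < L)
    (hψ : Tendsto (fun r => deriv ψ r / ψ r) atTop (𝓝 L)) (hη : 0 < η) :
    Tendsto (thetaInt n p ψ) atTop atTop ∧
    ∀ᶠ r in atTop, (1 - η) / decayExp p q ≤ u r ^ decayExp p q * thetaInt n p ψ r := by
  have hpq := critical_lt hp hpn hq
  have hk := decayExp_pos hp hpq
  set k := decayExp p q with hkdef
  have hp1 : 0 < p - 1 := by linarith
  have hq0 : 0 < q := by linarith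
  set b := 1 / (p - 1) with hb
  have hb0 : 0 < b := by positivity
  have hn1 : 1 < n := by exact_mod_cast (hp.trans hpn)
  have hpos : ∀ᶠ r : ℝ in atTop, 0 < r := eventually_gt_atTop 0
  set m : ℝ := ((n - 1 : ℕ) : ℝ) with hm
  have hm0 : 0 < m := by rw [hm]; exact_mod_cast Nat.sub_pos_of_lt hn1
  set l := m * L with hl
  have hl0 : 0 < l := by positivity
  have ha : Tendsto (fun r => m * (deriv ψ r / ψ r)) atTop (𝓝 l) := hψ.const_mul m
  have hΘ : Tendsto (Theta n ψ) atTop (𝓝 (1 / l)) :=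
    tendsto_of_linear_ode hl0 zero_le_one (hpos.mono fun r hr => h.hasDerivAt_Theta hr)
      (hpos.mono fun r hr => h.Theta_nonneg hr.le) ha tendsto_const_nhds
  have hΘb : Tendsto (fun r => Theta n ψ r ^ b) atTop (𝓝 ((1 / l) ^ b)) :=
    hΘ.rpow_const (Or.inr hb0.le)
  have hlb : 0 < (1 / l) ^ b := by positivity
  have hH : Tendsto (thetaInt n p ψ) atTop atTop := by
    have := eventually_mul_le_of_le_deriv (g := fun r : ℝ => r) (c := (1 / l) ^ b / 2)
      (ε := (1 / l) ^ b / 4) (by linarith)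
      (hpos.mono fun r hr => h.hasDerivAt_thetaInt (n := n) hp hr)
      (hpos.mono fun r _ => hasDerivAt_id r) (by
        filter_upwards [hΘb.eventually_const_le (show (1 / l) ^ b / 2 < (1 / l) ^ b by linarith)]
          with r hr
        rwa [mul_one]) tendsto_id
    exact tendsto_atTop_mono' _ this (tendsto_id.const_mul_atTop (by linarith))
  refine ⟨hH, ?_⟩
  have hwle : ∀ᶠ r in atTop, k / 2 * thetaInt n p ψ r ≤ u r ^ (-k) := by
    have := eventually_mul_le_of_le_deriv (c := k) (ε := k / 2) (by linarith)
      (hpos.mono fun r hr => hu.hasDerivAt_rpow_neg h hp hr)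
      (hpos.mono fun r hr => h.hasDerivAt_thetaInt (n := n) hp hr) (by
        filter_upwards [hpos] with r hr
        have := h.Theta_nonneg (n := n) hr.le
        have := hu.Theta_le_relFlux h hq0.le hr
        gcongr) hH
    filter_upwards [this] with r hr
    rwa [show k - k / 2 = k / 2 by ring] at hr
  have hw : Tendsto (fun r => u r ^ (-k)) atTop atTop :=
    tendsto_atTop_mono' _ hwle (hH.const_mul_atTop (by linarith))
  -- This is the source term in the equation of y^{p-1}; it vanishes at infinity because u^{-k} ≥
  -- (k/2) H.
  have hup : Tendsto (fun r => u r ^ (q + 1 - p)) atTop (𝓝 0) := by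
    have h1 := (hw.inv_tendsto_atTop.rpow_const (p := p - 1) (Or.inr hp1.le))
    rw [Real.zero_rpow hp1.ne'] at h1
    refine h1.congr' ?_
    filter_upwards [hpos] with r hr
    have := hu.pos r hr
    rw [Pi.inv_apply, ← Real.rpow_neg this.le, neg_neg, ← Real.rpow_mul this.le, hkdef, decayExp,
      div_mul_cancel₀ _ hp1.ne']
  set G : ℝ → ℝ := fun r => flux n q ψ u r / ψ r ^ (n - 1) with hG
  have hGpos : ∀ r, 0 < r → 0 < G r := fun r hr => div_pos (hu.flux_pos h hr)
    (pow_pos (h.pos hr) _)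
  have hGd : ∀ r, 0 < r → HasDerivAt G (u r ^ q - m * (deriv ψ r / ψ r) * G r) r := by
    intro r hr
    refine (h.hasDerivAt_inv_pow hr (hu.hasDerivAt_flux h hr)).congr_deriv ?_
    rw [mul_div_cancel_left₀ _ (pow_pos (h.pos hr) _).ne']
  set y : ℝ → ℝ := fun r => speed n p q ψ u r / u r with hy
  have hyle : ∀ r, 0 < r → y r ≤ p / ((p - 1) * (q + 1)) / Theta n ψ r := by
    intro r hr
    rw [hy]
    simp only
    rw [div_le_div_iff₀ (hu.pos r hr) (h.Theta_pos hr), mul_comm]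
    exact Theta_mul_speed_le h hp hpn hq (R := r + 1) (fun x hx => hu.pos x hx.1)
      (fun x hx => hbd x hx.1) (fun x hx => hu.hasDerivAt x hx.1) ⟨hr, by linarith⟩
  have hGpow : ∀ s : ℝ, ∀ r, 0 < r → HasDerivAt (fun x => G x * u x ^ (-s))
      (u r ^ (q - s) - (m * (deriv ψ r / ψ r) - s * y r) * (G r * u r ^ (-s))) r := by
    intro s r hr
    have hur := hu.pos r hr
    refine ((hGd r hr).mul ((hu.hasDerivAt r hr).rpow_const (p := -s)
      (Or.inl hur.ne'))).congr_deriv ?_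
    rw [sub_eq_add_neg q, Real.rpow_add hur, Real.rpow_sub_one hur.ne', hy]
    ring
  -- The function is y^{p-1}. Its damping coefficient (n-1)ψ'/ψ - (p-1)y is bounded below by a
  -- quantity with limit l(1 - p/(q+1)), positive because q + 1 > p.
  have hV : Tendsto (fun r => G r * u r ^ (-(p - 1))) atTop (𝓝 0) := by
    have hpq1 : p / (q + 1) < 1 := by rw [div_lt_one (by linarith)]; linarith
    set κ := l * (1 - p / (q + 1)) / 2 with hκ
    have hκ0 : 0 < κ := by
      have : 0 < 1 - p / (q + 1) := by linarith
      positivity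
    have hlimc : Tendsto (fun r => m * (deriv ψ r / ψ r)
        - (p - 1) * (p / ((p - 1) * (q + 1)) / Theta n ψ r)) atTop (𝓝 (2 * κ)) := by
      have := ha.sub (((tendsto_const_nhds (x := p / ((p - 1) * (q + 1)))).div hΘ
        (by positivity)).const_mul (p - 1))
      have e : l - (p - 1) * (p / ((p - 1) * (q + 1)) / (1 / l)) = 2 * κ := by
        rw [hκ]; field_simp
      rw [e] at this
      exact this
    refine tendsto_order.2 ⟨fun t ht => ?_, fun t ht => ?_⟩
    · filter_upwards [hpos] with r hr
      have := hGpos r hr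
      have := hu.pos r hr
      exact ht.trans_le (by positivity)
    · have := eventually_le_of_deriv_le (b := κ * (t / 4)) (κ := κ) (ε := t / 4) hκ0 (by linarith)
        (hpos.mono fun r hr => hGpow (p - 1) r hr) (by
          filter_upwards [hpos, hlimc.eventually_const_le (show κ < 2 * κ by linarith),
            hup.eventually_le_const (show 0 < κ * (t / 4) by positivity)] with r hr h1 h2
          have h3 := hGpos r hr
          have h4 := hu.pos r hr
          have h5 : 0 ≤ G r * u r ^ (-(p - 1)) := by positivity
          have h6 := hyle r hr
          have h7 : κ ≤ m * (deriv ψ r / ψ r) - (p - 1) * y r := by nlinarith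
          rw [show q - (p - 1) = q + 1 - p by ring]
          nlinarith)
      filter_upwards [this] with r hr
      rw [mul_div_cancel_left₀ _ hκ0.ne'] at hr
      linarith
  have hy0 : Tendsto y atTop (𝓝 0) := by
    have h1 := hV.rpow_const (p := b) (Or.inr hb0.le)
    rw [Real.zero_rpow hb0.ne'] at h1
    refine h1.congr' ?_
    filter_upwards [hpos] with r hr
    have h2 := hu.pos r hr
    rw [Real.mul_rpow (hGpos r hr).le (by positivity), ← Real.rpow_mul h2.le, hb,
      neg_mul, mul_one_div_cancel hp1.ne', Real.rpow_neg_one]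
    rfl
  -- `relFlux` is G u^{-q}; now that y → 0, its damping coefficient tends to l and its source is 1.
  have hX : Tendsto (relFlux n q ψ u) atTop (𝓝 (1 / l)) := by
    have hlima : Tendsto (fun r => m * (deriv ψ r / ψ r) - q * y r) atTop (𝓝 l) := by
      simpa using ha.sub (hy0.const_mul q)
    have := tendsto_of_linear_ode (X := fun x => G x * u x ^ (-q)) (b := fun _ => 1) hl0
      zero_le_one (hpos.mono fun r hr => by
        have := hGpow q r hr
        rwa [sub_self, Real.rpow_zero] at this) (hpos.mono fun r hr => by
        have h3 := hGpos r hr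
        have h4 := hu.pos r hr
        positivity) hlima tendsto_const_nhds
    refine this.congr' ?_
    filter_upwards [hpos] with r hr
    rw [Real.rpow_neg (hu.pos r hr).le, ← div_eq_mul_inv]
    rfl
  have hXb : Tendsto (fun r => relFlux n q ψ u r ^ b) atTop (𝓝 ((1 / l) ^ b)) :=
    hX.rpow_const (Or.inr hb0.le)
  have hcmp : ∀ᶠ r in atTop, relFlux n q ψ u r ^ b ≤ (1 + η / 2) * Theta n ψ r ^ b := by
    have h1 := hΘb.const_mul (1 + η / 2)
    filter_upwards [hXb.eventually_lt h1 (by nlinarith)] with r hr using hr.le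
  have hfin := eventually_le_mul_of_deriv_le (c := k * (1 + η / 2)) (ε := k * (η / 2))
    (by positivity) (hpos.mono fun r hr => hu.hasDerivAt_rpow_neg h hp hr)
      (hpos.mono fun r hr => h.hasDerivAt_thetaInt (n := n) hp hr) (by
        filter_upwards [hcmp] with r hr
        rw [mul_assoc]
        exact mul_le_mul_of_nonneg_left hr hk.le) hH
  filter_upwards [hfin, hpos] with r hr hr0
  have hur := Real.rpow_pos_of_pos (hu.pos r hr0) k
  have h1 : 1 ≤ k * (1 + η) * (u r ^ k * thetaInt n p ψ r) := by
    have := mul_le_mul_of_nonneg_left hr hur.le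
    rw [← Real.rpow_add (hu.pos r hr0), add_neg_cancel, Real.rpow_zero] at this
    calc (1 : ℝ) ≤ _ := this
      _ = _ := by ring
  rw [div_le_iff₀ hk]
  have h2 : 0 < u r ^ k * thetaInt n p ψ r := mul_pos hur (h.thetaInt_pos hp hr0)
  by_contra hcon
  rw [not_le] at hcon
  nlinarith [mul_pos h2 hk]

/-! ### Models with prescribed logarithmic derivative of the slope -/

/-- `γ` is admissible as `ψ''/ψ'`. -/
structure IsGrowthRate (γ : ℝ → ℝ) : Prop where
  contDiff : ContDiff ℝ ∞ γ
  nonneg : ∀ r, 0 ≤ γ r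
  eq_zero : ∀ r ≤ 1, γ r = 0

/-- The primitive of the odd function that equals `γ` on `[0, ∞)`. -/
def logSlope (γ : ℝ → ℝ) (s : ℝ) : ℝ := ∫ t in (0 : ℝ)..s, (γ t - γ (-t))

/-- The odd function `ψ` with `ψ'' = γ ψ'` on `[0, ∞)`, `ψ(0) = 0` and `ψ'(0) = 1`. -/
def growthModel (γ : ℝ → ℝ) (r : ℝ) : ℝ := ∫ s in (0 : ℝ)..r, Real.exp (logSlope γ s)

theorem contDiff_of_hasDerivAt {f g : ℝ → ℝ} (hf : ∀ r, HasDerivAt f (g r) r)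
    (hg : ContDiff ℝ ∞ g) : ContDiff ℝ ∞ f := by
  rw [contDiff_infty_iff_deriv]
  exact ⟨fun r => (hf r).differentiableAt, by rwa [funext fun r => (hf r).deriv]⟩

namespace IsGrowthRate

variable {γ : ℝ → ℝ}

theorem contDiff_odd (h : IsGrowthRate γ) : ContDiff ℝ ∞ fun t => γ t - γ (-t) :=
  h.contDiff.sub (h.contDiff.comp contDiff_neg)

theorem hasDerivAt_logSlope (h : IsGrowthRate γ) (r : ℝ) :
    HasDerivAt (logSlope γ) (γ r - γ (-r)) r :=
  intervalIntegral.integral_hasDerivAt_right (h.contDiff_odd.continuous.intervalIntegrable _ _)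
    (h.contDiff_odd.continuous.stronglyMeasurableAtFilter _ _) h.contDiff_odd.continuous.continuousAt

theorem contDiff_logSlope (h : IsGrowthRate γ) : ContDiff ℝ ∞ (logSlope γ) :=
  contDiff_of_hasDerivAt h.hasDerivAt_logSlope h.contDiff_odd

theorem hasDerivAt_growthModel (h : IsGrowthRate γ) (r : ℝ) :
    HasDerivAt (growthModel γ) (Real.exp (logSlope γ r)) r := by
  have hc : Continuous fun s => Real.exp (logSlope γ s) :=
    Real.continuous_exp.comp h.contDiff_logSlope.continuous
  exact intervalIntegral.integral_hasDerivAt_right (hc.intervalIntegrable _ _)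
    (hc.stronglyMeasurableAtFilter _ _) hc.continuousAt

theorem deriv_growthModel (h : IsGrowthRate γ) :
    deriv (growthModel γ) = fun r => Real.exp (logSlope γ r) :=
  funext fun r => (h.hasDerivAt_growthModel r).deriv

theorem contDiff_growthModel (h : IsGrowthRate γ) : ContDiff ℝ ∞ (growthModel γ) :=
  contDiff_of_hasDerivAt h.hasDerivAt_growthModel h.contDiff_logSlope.exp

theorem logSlope_neg (r : ℝ) : logSlope γ (-r) = logSlope γ r := by
  have := intervalIntegral.integral_comp_neg (a := 0) (b := r) (fun t => γ t - γ (-t))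
  rw [neg_zero] at this
  rw [logSlope, intervalIntegral.integral_symm, ← this, logSlope, ← intervalIntegral.integral_neg]
  simp only [neg_neg, neg_sub]

theorem odd_growthModel : Function.Odd (growthModel γ) := by
  intro r
  have := intervalIntegral.integral_comp_neg (a := 0) (b := r) (fun s => Real.exp (logSlope γ s))
  rw [neg_zero] at this
  rw [growthModel, intervalIntegral.integral_symm, ← this, growthModel]
  simp only [logSlope_neg]

theorem hasDerivAt_logSlope_of_nonneg (h : IsGrowthRate γ) {r : ℝ} (hr : 0 ≤ r) :
    HasDerivAt (logSlope γ) (γ r) r := by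
  have := h.hasDerivAt_logSlope r
  rwa [h.eq_zero (-r) (by linarith), sub_zero] at this

theorem logSlope_le (h : IsGrowthRate γ) {a b : ℝ} (ha : 0 ≤ a) (hab : a ≤ b) :
    logSlope γ a ≤ logSlope γ b :=
  le_of_hasDerivAt_nonneg hab
    (fun _ hx => h.hasDerivAt_logSlope_of_nonneg (ha.trans hx.1)) fun _ _ => h.nonneg _

theorem isCartanHadamardModel (h : IsGrowthRate γ) : IsCartanHadamardModel (growthModel γ) where
  contDiffOn := (contDiff_infty.1 h.contDiff_growthModel 2).contDiffOn
  map_zero := by simp [growthModel]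
  deriv_zero := by
    rw [(h.hasDerivAt_growthModel 0).hasDerivWithinAt.derivWithin (uniqueDiffOn_Ici 0 0 self_mem_Ici)]
    simp [logSlope]
  convexOn := by
    refine MonotoneOn.convexOn_of_deriv (convex_Ici 0) h.contDiff_growthModel.continuous.continuousOn
      (fun r _ => (h.hasDerivAt_growthModel r).differentiableAt.differentiableWithinAt) ?_
    rw [h.deriv_growthModel, interior_Ici]
    exact fun a ha b _ hab => Real.exp_le_exp.2 (h.logSlope_le (le_of_lt ha) hab)

theorem eqOn_growthModel {γ' : ℝ → ℝ} (h : IsGrowthRate γ) (h' : IsGrowthRate γ') {x : ℝ}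
    (he : EqOn γ γ' (Iic x)) : EqOn (growthModel γ) (growthModel γ') (Icc 0 x) := by
  intro r hr
  refine intervalIntegral.integral_congr fun s hs => ?_
  rw [uIcc_of_le hr.1] at hs
  congr 1
  refine intervalIntegral.integral_congr fun t ht => ?_
  rw [uIcc_of_le hs.1] at ht
  rw [he (ht.2.trans (hs.2.trans hr.2)), h.eq_zero (-t) (by linarith [ht.1]),
    h'.eq_zero (-t) (by linarith [ht.1])]

/-- `ψ' - L ψ` is constant where `γ = L`. -/
theorem deriv_sub_eq (h : IsGrowthRate γ) {L x : ℝ} (hx : 0 ≤ x) (hL : ∀ r, x ≤ r → γ r = L) :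
    ∀ r, x ≤ r → Real.exp (logSlope γ r) - L * growthModel γ r =
      Real.exp (logSlope γ x) - L * growthModel γ x := by
  intro r hr
  have hd : ∀ t ∈ Icc x r, HasDerivAt
      (fun t => Real.exp (logSlope γ t) - L * growthModel γ t) 0 t := by
    intro t ht
    refine ((h.hasDerivAt_logSlope_of_nonneg (hx.trans ht.1)).exp.sub
      ((h.hasDerivAt_growthModel t).const_mul L)).congr_deriv ?_
    rw [hL t ht.1]; ring
  exact le_antisymm (le_of_hasDerivAt_nonpos hr hd fun _ _ => le_rfl)
    (le_of_hasDerivAt_nonneg hr hd fun _ _ => le_rfl)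

theorem tendsto_growthModel (h : IsGrowthRate γ) : Tendsto (growthModel γ) atTop atTop :=
  tendsto_atTop_mono' _ ((eventually_ge_atTop 0).mono fun _ hr => h.isCartanHadamardModel.le_self hr)
    tendsto_id

theorem tendsto_deriv_div (h : IsGrowthRate γ) {L x : ℝ} (hx : 0 ≤ x)
    (hL : ∀ r, x ≤ r → γ r = L) :
    Tendsto (fun r => deriv (growthModel γ) r / growthModel γ r) atTop (𝓝 L) := by
  have h1 : Tendsto (fun r => L + (Real.exp (logSlope γ x) - L * growthModel γ x) /
      growthModel γ r) atTop (𝓝 (L + 0)) :=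
    tendsto_const_nhds.add (h.tendsto_growthModel.const_div_atTop _)
  rw [add_zero] at h1
  refine h1.congr' ?_
  filter_upwards [eventually_ge_atTop x, eventually_gt_atTop 0] with r hr hr0
  have := h.isCartanHadamardModel.pos hr0
  rw [h.deriv_growthModel, ← h.deriv_sub_eq hx hL r hr]
  field_simp
  ring

theorem tendsto_mul_deriv_div (h : IsGrowthRate γ) {x : ℝ} (hx : 0 ≤ x)
    (hL : ∀ r, x ≤ r → γ r = 0) :
    Tendsto (fun r => r * deriv (growthModel γ) r / growthModel γ r) atTop (𝓝 1) := by
  set S := Real.exp (logSlope γ x) with hS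
  have hS0 : 0 < S := Real.exp_pos _
  have hS1 : ∀ r, x ≤ r → Real.exp (logSlope γ r) = S := fun r hr => by
    have := h.deriv_sub_eq hx hL r hr
    simpa only [zero_mul, sub_zero] using this
  have hlin : ∀ r, x ≤ r → growthModel γ r - S * r = growthModel γ x - S * x := by
    intro r hr
    have hd : ∀ t ∈ Icc x r, HasDerivAt (fun t => growthModel γ t - S * t) 0 t := by
      intro t ht
      refine ((h.hasDerivAt_growthModel t).sub ((hasDerivAt_id t).const_mul S)).congr_deriv ?_
      rw [hS1 t ht.1]; ring
    exact le_antisymm (le_of_hasDerivAt_nonpos hr hd fun _ _ => le_rfl)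
      (le_of_hasDerivAt_nonneg hr hd fun _ _ => le_rfl)
  have h1 : Tendsto (fun r => 1 - (growthModel γ x - S * x) /
      growthModel γ r) atTop (𝓝 (1 - 0)) :=
    tendsto_const_nhds.sub (h.tendsto_growthModel.const_div_atTop _)
  rw [sub_zero] at h1
  refine h1.congr' ?_
  filter_upwards [eventually_ge_atTop x, eventually_gt_atTop 0] with r hr hr0
  have := h.isCartanHadamardModel.pos hr0
  rw [h.deriv_growthModel, ← hlin r hr]
  simp only
  rw [hS1 r hr]
  field_simp
  ring

end IsGrowthRate

theorem eventually_exp_le {ψ : ℝ → ℝ} {L M : ℝ} (h : IsCartanHadamardModel ψ)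
    (hψ : Tendsto (fun r => deriv ψ r / ψ r) atTop (𝓝 L)) (hM : M < L) :
    ∀ᶠ r in atTop, Real.exp (M * r) ≤ ψ r := by
  have hpos : ∀ᶠ r : ℝ in atTop, 0 < r := eventually_gt_atTop 0
  have := eventually_mul_le_of_le_deriv (f := fun r => Real.log (ψ r)) (g := fun r : ℝ => r)
    (c := (M + L) / 2) (ε := (L - M) / 2) (by linarith)
    (hpos.mono fun r hr => (h.hasDerivAt hr).log (h.pos hr).ne')
    (hpos.mono fun r _ => hasDerivAt_id r)
    ((hψ.eventually_const_le (show (M + L) / 2 < L by linarith)).mono fun r hr => by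
      rwa [mul_one]) tendsto_id
  filter_upwards [this, hpos] with r hr hr0
  rw [← Real.le_log_iff_exp_le (h.pos hr0)]
  linarith

theorem thetaInt_congr {n : ℕ} {p r : ℝ} {ψ ψ' : ℝ → ℝ} (hr : 0 ≤ r)
    (h : EqOn ψ ψ' (Icc 0 r)) : thetaInt n p ψ r = thetaInt n p ψ' r := by
  refine intervalIntegral.integral_congr fun s hs => ?_
  rw [uIcc_of_le hr] at hs
  simp only [Theta]
  rw [h hs]
  congr 2
  refine intervalIntegral.integral_congr fun t ht => ?_
  rw [uIcc_of_le hs.1] at ht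
  simp only [h ⟨ht.1, ht.2.trans hs.2⟩]

/-! ### A model on which the rescaled solution oscillates -/

/-- On `[x, y]` the quantity `u^k ∫Θ^{1/(p-1)}` drops below `(1-δ)/k` and comes back close to
`1/k`, while the model beats `e^{Nr}`. -/
structure OscillatesOn (n : ℕ) (p q δ : ℝ) (ψ u : ℝ → ℝ) (N : ℕ) (x y : ℝ) : Prop where
  low : ∃ r ∈ Icc x y, u r ^ decayExp p q * thetaInt n p ψ r ≤ (1 - δ) / decayExp p q
  high : ∃ r ∈ Icc x y, (1 - 1 / ((N : ℝ) + 1)) / decayExp p q ≤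
      u r ^ decayExp p q * thetaInt n p ψ r ∧ Real.exp (N * r) ≤ ψ r ∧ N ≤ thetaInt n p ψ r

/-- One oscillation: continue with γ = 0 until u^k H is low at y, switch to γ = L until it is high
at z, then return to γ = 0. The conclusion is stated for every later modification γ'' beyond x', so
it passes to the limit of the construction. -/
theorem exists_growthRate_step {n : ℕ} {p q α ε δ : ℝ} (hp : 1 < p) (hpn : p < n)
    (hq : (n : ℝ) * p / ((n : ℝ) - p) - 1 ≤ q) (hα : 0 < α)
    (hε : ∀ ψ : ℝ → ℝ, IsCartanHadamardModel ψ →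
      Tendsto (fun r => r * deriv ψ r / ψ r) atTop (𝓝 1) → ∀ᶠ r in atTop, ε ≤ ratio n p ψ r)
    (hδ : ∀ ψ u : ℝ → ℝ, IsCartanHadamardModel ψ →
      IsProfile n p q ψ u → (∀ᶠ r in atTop, ε ≤ ratio n p ψ r) →
      ∃ᶠ r in atTop, u r ^ decayExp p q * thetaInt n p ψ r ≤ (1 - δ) / decayExp p q)
    {γ : ℝ → ℝ} {x : ℝ} (hγ : IsGrowthRate γ) (hx : 0 ≤ x) (hγx : ∀ r, x ≤ r → γ r = 0) (N : ℕ) :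
    ∃ (γ' : ℝ → ℝ) (x' : ℝ), IsGrowthRate γ' ∧ x + 1 ≤ x' ∧ (∀ r, x' ≤ r → γ' r = 0) ∧
      EqOn γ' γ (Iic x) ∧ ∀ γ'' : ℝ → ℝ, IsGrowthRate γ'' → EqOn γ'' γ' (Iic x') →
        ∀ u, IsProfile n p q (growthModel γ'') u → ContinuousOn u (Ici 0) → u 0 = α →
          OscillatesOn n p q δ (growthModel γ'') u N x x' := by
  have hpq := critical_lt hp hpn hq
  have hq0 : 0 ≤ q := by linarith
  have hψ := hγ.isCartanHadamardModel
  obtain ⟨u₀, hu₀, hc₀, h0₀⟩ := exists_isProfile hψ hp hpn hq hα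
  obtain ⟨y, hylow, hy⟩ := ((hδ _ _ hψ hu₀ (hε _ hψ
    (hγ.tendsto_mul_deriv_div hx hγx))).and_eventually (eventually_ge_atTop (max x 1))).exists
  have hyx : x ≤ y := (le_max_left _ _).trans hy
  have hy1 : 1 ≤ y := (le_max_right _ _).trans hy
  -- L > N gives ψ ≥ e^{Nr} eventually, and 1/L is the tolerance required in `OscillatesOn`.
  set L : ℝ := (N : ℝ) + 1 with hL
  have hL0 : 0 < L := by positivity
  set γ₁ : ℝ → ℝ := fun r => γ r + L * Real.smoothTransition (r - y) with hγ₁def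
  have hγ₁ : IsGrowthRate γ₁ := by
    refine ⟨hγ.contDiff.add (contDiff_const.mul
      (Real.smoothTransition.contDiff.comp (contDiff_id.sub contDiff_const))), fun r => ?_,
      fun r hr => ?_⟩
    · have := hγ.nonneg r
      have := Real.smoothTransition.nonneg (r - y)
      positivity
    · simp only [hγ₁def]
      rw [hγ.eq_zero r hr, Real.smoothTransition.zero_of_nonpos (by linarith)]; simp
  have hγ₁L : ∀ r, y + 1 ≤ r → γ₁ r = L := fun r hr => by
    simp only [hγ₁def]
    rw [hγx r (by linarith), Real.smoothTransition.one_of_one_le (by linarith)]; simp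
  have hψ₁ := hγ₁.isCartanHadamardModel
  obtain ⟨u₁, hu₁, hc₁, h0₁⟩ := exists_isProfile hψ₁ hp hpn hq hα
  have hbd : ∀ r, 0 < r → u₁ r ≤ α := fun r hr => by
    obtain ⟨c, -, hm⟩ := (hu₁.isSolutionOn (R := r) hψ₁ hp hq0 hα hc₁ h0₁).exists_mem_Icc hψ₁ hr.le
    exact (hm r (right_mem_Icc.2 hr.le)).2
  have hlim₁ := hγ₁.tendsto_deriv_div (by linarith : 0 ≤ y + 1) hγ₁L
  obtain ⟨hH, hhigh⟩ := hu₁.eventually_le_rpow_mul_thetaInt hψ₁ hp hpn hq hbd hL0 hlim₁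
    (η := 1 / L) (by positivity)
  obtain ⟨z, hz1, hz2, hz3, hz4⟩ := (hhigh.and ((eventually_exp_le hψ₁ hlim₁
    (show (N : ℝ) < L by linarith)).and ((hH.eventually_ge_atTop (N : ℝ)).and
      (eventually_ge_atTop (y + 1))))).exists
  -- The second cutoff is 1 up to z and 0 from z + 1 on. Thus γ' equals γ up to y and γ₁ up to z, so
  -- the points y and z found for these two models keep their properties.
  set γ' : ℝ → ℝ := fun r => γ r +
    L * (Real.smoothTransition (r - y) * Real.smoothTransition (z + 1 - r)) with hγ'def
  have hγ'₁ : EqOn γ' γ₁ (Iic z) := fun r hr => by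
    have hr := mem_Iic.1 hr
    simp only [hγ'def, hγ₁def]
    rw [Real.smoothTransition.one_of_one_le (x := z + 1 - r) (by linarith), mul_one]
  have hγ'γ : EqOn γ' γ (Iic y) := fun r hr => by
    have hr := mem_Iic.1 hr
    simp only [hγ'def]
    rw [Real.smoothTransition.zero_of_nonpos (x := r - y) (by linarith)]; simp
  refine ⟨γ', z + 1, ⟨hγ.contDiff.add (contDiff_const.mul
      ((Real.smoothTransition.contDiff.comp (contDiff_id.sub contDiff_const)).mul
      (Real.smoothTransition.contDiff.comp (contDiff_const.sub contDiff_id)))), fun r => ?_,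
      fun r hr => ?_⟩, by linarith, fun r hr => ?_, hγ'γ.mono (Iic_subset_Iic.2 hyx),
      fun γ'' hγ'' he u hu hc h0 => ?_⟩
  · have := hγ.nonneg r
    have := Real.smoothTransition.nonneg (r - y)
    have := Real.smoothTransition.nonneg (z + 1 - r)
    positivity
  · rw [hγ'γ (hr.trans hy1), hγ.eq_zero r hr]
  · simp only [hγ'def]
    rw [hγx r (by linarith), Real.smoothTransition.zero_of_nonpos (x := z + 1 - r) (by linarith)]
    simp
  · have hψ'' := hγ''.isCartanHadamardModel
    have hagree : ∀ (g v : ℝ → ℝ) (t : ℝ), IsGrowthRate g → 0 ≤ t → EqOn γ'' g (Iic t) →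
        IsProfile n p q (growthModel g) v → ContinuousOn v (Ici 0) → v 0 = α →
        u t = v t ∧ growthModel γ'' t = growthModel g t ∧
          thetaInt n p (growthModel γ'') t = thetaInt n p (growthModel g) t := by
      intro g v t hg ht heq hv hcv hv0
      have hE := hγ''.eqOn_growthModel hg heq
      have htI := right_mem_Icc.2 ht
      exact ⟨(hu.isSolutionOn hψ'' hp hq0 hα hc h0).eqOn
        (hv.isSolutionOn hg.isCartanHadamardModel hp hq0 hα hcv hv0) hψ'' hg.isCartanHadamardModel
        hE hp hq0 htI, hE htI, thetaInt_congr ht hE⟩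
    obtain ⟨e1, -, e2⟩ := hagree γ u₀ y hγ (by linarith) (fun r hr => by
      rw [he (mem_Iic.2 (by linarith [mem_Iic.1 hr])), hγ'γ hr]) hu₀ hc₀ h0₀
    obtain ⟨e3, e4, e5⟩ := hagree γ₁ u₁ z hγ₁ (by linarith) (fun r hr => by
      rw [he (mem_Iic.2 (by linarith [mem_Iic.1 hr])), hγ'₁ hr]) hu₁ hc₁ h0₁
    refine ⟨⟨y, ⟨hyx, by linarith⟩, ?_⟩, z, ⟨by linarith, by linarith⟩, ?_, ?_, ?_⟩
    · rwa [e1, e2]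
    · rwa [e3, e5]
    · rwa [e4]
    · rwa [e5]

/-- Iteration of the step from γ = 0. The constants ε and δ are fixed first, and they serve every
stage because each intermediate model is affine at infinity. -/
theorem exists_oscillating_growthRate {n : ℕ} {p q α : ℝ} (hp : 1 < p) (hpn : p < n)
    (hq : (n : ℝ) * p / ((n : ℝ) - p) - 1 ≤ q) (hα : 0 < α) :
    ∃ γ δ, IsGrowthRate γ ∧ 0 < δ ∧ δ < 1 ∧ ∀ u, IsProfile n p q (growthModel γ) u →
      ContinuousOn u (Ici 0) → u 0 = α →
      ∀ N : ℕ, ∃ x y, (N : ℝ) ≤ x ∧ OscillatesOn n p q δ (growthModel γ) u N x y := by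
  have hpq := critical_lt hp hpn hq
  obtain ⟨ε, hε0, hε⟩ := exists_le_ratio_of_tendsto (l := 1) n hp
  obtain ⟨δ, hδ0, hδ1, hδ⟩ := exists_frequently_rpow_mul_thetaInt_le hp hpq hε0
  let S := {s : (ℝ → ℝ) × ℝ // IsGrowthRate s.1 ∧ 0 ≤ s.2 ∧ ∀ r, s.2 ≤ r → s.1 r = 0}
  have hstep : ∀ (N : ℕ) (s : S), ∃ s' : S, s.1.2 + 1 ≤ s'.1.2 ∧ EqOn s'.1.1 s.1.1 (Iic s.1.2) ∧
      ∀ γ'' : ℝ → ℝ, IsGrowthRate γ'' → EqOn γ'' s'.1.1 (Iic s'.1.2) →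
        ∀ u, IsProfile n p q (growthModel γ'') u → ContinuousOn u (Ici 0) → u 0 = α →
          OscillatesOn n p q δ (growthModel γ'') u N s.1.2 s'.1.2 := by
    intro N s
    obtain ⟨γ', x', h1, h2, h3, h4, h5⟩ := exists_growthRate_step hp hpn hq hα hε (hδ n)
      s.2.1 s.2.2.1 s.2.2.2 N
    exact ⟨⟨(γ', x'), h1, by linarith [s.2.2.1], h3⟩, h2, h4, h5⟩
  choose next hnext1 hnext2 hnext3 using hstep
  let s₀ : S := ⟨(fun _ => 0, 0), ⟨contDiff_const, fun _ => le_rfl, fun _ _ => rfl⟩, le_rfl,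
    fun _ _ => rfl⟩
  let s : ℕ → S := fun N => Nat.rec s₀ next N
  have hs : ∀ N, s (N + 1) = next N (s N) := fun _ => rfl
  have hx1 : ∀ N, (s N).1.2 + 1 ≤ (s (N + 1)).1.2 := fun N => by rw [hs]; exact hnext1 _ _
  have hxN : ∀ N : ℕ, (N : ℝ) ≤ (s N).1.2 := by
    intro N
    induction N with
    | zero => simpa using (s 0).2.2.1
    | succ N ih => push_cast; linarith [hx1 N]
  have hmono : Monotone fun N => (s N).1.2 := monotone_nat_of_le_succ fun N => by
    linarith [hx1 N]
  have hEq : ∀ i j, i ≤ j → EqOn (s j).1.1 (s i).1.1 (Iic (s i).1.2) := by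
    intro i j hij
    induction j, hij using Nat.le_induction with
    | base => exact fun _ _ => rfl
    | succ j hij ih =>
      intro r hr
      rw [hs, hnext2 j (s j) (mem_Iic.2 (hr.trans (hmono hij))), ih hr]
  -- The stages stabilise: stage N is frozen on (-∞, x_N] and x_N ≥ N, so γ is locally equal to one
  -- of the stages, hence smooth.
  set γ : ℝ → ℝ := fun r => (s ⌈r⌉₊).1.1 r with hγdef
  have hγs : ∀ j, EqOn γ (s j).1.1 (Iic (s j).1.2) := by
    intro j r hr
    rcases le_total j ⌈r⌉₊ with hj | hj
    · exact hEq _ _ hj hr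
    · exact (hEq _ _ hj (mem_Iic.2 ((Nat.le_ceil r).trans (hxN _)))).symm
  have hγ : IsGrowthRate γ := by
    refine ⟨contDiff_iff_contDiffAt.2 fun r => ?_, fun r => (s _).2.1.nonneg r,
      fun r hr => (s _).2.1.eq_zero r hr⟩
    have hlt : r < (s (⌈r⌉₊ + 1)).1.2 :=
      ((Nat.le_ceil r).trans (hxN _)).trans_lt (by linarith [hx1 ⌈r⌉₊])
    refine (s (⌈r⌉₊ + 1)).2.1.contDiff.contDiffAt.congr_of_eventuallyEq ?_
    filter_upwards [Iio_mem_nhds hlt] with t ht using hγs (⌈r⌉₊ + 1) (mem_Iic.2 (mem_Iio.1 ht).le)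
  refine ⟨γ, δ, hγ, hδ0, hδ1, fun u hu hc h0 N => ⟨(s N).1.2, (s (N + 1)).1.2, hxN N, ?_⟩⟩
  exact hnext3 N (s N) γ hγ (hγs (N + 1)) u hu hc h0

theorem rescaled_eq {n : ℕ} {p q : ℝ} {ψ u : ℝ → ℝ} (h : IsCartanHadamardModel ψ) (hp : 1 < p)
    (hpq : p - 1 < q) {r : ℝ} (hr : 0 < r) (hu : 0 ≤ u r) :
    rescaled n p q ψ u r = (u r ^ decayExp p q * thetaInt n p ψ r) ^ ((p - 1) / (q + 1 - p)) := by
  have hp1 : 0 < p - 1 := by linarith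
  have hqp : 0 < q + 1 - p := by linarith
  rw [Real.mul_rpow (Real.rpow_nonneg hu _) (h.thetaInt_pos hp hr).le, ← Real.rpow_mul hu,
    decayExp, div_mul_div_cancel₀ hp1.ne', div_self hqp.ne', Real.rpow_one, mul_comm]
  rfl

theorem exists_oscillating_model {n : ℕ} {p q α : ℝ} (hp : 1 < p) (hpn : p < n)
    (hq : (n : ℝ) * p / ((n : ℝ) - p) - 1 ≤ q) (hα : 0 < α) :
    ∃ ψ u : ℝ → ℝ, IsCartanHadamardModel ψ ∧ ContDiff ℝ ∞ ψ ∧ Function.Odd ψ ∧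
      PStochasticallyComplete n p ψ ∧
      (∀ l : ℝ, 0 < l →
        limsup (fun r : ℝ => ((ψ r / Real.exp (l * r) : ℝ) : EReal)) atTop = ⊤) ∧
      IsProfile n p q ψ u ∧ ContinuousOn u (Ici 0) ∧ u 0 = α ∧
      ¬ ∃ L : EReal,
        Tendsto (fun r : ℝ => ((rescaled n p q ψ u r : ℝ) : EReal)) atTop (𝓝 L) := by
  have hpq := critical_lt hp hpn hq
  have hk := decayExp_pos hp hpq
  have hp1 : 0 < p - 1 := by linarith
  have hqp : 0 < q + 1 - p := by linarith
  obtain ⟨γ, δ, hγ, hδ0, hδ1, hosc⟩ := exists_oscillating_growthRate hp hpn hq hα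
  have h := hγ.isCartanHadamardModel
  obtain ⟨u, hu, hc, h0⟩ := exists_isProfile h hp hpn hq hα
  replace hosc := hosc u hu hc h0
  set k := decayExp p q with hkdef
  set e := (p - 1) / (q + 1 - p) with he
  have he0 : 0 < e := by positivity
  have hlow : ∃ᶠ r in atTop, u r ^ k * thetaInt n p (growthModel γ) r ≤ (1 - δ) / k := by
    refine frequently_atTop.2 fun b => ?_
    obtain ⟨x, y, hNx, ho⟩ := hosc ⌈b⌉₊
    obtain ⟨r, hr, hr2⟩ := ho.low
    exact ⟨r, (Nat.le_ceil b).trans (hNx.trans hr.1), hr2⟩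
  have hhigh : ∀ M : ℕ, ∃ᶠ r in atTop, (1 - 1 / ((M : ℝ) + 1)) / k ≤
      u r ^ k * thetaInt n p (growthModel γ) r ∧ Real.exp (M * r) ≤ growthModel γ r ∧
      M ≤ thetaInt n p (growthModel γ) r := by
    refine fun M => frequently_atTop.2 fun b => ?_
    -- The maximum makes the point both far out and good enough for M: the three bounds in
    -- `OscillatesOn.high` improve with the index when r ≥ 0.
    obtain ⟨x, y, hNx, ho⟩ := hosc (max ⌈b⌉₊ M)
    obtain ⟨r, hr, hr2, hr3, hr4⟩ := ho.high
    have hM : (M : ℝ) ≤ (max ⌈b⌉₊ M : ℕ) := by exact_mod_cast le_max_right _ _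
    have hb : b ≤ (max ⌈b⌉₊ M : ℕ) := (Nat.le_ceil b).trans (by exact_mod_cast le_max_left _ _)
    have hr0 : 0 ≤ r := (Nat.cast_nonneg _).trans (hNx.trans hr.1)
    refine ⟨r, hb.trans (hNx.trans hr.1), le_trans ?_ hr2, le_trans ?_ hr3, hM.trans hr4⟩
    · gcongr
    · gcongr
  have hHlim : Tendsto (thetaInt n p (growthModel γ)) atTop atTop := by
    refine tendsto_atTop.2 fun b => ?_
    obtain ⟨r, ⟨-, -, hr⟩, hr0⟩ := ((hhigh ⌈b⌉₊).and_eventually (eventually_gt_atTop 0)).exists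
    filter_upwards [eventually_ge_atTop r] with t ht
    exact (Nat.le_ceil b).trans (hr.trans (h.thetaInt_le hp hr0 ht))
  refine ⟨growthModel γ, u, h, hγ.contDiff_growthModel, IsGrowthRate.odd_growthModel,
    h.pStochasticallyComplete hHlim, fun l hl => ?_, hu, hc, h0, ?_⟩
  · rw [EReal.eq_top_iff_forall_lt]
    intro b
    obtain ⟨M, hM⟩ := exists_nat_ge (l + 1)
    refine lt_of_lt_of_le (b := ((b + 1 : ℝ) : EReal)) (by exact_mod_cast (by linarith)) ?_
    refine le_limsup_of_frequently_le ?_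
    refine ((hhigh M).and_eventually (eventually_ge_atTop (max 0 b))).mono fun r hr => ?_
    obtain ⟨⟨-, hr1, -⟩, hr2⟩ := hr
    have hr0 := (le_max_left _ _).trans hr2
    have hrb := (le_max_right _ _).trans hr2
    refine EReal.coe_le_coe_iff.2 ?_
    rw [le_div_iff₀ (Real.exp_pos _)]
    refine le_trans ?_ hr1
    calc (b + 1) * Real.exp (l * r) ≤ Real.exp r * Real.exp (l * r) := by
          gcongr
          linarith [Real.add_one_le_exp r]
      _ = Real.exp ((l + 1) * r) := by rw [← Real.exp_add]; ring_nf
      _ ≤ Real.exp (M * r) := by gcongr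
  · rintro ⟨A, hA⟩
    have hpos : ∀ᶠ r : ℝ in atTop, 0 < r := eventually_gt_atTop 0
    have hA1 : A ≤ ((((1 - δ) / k) ^ e : ℝ) : EReal) := by
      refine le_of_tendsto_of_frequently hA ((hlow.and_eventually hpos).mono fun r hr => ?_)
      rw [EReal.coe_le_coe_iff, rescaled_eq h hp hpq hr.2 (hu.pos r hr.2).le]
      have := hu.pos r hr.2
      have := h.thetaInt_pos (n := n) hp hr.2
      exact Real.rpow_le_rpow (by positivity) hr.1 he0.le
    -- Then 1/(M+1) ≤ δ/2, so any limit would be at most the value belonging to 1-δ and at least the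
    -- one belonging to 1-δ/2.
    obtain ⟨M, hM⟩ := exists_nat_gt (2 / δ)
    have hA2 : ((((1 - δ / 2) / k) ^ e : ℝ) : EReal) ≤ A := by
      refine ge_of_tendsto_of_frequently hA (((hhigh M).and_eventually hpos).mono fun r hr => ?_)
      rw [EReal.coe_le_coe_iff, rescaled_eq h hp hpq hr.2 (hu.pos r hr.2).le]
      have h1 : 1 / ((M : ℝ) + 1) ≤ δ / 2 := by
        rw [div_lt_iff₀ hδ0] at hM
        rw [div_le_div_iff₀ (by positivity) two_pos]
        nlinarith
      refine Real.rpow_le_rpow (div_nonneg (by linarith) hk.le) (le_trans ?_ hr.1.1) he0.le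
      gcongr
    have hlt : ((1 - δ) / k) ^ e < ((1 - δ / 2) / k) ^ e := by
      refine Real.rpow_lt_rpow (div_nonneg (by linarith) hk.le) ?_ he0
      gcongr
      linarith
    exact absurd (hA2.trans hA1) (not_le.2 (by exact_mod_cast hlt))

/-! ### Polar coordinates -/

section Polar

variable {n : ℕ}

/-- The surface measure of the unit sphere. -/
def sphereMeasure (n : ℕ) : Measure (Metric.sphere (0 : EuclideanSpace ℝ (Fin n)) 1) :=
  (volume : Measure (EuclideanSpace ℝ (Fin n))).toSphere

instance : IsFiniteMeasure (sphereMeasure n) := by unfold sphereMeasure; infer_instance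

/-- The product of the surface measure and Lebesgue measure on the half-line. -/
def polarMeasure (n : ℕ) : Measure (Metric.sphere (0 : EuclideanSpace ℝ (Fin n)) 1 × ℝ) :=
  (sphereMeasure n).prod (volume.restrict (Ioi 0))

/-- Polar coordinates. -/
def polarMap (z : Metric.sphere (0 : EuclideanSpace ℝ (Fin n)) 1 × ℝ) :
    EuclideanSpace ℝ (Fin n) := z.2 • (z.1 : EuclideanSpace ℝ (Fin n))

theorem continuous_polarMap : Continuous (polarMap (n := n)) := by
  unfold polarMap; fun_prop

theorem norm_polarMap (z : Metric.sphere (0 : EuclideanSpace ℝ (Fin n)) 1 × ℝ) (h : 0 < z.2) :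
    ‖polarMap z‖ = z.2 := by
  have := z.1.2
  rw [mem_sphere_zero_iff_norm] at this
  simp [polarMap, norm_smul, this, abs_of_pos h]

theorem sphereMeasure_real_pos (hn : 2 ≤ n) : 0 < (sphereMeasure n).real univ := by
  have : Nontrivial (EuclideanSpace ℝ (Fin n)) := by
    have : Nonempty (Fin n) := ⟨⟨0, by omega⟩⟩
    infer_instance
  have h : sphereMeasure n ≠ 0 := Measure.toSphere_ne_zero _
  exact ENNReal.toReal_pos (by simpa using h) (measure_ne_top _ _)

theorem ae_polarMeasure_pos : ∀ᵐ z ∂polarMeasure n, 0 < z.2 := by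
  have : ∀ᵐ r ∂(volume.restrict (Ioi (0 : ℝ))), 0 < r := ae_restrict_mem measurableSet_Ioi
  exact Measure.quasiMeasurePreserving_snd.ae this

theorem map_val_volumeIoiPow (k : ℕ) :
    MeasurePreserving (Subtype.val : Ioi (0 : ℝ) → ℝ) (Measure.volumeIoiPow k)
      ((volume.restrict (Ioi 0)).withDensity fun r => ENNReal.ofReal (r ^ k)) := by
  refine ⟨measurable_subtype_coe, Measure.ext fun s hs => ?_⟩
  rw [Measure.map_apply measurable_subtype_coe hs, Measure.volumeIoiPow,
    withDensity_apply _ (measurable_subtype_coe hs), withDensity_apply _ hs,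
    setLIntegral_subtype measurableSet_Ioi _ fun a : ℝ => ENNReal.ofReal (a ^ k),
    Measure.restrict_restrict hs]
  congr 2
  ext x
  simp [and_comm]

/-- The polar decomposition of the punctured space, transported to sphere × ℝ with Lebesgue measure
restricted to (0, ∞), so that radii are plain real numbers; the origin is a null set. -/
theorem measurePreserving_polarMap (hn : 2 ≤ n) :
    MeasurePreserving (polarMap (n := n))
      ((polarMeasure n).withDensity fun z => ENNReal.ofReal (z.2 ^ (n - 1))) volume := by
  have : Nontrivial (EuclideanSpace ℝ (Fin n)) := by
    have : Nonempty (Fin n) := ⟨⟨0, by omega⟩⟩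
    infer_instance
  set E := EuclideanSpace ℝ (Fin n)
  have h1 := (volume : Measure E).measurePreserving_homeomorphUnitSphereProd
  rw [finrank_euclideanSpace_fin] at h1
  have h2 := h1.symm (homeomorphUnitSphereProd E).toMeasurableEquiv
  have h3 : MeasurePreserving (Subtype.val : ({0}ᶜ : Set E) → E)
      (Measure.comap Subtype.val volume) volume := by
    refine ⟨measurable_subtype_coe, ?_⟩
    rw [map_comap_subtype_coe (measurableSet_singleton _).compl, restrict_compl_singleton]
  have h4 := h3.comp h2
  have h5 : MeasurePreserving (Prod.map id Subtype.val :
      Metric.sphere (0 : E) 1 × Ioi (0 : ℝ) → Metric.sphere (0 : E) 1 × ℝ)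
      ((sphereMeasure n).prod (Measure.volumeIoiPow (n - 1)))
      ((sphereMeasure n).prod
        ((volume.restrict (Ioi 0)).withDensity fun r => ENNReal.ofReal (r ^ (n - 1)))) := by
    have hs := (map_val_volumeIoiPow (n - 1))
    have : SFinite ((volume.restrict (Ioi (0 : ℝ))).withDensity
      fun r => ENNReal.ofReal (r ^ (n - 1))) := inferInstance
    exact (MeasurePreserving.id _).prod hs
  rw [prod_withDensity_right (by fun_prop)] at h5
  refine ⟨continuous_polarMap.measurable, ?_⟩
  have h6 := h5.map_eq
  have h7 := h4.map_eq
  rw [polarMeasure, ← h6, Measure.map_map continuous_polarMap.measurable h5.measurable]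
  rw [← h7]
  rfl

theorem integrable_polar {F : Type*} [NormedAddCommGroup F] [NormedSpace ℝ F] (hn : 2 ≤ n)
    {f : EuclideanSpace ℝ (Fin n) → F} (hf : Integrable f) :
    Integrable (fun z => z.2 ^ (n - 1) • f (polarMap z)) (polarMeasure n) := by
  have h := (measurePreserving_polarMap hn).integrable_comp_of_integrable hf
  rw [integrable_withDensity_iff_integrable_smul' (by fun_prop) (by simp)] at h
  refine h.congr ?_
  filter_upwards [ae_polarMeasure_pos] with z hz
  simp only [Function.comp]
  rw [ENNReal.toReal_ofReal (by positivity)]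

theorem integral_polar {F : Type*} [NormedAddCommGroup F] [NormedSpace ℝ F] [CompleteSpace F]
    (hn : 2 ≤ n) {f : EuclideanSpace ℝ (Fin n) → F} (hf : AEStronglyMeasurable f) :
    ∫ x, f x = ∫ z, z.2 ^ (n - 1) • f (polarMap z) ∂polarMeasure n := by
  have h := measurePreserving_polarMap hn
  rw [← h.map_eq, integral_map h.measurable.aemeasurable (by rwa [h.map_eq]),
    integral_withDensity_eq_integral_toReal_smul (by fun_prop) (by simp)]
  refine integral_congr_ae ?_
  filter_upwards [ae_polarMeasure_pos] with z hz
  rw [ENNReal.toReal_ofReal (by positivity)]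

theorem integral_polar_sphere {F : Type*} [NormedAddCommGroup F] [NormedSpace ℝ F]
    [CompleteSpace F] (hn : 2 ≤ n) {f : EuclideanSpace ℝ (Fin n) → F} (hf : Integrable f) :
    ∫ x, f x = ∫ θ, (∫ r in Ioi (0 : ℝ), r ^ (n - 1) • f (r • (θ : EuclideanSpace ℝ (Fin n))))
      ∂sphereMeasure n := by
  rw [integral_polar hn hf.1, polarMeasure, integral_prod _ (integrable_polar hn hf)]
  rfl

theorem integral_polar_radius {F : Type*} [NormedAddCommGroup F] [NormedSpace ℝ F]
    [CompleteSpace F] (hn : 2 ≤ n) {f : EuclideanSpace ℝ (Fin n) → F} (hf : Integrable f) :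
    ∫ x, f x = ∫ r in Ioi (0 : ℝ), ∫ θ, r ^ (n - 1) • f (r • (θ : EuclideanSpace ℝ (Fin n)))
      ∂sphereMeasure n := by
  rw [integral_polar hn hf.1, polarMeasure, integral_prod_symm _ (integrable_polar hn hf)]
  rfl

theorem integrable_sphere_mean {F : Type*} [NormedAddCommGroup F] [NormedSpace ℝ F]
    (hn : 2 ≤ n) {f : EuclideanSpace ℝ (Fin n) → F} (hf : Integrable f) :
    IntegrableOn (fun r : ℝ => ∫ θ, r ^ (n - 1) • f (r • (θ : EuclideanSpace ℝ (Fin n)))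
      ∂sphereMeasure n) (Ioi 0) :=
  (integrable_polar hn hf).integral_prod_right

theorem ae_polar (hn : 2 ≤ n) {P : EuclideanSpace ℝ (Fin n) → Prop} (h : ∀ᵐ x, P x) :
    ∀ᵐ z ∂polarMeasure n, P (polarMap z) := by
  have h1 := (measurePreserving_polarMap hn).quasiMeasurePreserving.ae h
  refine Measure.AbsolutelyContinuous.ae_le (withDensity_absolutelyContinuous' ?_ ?_) h1
  · fun_prop
  · filter_upwards [ae_polarMeasure_pos] with z hz
    simp
    positivity

/-- By Fubini the property holds at almost every radius for almost every direction; the sphere has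
positive measure, so one such direction exists. -/
theorem ae_of_ae_norm (hn : 2 ≤ n) {P : ℝ → Prop}
    (h : ∀ᵐ x : EuclideanSpace ℝ (Fin n), P ‖x‖) : ∀ᵐ r ∂(volume.restrict (Ioi (0 : ℝ))), P r := by
  have h1 := ae_polar hn h
  have h2 : ∀ᵐ z ∂polarMeasure n, P z.2 := by
    filter_upwards [h1, ae_polarMeasure_pos] with z hz hz'
    rwa [norm_polarMap z hz'] at hz
  have h3 := Measure.ae_ae_of_ae_prod h2
  have : (ae (sphereMeasure n)).NeBot := by
    rw [ae_neBot]
    intro h0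
    have := sphereMeasure_real_pos hn
    simp [h0] at this
  exact h3.exists.choose_spec

theorem integral_norm [Nontrivial (EuclideanSpace ℝ (Fin n))] {F : ℝ → ℝ} :
    ∫ x : EuclideanSpace ℝ (Fin n), F ‖x‖
      = (sphereMeasure n).real univ * ∫ r in Ioi (0 : ℝ), r ^ (n - 1) * F r := by
  rw [integral_fun_norm_addHaar, sphereMeasure, Measure.toSphere_real_apply_univ]
  simp [mul_assoc]

end Polar

/-! ### The Riemannian measure -/

namespace IsCartanHadamardModel

variable {ψ : ℝ → ℝ} {n : ℕ}

theorem warp_pos (h : IsCartanHadamardModel ψ) {r : ℝ} (hr : 0 ≤ r) : 0 < warp ψ r := by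
  unfold warp
  split_ifs with h0
  · exact one_pos
  · have : 0 < r := lt_of_le_of_ne hr (Ne.symm h0)
    exact div_pos (h.pos this) this

theorem continuousOn_warp (h : IsCartanHadamardModel ψ) : ContinuousOn (warp ψ) (Ici 0) := by
  intro r hr
  rcases eq_or_lt_of_le (show (0 : ℝ) ≤ r from hr) with rfl | hr
  · have h1 := hasDerivWithinAt_iff_tendsto_slope.1 h.hasDerivWithinAt_zero
    have : Tendsto (warp ψ) (𝓝[Ici 0 \ {0}] 0) (𝓝 (warp ψ 0)) := by
      have e : warp ψ 0 = 1 := by simp [warp]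
      rw [e]
      refine h1.congr' ?_
      filter_upwards [self_mem_nhdsWithin] with x hx
      have hx0 : x ≠ 0 := by simpa using hx.2
      simp [slope, warp, hx0, h.map_zero, div_eq_inv_mul]
    rw [← continuousWithinAt_sdiff_self]
    exact this
  · have : ContinuousAt (fun r => ψ r / r) r :=
      (h.contDiffAt hr).continuousAt.div continuousAt_id hr.ne'
    refine (this.congr ?_).continuousWithinAt
    filter_upwards [lt_mem_nhds hr] with x hx
    simp [warp, hx.ne']

theorem continuous_warp_norm (h : IsCartanHadamardModel ψ) :
    Continuous fun x : EuclideanSpace ℝ (Fin n) => warp ψ ‖x‖ :=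
  h.continuousOn_warp.comp_continuous continuous_norm fun _ => norm_nonneg _

theorem vol_eq (h : IsCartanHadamardModel ψ) (hn : 1 ≤ n) :
    vol n ψ = volume.withDensity fun x => ENNReal.ofReal (warp ψ ‖x‖ ^ (n - 1)) := by
  unfold vol
  congr 1
  ext x
  rw [sqrt_det_metricMatrix hn (h.warp_pos (norm_nonneg _))]

theorem integral_vol (h : IsCartanHadamardModel ψ) (hn : 1 ≤ n)
    (f : EuclideanSpace ℝ (Fin n) → ℝ) :
    ∫ x, f x ∂vol n ψ = ∫ x, warp ψ ‖x‖ ^ (n - 1) * f x := by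
  have hm := (h.continuous_warp_norm (n := n)).measurable
  rw [h.vol_eq hn, integral_withDensity_eq_integral_toReal_smul (by fun_prop) (by simp)]
  refine integral_congr_ae (Eventually.of_forall fun x => ?_)
  have := h.warp_pos (norm_nonneg x)
  simp only [smul_eq_mul]
  rw [ENNReal.toReal_ofReal (by positivity)]

theorem vol_absolutelyContinuous (h : IsCartanHadamardModel ψ) (hn : 1 ≤ n) :
    volume ≪ vol n ψ := by
  have hm := (h.continuous_warp_norm (n := n)).measurable
  rw [h.vol_eq hn]
  refine withDensity_absolutelyContinuous' (hm.pow_const _).ennreal_ofReal.aemeasurable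
    (Eventually.of_forall fun x => ?_)
  have := h.warp_pos (norm_nonneg x)
  simp
  positivity

theorem isFiniteMeasureOnCompacts_vol (h : IsCartanHadamardModel ψ) (hn : 1 ≤ n) :
    IsFiniteMeasureOnCompacts (vol n ψ) := by
  have hm := (h.continuous_warp_norm (n := n))
  rw [h.vol_eq hn]
  have hl : IsLocallyFiniteMeasure ((volume : Measure (EuclideanSpace ℝ (Fin n))).withDensity
      fun x => ENNReal.ofReal (warp ψ ‖x‖ ^ (n - 1))) :=
    IsLocallyFiniteMeasure.withDensity_ofReal (by fun_prop)
  infer_instance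

theorem mul_warp_pow (n : ℕ) {r : ℝ} (hr : 0 < r) :
    r ^ (n - 1) * warp ψ r ^ (n - 1) = ψ r ^ (n - 1) := by
  rw [← mul_pow]
  congr 1
  simp [warp, hr.ne']
  field_simp

theorem integral_vol_norm [Nontrivial (EuclideanSpace ℝ (Fin n))] (h : IsCartanHadamardModel ψ)
    (hn : 1 ≤ n) (F : ℝ → ℝ) :
    ∫ x, F ‖x‖ ∂vol n ψ
      = (sphereMeasure n).real univ * ∫ r in Ioi (0 : ℝ), ψ r ^ (n - 1) * F r := by
  rw [h.integral_vol hn, integral_norm (F := fun r => warp ψ r ^ (n - 1) * F r)]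
  congr 1
  refine setIntegral_congr_fun measurableSet_Ioi fun r hr => ?_
  rw [← mul_assoc, mul_warp_pow n hr]

theorem integrable_vol_iff (h : IsCartanHadamardModel ψ) (hn : 1 ≤ n)
    (f : EuclideanSpace ℝ (Fin n) → ℝ) :
    Integrable f (vol n ψ) ↔ Integrable fun x => warp ψ ‖x‖ ^ (n - 1) * f x := by
  have hm := (h.continuous_warp_norm (n := n)).measurable
  rw [h.vol_eq hn, integrable_withDensity_iff_integrable_smul' (by fun_prop) (by simp)]
  refine integrable_congr (Eventually.of_forall fun x => ?_)
  have := h.warp_pos (norm_nonneg x)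
  simp only [smul_eq_mul]
  rw [ENNReal.toReal_ofReal (by positivity)]

end IsCartanHadamardModel

/-! ### The metric on radial covectors -/

theorem sharp_radial {n : ℕ} (ψ : ℝ → ℝ) (x : EuclideanSpace ℝ (Fin n)) (a : ℝ) :
    sharp ψ x (a • radialDir x) = a • radialDir x := by
  rcases eq_or_ne x 0 with rfl | hx
  · simp [sharp, radialDir]
  · rw [sharp, inner_smul_right, inner_radialDir_self hx]
    simp

theorem metricNorm_sharp_radial {n : ℕ} {ψ : ℝ → ℝ} {x : EuclideanSpace ℝ (Fin n)} (hx : x ≠ 0)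
    (a : ℝ) : metricNorm ψ x (sharp ψ x (a • radialDir x)) = |a| := by
  rw [sharp_radial, metricNorm, metric]
  simp only [inner_smul_right, inner_smul_left, inner_radialDir_self hx]
  simp [← sq, Real.sqrt_sq_eq_abs]

theorem metric_sharp_radial {n : ℕ} {ψ : ℝ → ℝ} {x : EuclideanSpace ℝ (Fin n)}
    (hw : warp ψ ‖x‖ ≠ 0) (a : ℝ) (w : EuclideanSpace ℝ (Fin n)) :
    metric ψ x (sharp ψ x (a • radialDir x)) (sharp ψ x w) = a * ⟪radialDir x, w⟫_ℝ := by
  rw [metric_sharp hw, inner_smul_left]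
  rcases eq_or_ne x 0 with rfl | hx
  · simp [radialDir]
  · rw [sharp, inner_add_right, inner_smul_right, inner_smul_right, inner_sub_right,
      inner_smul_right, inner_radialDir_self hx]
    simp

/-! ### Profiles define weak solutions -/

theorem integrableOn_Ioi_of_eq_zero {f : ℝ → ℝ} {R : ℝ} (hf : ContinuousOn f (Ici 0))
    (h0 : ∀ r, R < r → f r = 0) : IntegrableOn f (Ioi 0) := by
  have h1 : IntegrableOn f (Icc 0 R) := (hf.mono Icc_subset_Ici_self).integrableOn_Icc
  refine h1.of_forall_sdiff_eq_zero measurableSet_Ioi fun r hr => h0 r ?_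
  by_contra hR
  exact hr.2 ⟨le_of_lt hr.1, not_lt.1 hR⟩

theorem integral_Ioi_mul_deriv_of_eq_zero {F F' v v' : ℝ → ℝ} {R : ℝ}
    (hF : ContinuousOn F (Ici 0)) (hF0 : F 0 = 0) (hd : ∀ r, 0 < r → HasDerivAt F (F' r) r)
    (hF' : ContinuousOn F' (Ici 0)) (hv : ∀ r, HasDerivAt v (v' r) r) (hv' : Continuous v')
    (h0 : ∀ r, R < r → v r = 0) :
    ∫ r in Ioi (0 : ℝ), F r * v' r = - ∫ r in Ioi (0 : ℝ), F' r * v r := by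
  have hvc : Continuous v := continuous_iff_continuousAt.2 fun r => (hv r).continuousAt
  have h0' : ∀ r, R < r → v' r = 0 := fun r hr => by
    have : HasDerivAt v 0 r := (hasDerivAt_const r (0 : ℝ)).congr_of_eventuallyEq
      ((lt_mem_nhds hr).mono fun x hx => h0 x hx)
    exact (hv r).unique this
  have h := integral_Ioi_mul_deriv_eq_deriv_mul (a := 0) (a' := 0) (b' := 0) hd
    (fun x _ => hv x)
    (integrableOn_Ioi_of_eq_zero (R := R) (hF.mul hv'.continuousOn) fun r hr => by
      simp [h0' r hr])
    (integrableOn_Ioi_of_eq_zero (R := R) (hF'.mul hvc.continuousOn) fun r hr => by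
      simp [h0 r hr]) ?_ ?_
  · simpa using h
  · have := ((hF 0 self_mem_Ici).mul hvc.continuousWithinAt).mono_left
      (nhdsWithin_mono _ Ioi_subset_Ici_self)
    simpa [hF0] using this
  · refine tendsto_const_nhds.congr' ?_
    filter_upwards [eventually_gt_atTop R] with r hr
    simp [h0 r hr]

theorem continuous_smul_radialDir {n : ℕ} {G : ℝ → ℝ} (hG : ContinuousOn G (Ici 0))
    (h0 : G 0 = 0) :
    Continuous fun x : EuclideanSpace ℝ (Fin n) => G ‖x‖ • radialDir x := by
  have hGn : Continuous fun x : EuclideanSpace ℝ (Fin n) => G ‖x‖ :=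
    hG.comp_continuous continuous_norm fun _ => norm_nonneg _
  refine continuous_iff_continuousAt.2 fun x => ?_
  rcases eq_or_ne x 0 with rfl | hx
  · have hb : ∀ y : EuclideanSpace ℝ (Fin n), ‖G ‖y‖ • radialDir y‖ ≤ |G ‖y‖| := fun y => by
      rw [norm_smul, Real.norm_eq_abs, radialDir, norm_smul, norm_inv, norm_norm]
      exact mul_le_of_le_one_right (abs_nonneg _) (inv_mul_le_one (a := ‖y‖))
    have h1 : Tendsto (fun y : EuclideanSpace ℝ (Fin n) => |G ‖y‖|) (𝓝 0) (𝓝 0) := by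
      simpa [h0] using hGn.abs.tendsto 0
    have := squeeze_zero_norm hb h1
    simpa [ContinuousAt, radialDir] using this
  · unfold radialDir
    exact hGn.continuousAt.smul
      ((continuous_norm.continuousAt.inv₀ (norm_ne_zero_iff.2 hx)).smul continuousAt_id)

theorem hasGradientAt_norm {n : ℕ} {x : EuclideanSpace ℝ (Fin n)} (hx : x ≠ 0) {f : ℝ → ℝ} {f' : ℝ}
    (hf : HasDerivAt f f' ‖x‖) : HasGradientAt (fun y => f ‖y‖) (f' • radialDir x) x := by
  have hx0 : ‖x‖ ≠ 0 := norm_ne_zero_iff.2 hx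
  have h1 := (hasStrictFDerivAt_norm_sq x).hasFDerivAt.sqrt (by positivity)
  have h2 : (fun y : EuclideanSpace ℝ (Fin n) => Real.sqrt (‖y‖ ^ 2)) = fun y => ‖y‖ :=
    funext fun y => Real.sqrt_sq (norm_nonneg y)
  rw [h2] at h1
  rw [hasGradientAt_iff_hasFDerivAt]
  refine (hf.comp_hasFDerivAt x h1).congr_fderiv ?_
  ext v
  simp [radialDir, Real.sqrt_sq (norm_nonneg x)]
  left
  field_simp

theorem hasWeakDifferential_of_hasGradientAt {n : ℕ} {u : EuclideanSpace ℝ (Fin n) → ℝ}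
    {η : EuclideanSpace ℝ (Fin n) → EuclideanSpace ℝ (Fin n)} (hu : ∀ x, HasGradientAt u (η x) x)
    (hη : Continuous η) : HasWeakDifferential u η := by
  have huc : Continuous u := continuous_iff_continuousAt.2 fun x => (hu x).continuousAt
  refine ⟨huc.locallyIntegrable, hη.locallyIntegrable, fun ξ hξ hξc v => ?_⟩
  have hf : ∀ x, fderiv ℝ u x v = ⟪η x, v⟫_ℝ := fun x => by
    rw [(hu x).hasFDerivAt.fderiv]; rfl
  have hξ' : Continuous fun x => fderiv ℝ ξ x v :=
    (hξ.continuous_fderiv (by simp)).clm_apply continuous_const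
  rw [integral_mul_fderiv_eq_neg_fderiv_mul_of_integrable]
  · simp_rw [hf]
  · simp_rw [hf]
    exact ((hη.inner continuous_const).mul hξ.continuous).integrable_of_hasCompactSupport
      hξc.mul_left
  · exact (huc.mul hξ').integrable_of_hasCompactSupport
      (HasCompactSupport.mul_left (hξc.fderiv_apply ℝ v))
  · exact (huc.mul hξ.continuous).integrable_of_hasCompactSupport hξc.mul_left
  · exact fun x _ => (hu x).differentiableAt
  · exact fun x _ => hξ.differentiable (by simp) x

namespace IsProfile

variable {n : ℕ} {p q : ℝ} {ψ u : ℝ → ℝ}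

theorem continuousOn_Ici_flux (hu : IsProfile n p q ψ u) : ContinuousOn (flux n q ψ u) (Ici 0) := by
  intro r hr
  have := intervalIntegral.continuousOn_primitive_interval'
    (hu.integrable (r + 1) (by linarith [show (0 : ℝ) ≤ r from hr])) left_mem_uIcc
  rw [uIcc_of_le (by linarith [show (0 : ℝ) ≤ r from hr])] at this
  refine (this r ⟨hr, by linarith⟩).mono_of_mem_nhdsWithin ?_
  rw [← Ici_inter_Iic]
  exact inter_mem self_mem_nhdsWithin (mem_nhdsWithin_of_mem_nhds (Iic_mem_nhds (by linarith)))

theorem speed_zero (hp : 1 < p) : speed n p q ψ u 0 = 0 := by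
  have : 0 < p - 1 := by linarith
  simp [speed, flux, this.ne']

theorem tendsto_speed_zero (hu : IsProfile n p q ψ u) (h : IsCartanHadamardModel ψ) (hp : 1 < p)
    (hq : 0 ≤ q) (hc : ContinuousOn u (Ici 0)) (h0 : 0 < u 0) :
    Tendsto (speed n p q ψ u) (𝓝[>] 0) (𝓝 0) := by
  obtain ⟨c, hc0, hm⟩ := (hu.isSolutionOn (R := 1) h hp hq h0 hc rfl).exists_mem_Icc h zero_le_one
  have hb : Tendsto (fun r : ℝ => (u 0 ^ q * r) ^ (1 / (p - 1))) (𝓝[>] 0) (𝓝 0) := by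
    have hp1 : 0 < 1 / (p - 1) := by have : 0 < p - 1 := by linarith
                                     positivity
    have : Continuous fun r : ℝ => (u 0 ^ q * r) ^ (1 / (p - 1)) :=
      Continuous.rpow_const (by fun_prop) fun _ => Or.inr hp1.le
    have := this.tendsto 0
    simp only [mul_zero, Real.zero_rpow hp1.ne'] at this
    exact this.mono_left nhdsWithin_le_nhds
  refine squeeze_zero' ?_ ?_ hb
  · filter_upwards [self_mem_nhdsWithin] with r hr using (hu.speed_pos h hr).le
  · filter_upwards [Ioc_mem_nhdsGT zero_lt_one] with r hr
    exact speed_le h hp hq hc0 (hc.mono Icc_subset_Ici_self) hm hr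

theorem continuousOn_Ici_speed (hu : IsProfile n p q ψ u) (h : IsCartanHadamardModel ψ)
    (hp : 1 < p) (hq : 0 ≤ q) (hc : ContinuousOn u (Ici 0)) (h0 : 0 < u 0) :
    ContinuousOn (speed n p q ψ u) (Ici 0) := by
  intro r hr
  rcases eq_or_lt_of_le (show (0 : ℝ) ≤ r from hr) with rfl | hr
  · rw [← continuousWithinAt_Ioi_iff_Ici, ContinuousWithinAt, speed_zero hp]
    exact hu.tendsto_speed_zero h hp hq hc h0
  · have hp1 : 0 < p - 1 := by linarith
    exact (((hu.hasDerivAt_flux h hr).continuousAt.div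
      ((h.contDiffAt hr).continuousAt.pow _) (pow_pos (h.pos hr) _).ne').rpow_const
        (Or.inr (by positivity))).continuousWithinAt

/-- Away from the pole this is the chain rule. At the pole the speed tends to 0, so the one-sided
derivative of u is 0 and u(‖y‖) - u(0) = o(‖y‖). -/
theorem hasGradientAt (hu : IsProfile n p q ψ u) (h : IsCartanHadamardModel ψ) (hp : 1 < p)
    (hq : 0 ≤ q) (hc : ContinuousOn u (Ici 0)) (h0 : 0 < u 0) (x : EuclideanSpace ℝ (Fin n)) :
    HasGradientAt (fun y => u ‖y‖) ((-speed n p q ψ u ‖x‖) • radialDir x) x := by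
  rcases eq_or_ne x 0 with rfl | hx
  · have hd : HasDerivWithinAt u 0 (Ici 0) 0 := by
      refine hasDerivWithinAt_Ici_of_tendsto_deriv (s := Ioi 0)
        (fun r hr => (hu.hasDerivAt r hr).differentiableAt.differentiableWithinAt)
        ((hc 0 self_mem_Ici).mono Ioi_subset_Ici_self) self_mem_nhdsWithin ?_
      have := (hu.tendsto_speed_zero h hp hq hc h0).neg
      rw [neg_zero] at this
      refine this.congr' ?_
      filter_upwards [self_mem_nhdsWithin] with r hr using (hu.hasDerivAt r hr).deriv.symm
    have ht : Tendsto (fun y : EuclideanSpace ℝ (Fin n) => ‖y‖) (𝓝 0) (𝓝[Ici 0] 0) :=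
      tendsto_nhdsWithin_iff.2 ⟨by simpa using (continuous_norm (E := EuclideanSpace ℝ (Fin n))).tendsto 0,
        Eventually.of_forall fun y => norm_nonneg y⟩
    have h1 := (hasDerivWithinAt_iff_isLittleO.1 hd).comp_tendsto ht
    rw [hasGradientAt_iff_isLittleO]
    simp only [radialDir, smul_zero, inner_zero_left, sub_zero, norm_zero, Function.comp_def] at h1 ⊢
    exact h1.of_norm_right
  · exact hasGradientAt_norm hx (hu.hasDerivAt _ (norm_pos_iff.2 hx))

theorem mul_speed_rpow (hu : IsProfile n p q ψ u) (h : IsCartanHadamardModel ψ) (hp : 1 < p)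
    {r : ℝ} (hr : 0 < r) : ψ r ^ (n - 1) * speed n p q ψ u r ^ (p - 1) = flux n q ψ u r := by
  have hψ := pow_pos (h.pos hr) (n - 1)
  have hp1 : p - 1 ≠ 0 := by linarith
  rw [speed, ← Real.rpow_mul (div_nonneg (hu.flux_pos h hr).le hψ.le), one_div,
    inv_mul_cancel₀ hp1, Real.rpow_one]
  field_simp

theorem integral_flux_mul_fderiv (hu : IsProfile n p q ψ u) (h : IsCartanHadamardModel ψ)
    (hc : ContinuousOn u (Ici 0)) (h0 : 0 < u 0) {ξ : EuclideanSpace ℝ (Fin n) → ℝ}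
    (hξ : ContDiff ℝ ∞ ξ) (hξc : HasCompactSupport ξ)
    (θ : Metric.sphere (0 : EuclideanSpace ℝ (Fin n)) 1) :
    ∫ r in Ioi (0 : ℝ), flux n q ψ u r * fderiv ℝ ξ (r • (θ : EuclideanSpace ℝ (Fin n))) θ
      = - ∫ r in Ioi (0 : ℝ), ψ r ^ (n - 1) * u r ^ q * ξ (r • (θ : EuclideanSpace ℝ (Fin n))) := by
  obtain ⟨R, -, hR⟩ := hξc.exists_pos_le_norm
  have hθ : ‖(θ : EuclideanSpace ℝ (Fin n))‖ = 1 := mem_sphere_zero_iff_norm.1 θ.2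
  have hpos : ∀ r, 0 ≤ r → 0 < u r := fun r hr => by
    rcases hr.eq_or_lt with rfl | hr
    · exact h0
    · exact hu.pos r hr
  refine integral_Ioi_mul_deriv_of_eq_zero (R := R) hu.continuousOn_Ici_flux (by simp [flux])
    (fun r hr => hu.hasDerivAt_flux h hr)
    ((h.continuousOn_pow _).mul (hc.rpow_const fun r hr => Or.inl (hpos r hr).ne'))
    (fun r => ?_) ?_ fun r hr => ?_
  · have h1 : HasDerivAt (fun r : ℝ => r • (θ : EuclideanSpace ℝ (Fin n))) θ r := by
      simpa using (hasDerivAt_id r).smul_const (θ : EuclideanSpace ℝ (Fin n))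
    exact (hξ.differentiable (by simp) _).hasFDerivAt.comp_hasDerivAt r h1
  · exact ((hξ.continuous_fderiv (by simp)).comp (by fun_prop)).clm_apply continuous_const
  · refine hR _ ?_
    rw [norm_smul, hθ, mul_one]
    exact hr.le.trans (le_abs_self r)

/-- The field |∇u|^{p-2}∇u is -|u'|^{p-1} times the radial direction, and ψ^{n-1}|u'|^{p-1} is the
flux. In polar coordinates the weak equation therefore reduces, ray by ray, to an integration by
parts with flux' = ψ^{n-1} u^q. -/
theorem isRadialSolution (hu : IsProfile n p q ψ u) (h : IsCartanHadamardModel ψ) (hn : 2 ≤ n)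
    (hp : 1 < p) (hq : 0 ≤ q) (hc : ContinuousOn u (Ici 0)) (h0 : 0 < u 0) :
    IsRadialSolution n p q ψ u := by
  have hn1 : 1 ≤ n := by omega
  have hp1 : 0 < p - 1 := by linarith
  set η : EuclideanSpace ℝ (Fin n) → EuclideanSpace ℝ (Fin n) :=
    fun x => (-speed n p q ψ u ‖x‖) • radialDir x with hη
  have hsc := hu.continuousOn_Ici_speed h hp hq hc h0
  have hpos : ∀ r, 0 ≤ r → 0 < u r := fun r hr => by
    rcases hr.eq_or_lt with rfl | hr
    · exact h0
    · exact hu.pos r hr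
  have hs0 : ∀ r, 0 ≤ r → 0 ≤ speed n p q ψ u r := fun r hr =>
    speed_nonneg h hr fun t ht => (hpos t ht.1).le
  have hηc : Continuous η := continuous_smul_radialDir (G := fun r => -speed n p q ψ u r) hsc.neg
    (by simp [speed_zero hp])
  have huc : Continuous fun x : EuclideanSpace ℝ (Fin n) => u ‖x‖ :=
    hc.comp_continuous continuous_norm fun _ => norm_nonneg _
  have hnorm : ∀ x, metricNorm ψ x (sharp ψ x (η x)) = speed n p q ψ u ‖x‖ := fun x => by
    rcases eq_or_ne x 0 with rfl | hx
    · simp [hη, speed_zero hp, sharp, metricNorm, metric]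
    · rw [hη, metricNorm_sharp_radial hx, abs_neg, abs_of_nonneg (hs0 _ (norm_nonneg _))]
  have hsn : Continuous fun x : EuclideanSpace ℝ (Fin n) => speed n p q ψ u ‖x‖ :=
    hsc.comp_continuous continuous_norm fun _ => norm_nonneg _
  have := h.isFiniteMeasureOnCompacts_vol hn1
  have hmem : ∀ f : EuclideanSpace ℝ (Fin n) → ℝ, Continuous f → ∀ K, IsCompact K → ∀ s : ENNReal,
      MemLp f s ((vol n ψ).restrict K) := fun f hf K hK s => by
    obtain ⟨C, hC⟩ := hK.exists_bound_of_continuousOn hf.continuousOn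
    have : IsFiniteMeasure ((vol n ψ).restrict K) := ⟨by simpa using hK.measure_lt_top⟩
    exact MemLp.of_bound hf.aestronglyMeasurable C (ae_restrict_of_forall_mem hK.measurableSet hC)
  refine ⟨fun x => hpos _ (norm_nonneg x), η,
    hasWeakDifferential_of_hasGradientAt (hu.hasGradientAt h hp hq hc h0) hηc,
    fun K hK => ⟨hmem _ huc K hK _, ?_, hmem _ huc K hK _⟩, fun ξ hξ hξc => ?_⟩
  · simp_rw [hnorm]
    exact hmem _ hsn K hK _
  set G : ℝ → ℝ := fun r => -speed n p q ψ u r ^ (p - 1) with hG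
  have hGc : Continuous fun x : EuclideanSpace ℝ (Fin n) => G ‖x‖ • radialDir x :=
    continuous_smul_radialDir (hsc.rpow_const fun _ _ => Or.inr hp1.le).neg
      (by simp [hG, speed_zero hp, hp1.ne'])
  have hw := h.continuous_warp_norm (n := n)
  have hξ' : Continuous (fderiv ℝ ξ) := hξ.continuous_fderiv (by simp)
  have e1 : ∀ x, metricNorm ψ x (sharp ψ x (η x)) ^ (p - 2)
      * metric ψ x (sharp ψ x (η x)) (sharp ψ x (gradient ξ x))
      = fderiv ℝ ξ x (G ‖x‖ • radialDir x) := fun x => by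
    rw [hnorm, metric_sharp_radial (h.warp_pos (norm_nonneg x)).ne']
    have e : ⟪radialDir x, gradient ξ x⟫_ℝ = fderiv ℝ ξ x (radialDir x) := by
      rw [real_inner_comm, gradient, InnerProductSpace.toDual_symm_apply]
    rw [e, map_smul, smul_eq_mul, hG]
    -- At the pole the speed is 0 and the exponent p - 2 may be negative; both sides vanish because
    -- the radial direction is 0 there.
    rcases eq_or_ne x 0 with rfl | hx
    · simp [radialDir]
    · have := hu.speed_pos h (norm_pos_iff.2 hx)
      have e2 : speed n p q ψ u ‖x‖ ^ (p - 1)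
          = speed n p q ψ u ‖x‖ ^ (p - 2) * speed n p q ψ u ‖x‖ := by
        rw [← Real.rpow_add_one this.ne']; ring_nf
      simp only [e2]
      ring
  simp_rw [e1]
  rw [h.integral_vol hn1, h.integral_vol hn1, integral_polar_sphere hn, integral_polar_sphere hn]
  · refine integral_congr_ae (Eventually.of_forall fun θ => ?_)
    have hθ : ‖(θ : EuclideanSpace ℝ (Fin n))‖ = 1 := mem_sphere_zero_iff_norm.1 θ.2
    have hnr : ∀ r : ℝ, 0 < r → ‖r • (θ : EuclideanSpace ℝ (Fin n))‖ = r := fun r hr => by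
      rw [norm_smul, hθ, mul_one, Real.norm_of_nonneg hr.le]
    have key := hu.integral_flux_mul_fderiv h hc h0 hξ hξc θ
    simp only [smul_eq_mul]
    rw [eq_neg_iff_add_eq_zero, add_comm, ← eq_neg_iff_add_eq_zero, ← integral_neg] at key
    rw [show (∫ r in Ioi (0 : ℝ), r ^ (n - 1) * (warp ψ ‖r • (θ : EuclideanSpace ℝ (Fin n))‖ ^ (n - 1)
        * (u ‖r • (θ : EuclideanSpace ℝ (Fin n))‖ ^ q * ξ (r • (θ : EuclideanSpace ℝ (Fin n))))))
        = ∫ r in Ioi (0 : ℝ), ψ r ^ (n - 1) * u r ^ q * ξ (r • (θ : EuclideanSpace ℝ (Fin n))) from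
      setIntegral_congr_fun measurableSet_Ioi fun r hr => ?_, key]
    · refine setIntegral_congr_fun measurableSet_Ioi fun r hr => ?_
      have hr0 : (0 : ℝ) < r := hr
      have e3 : radialDir (r • (θ : EuclideanSpace ℝ (Fin n))) = θ := by
        rw [radialDir, hnr r hr, smul_smul, inv_mul_cancel₀ hr0.ne', one_smul]
      rw [hnr r hr, e3, map_smul, smul_eq_mul, ← mul_assoc,
        IsCartanHadamardModel.mul_warp_pow n hr, ← mul_assoc, hG, mul_neg,
        hu.mul_speed_rpow h hp hr]
      ring
    · rw [hnr r hr, ← mul_assoc, IsCartanHadamardModel.mul_warp_pow n hr, mul_assoc]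
  · refine Continuous.integrable_of_hasCompactSupport ?_ ?_
    · exact (hw.pow _).mul ((huc.rpow_const fun x => Or.inl (hpos _ (norm_nonneg x)).ne').mul
        hξ.continuous)
    · exact HasCompactSupport.mul_left (HasCompactSupport.mul_left hξc)
  · refine Continuous.integrable_of_hasCompactSupport ((hw.pow _).mul (hξ'.clm_apply hGc)) ?_
    refine HasCompactSupport.mul_left (((hξc.fderiv ℝ)).mono fun x hx => ?_)
    contrapose! hx
    simp only [Function.mem_support, not_not] at hx ⊢
    simp [hx]

end IsProfile

/-! ### Weak differentials of radial functions -/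

/-- `k` is a smooth function with compact support in `(0, ∞)`. -/
structure IsTestFunction (k : ℝ → ℝ) : Prop where
  contDiff : ContDiff ℝ ∞ k
  exists_support : ∃ a b, 0 < a ∧ ∀ r, k r ≠ 0 → r ∈ Icc a b

theorem IsTestFunction.of_tsupport {k : ℝ → ℝ} (hk : ContDiff ℝ ∞ k) (hc : HasCompactSupport k)
    (hs : tsupport k ⊆ Ioi 0) : IsTestFunction k := by
  refine ⟨hk, ?_⟩
  rcases (tsupport k).eq_empty_or_nonempty with h | h
  · refine ⟨1, 1, one_pos, fun r hr => ?_⟩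
    have := subset_tsupport k hr
    rw [h] at this
    exact this.elim
  · obtain ⟨a, ha, hmin⟩ := hc.isCompact.exists_isLeast h
    obtain ⟨b, hb, hmax⟩ := hc.isCompact.exists_isGreatest h
    exact ⟨a, b, hs ha, fun r hr => ⟨hmin (subset_tsupport k hr), hmax (subset_tsupport k hr)⟩⟩

theorem ae_eq_zero_of_forall_isTestFunction {f : ℝ → ℝ} (hf : LocallyIntegrableOn f (Ioi 0))
    (h : ∀ k, IsTestFunction k → ∫ r in Ioi (0 : ℝ), f r * k r = 0) :
    ∀ᵐ r ∂(volume.restrict (Ioi 0)), f r = 0 := by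
  rw [ae_restrict_iff' measurableSet_Ioi]
  refine isOpen_Ioi.ae_eq_zero_of_integral_contDiff_smul_eq_zero hf fun g hg hgc hgs => ?_
  rw [← h g (.of_tsupport hg hgc hgs), ← integral_indicator measurableSet_Ioi]
  refine integral_congr_ae (Eventually.of_forall fun r => ?_)
  by_cases hr : r ∈ Ioi (0 : ℝ)
  · simp [indicator_of_mem hr, mul_comm]
  · rw [indicator_of_notMem hr]
    simp [image_eq_zero_of_notMem_tsupport fun h' => hr (hgs h')]

theorem locallyIntegrableOn_of_integrableOn_Ioc {f : ℝ → ℝ}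
    (hf : ∀ R, IntegrableOn f (Ioc 0 R)) : LocallyIntegrableOn f (Ioi 0) := by
  rw [locallyIntegrableOn_iff isOpen_Ioi.isLocallyClosed]
  intro K hK hKc
  obtain ⟨R, hR⟩ := hKc.bddAbove
  exact (hf R).mono_set fun r hr => ⟨hK hr, hR hr⟩

theorem IsTestFunction.integrable_mul {f k : ℝ → ℝ} (hk : IsTestFunction k)
    (hf : LocallyIntegrableOn f (Ioi 0)) : IntegrableOn (fun r => f r * k r) (Ioi 0) := by
  obtain ⟨a, b, ha, hab⟩ := hk.exists_support
  have h1 : IntegrableOn f (Icc a b) :=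
    hf.integrableOn_compact_subset (fun r hr => ha.trans_le hr.1) isCompact_Icc
  refine (h1.mul_continuousOn hk.contDiff.continuous.continuousOn isCompact_Icc
    ).of_forall_sdiff_eq_zero measurableSet_Ioi fun r hr => ?_
  rw [mul_eq_zero]
  right
  by_contra h
  exact hr.2 (hab r h)

section Radial

variable {n : ℕ}

theorem contDiff_comp_norm {g : ℝ → ℝ} {a c : ℝ} (hg : ContDiff ℝ ∞ g) (ha : 0 < a)
    (hc : ∀ r < a, g r = c) : ContDiff ℝ ∞ fun x : EuclideanSpace ℝ (Fin n) => g ‖x‖ := by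
  refine contDiff_iff_contDiffAt.2 fun x => ?_
  rcases eq_or_ne x 0 with rfl | hx
  · refine (contDiffAt_const (c := c)).congr_of_eventuallyEq ?_
    filter_upwards [Metric.ball_mem_nhds 0 ha] with y hy
    exact hc _ (by simpa using hy)
  · exact hg.contDiffAt.comp x (contDiffAt_norm ℝ hx)

theorem hasGradientAt_comp_norm {g : ℝ → ℝ} {a c : ℝ} (hg : ContDiff ℝ ∞ g) (ha : 0 < a)
    (hc : ∀ r < a, g r = c) (x : EuclideanSpace ℝ (Fin n)) :
    HasGradientAt (fun x => g ‖x‖) (deriv g ‖x‖ • radialDir x) x := by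
  rcases eq_or_ne x 0 with rfl | hx
  · simp only [radialDir, smul_zero]
    refine (hasGradientAt_const 0 c).congr_of_eventuallyEq ?_
    filter_upwards [Metric.ball_mem_nhds 0 ha] with y hy
    exact hc _ (by simpa using hy)
  · exact hasGradientAt_norm hx (hg.differentiable (by simp) _).hasDerivAt

theorem hasCompactSupport_comp_norm {g : ℝ → ℝ} {b : ℝ} (hb : ∀ r, b < r → g r = 0) :
    HasCompactSupport fun x : EuclideanSpace ℝ (Fin n) => g ‖x‖ :=
  HasCompactSupport.intro (isCompact_closedBall 0 b) fun x hx => hb _ (by simpa using hx)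

theorem IsTestFunction.eq_zero_of_lt {k : ℝ → ℝ} (hk : IsTestFunction k) :
    ∃ a b, 0 < a ∧ (∀ r < a, k r = 0) ∧ ∀ r, b < r → k r = 0 := by
  obtain ⟨a, b, ha, hab⟩ := hk.exists_support
  refine ⟨a, b, ha, fun r hr => ?_, fun r hr => ?_⟩ <;> by_contra h
  · exact hr.not_ge (hab r h).1
  · exact hr.not_ge (hab r h).2

/-- The integral of `f` over the sphere of radius `r`. -/
def shell (f : EuclideanSpace ℝ (Fin n) → ℝ) (r : ℝ) : ℝ :=
  ∫ θ, r ^ (n - 1) * f (r • (θ : EuclideanSpace ℝ (Fin n))) ∂sphereMeasure n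

theorem norm_smul_sphere {r : ℝ} (hr : 0 ≤ r)
    (θ : Metric.sphere (0 : EuclideanSpace ℝ (Fin n)) 1) :
    ‖r • (θ : EuclideanSpace ℝ (Fin n))‖ = r := by
  rw [norm_smul, mem_sphere_zero_iff_norm.1 θ.2, mul_one, Real.norm_of_nonneg hr]

theorem integral_comp_norm_mul (hn : 2 ≤ n) {G : ℝ → ℝ} {f : EuclideanSpace ℝ (Fin n) → ℝ}
    (hi : Integrable fun x => G ‖x‖ * f x) :
    ∫ x, G ‖x‖ * f x = ∫ r in Ioi (0 : ℝ), G r * shell f r := by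
  rw [integral_polar_radius hn hi]
  refine setIntegral_congr_fun measurableSet_Ioi fun r hr => ?_
  rw [shell, ← integral_const_mul]
  refine integral_congr_ae (Eventually.of_forall fun θ => ?_)
  simp only [smul_eq_mul, norm_smul_sphere (le_of_lt hr)]
  ring

theorem integrableOn_shell (hn : 2 ≤ n) {f : EuclideanSpace ℝ (Fin n) → ℝ}
    (hf : LocallyIntegrable f) (R : ℝ) : IntegrableOn (shell f) (Ioc 0 R) := by
  have h1 : Integrable ((Metric.closedBall 0 R).indicator f) :=
    (hf.integrableOn_isCompact (isCompact_closedBall 0 R)).integrable_indicator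
      measurableSet_closedBall
  refine ((integrable_sphere_mean hn h1).mono_set Ioc_subset_Ioi_self).congr_fun (fun r hr => ?_)
    measurableSet_Ioc
  refine integral_congr_ae (Eventually.of_forall fun θ => ?_)
  simp only [smul_eq_mul]
  rw [indicator_of_mem]
  simpa [norm_smul_sphere hr.1.le] using hr.2

theorem locallyIntegrableOn_shell (hn : 2 ≤ n) {f : EuclideanSpace ℝ (Fin n) → ℝ}
    (hf : LocallyIntegrable f) : LocallyIntegrableOn (shell f) (Ioi 0) :=
  locallyIntegrableOn_of_integrableOn_Ioc (integrableOn_shell hn hf)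

theorem shell_comp_norm {φ : ℝ → ℝ} {r : ℝ} (hr : 0 < r) :
    shell (fun x : EuclideanSpace ℝ (Fin n) => φ ‖x‖) r
      = (sphereMeasure n).real univ * (r ^ (n - 1) * φ r) := by
  simp [shell, norm_smul_sphere hr.le]

theorem locallyIntegrableOn_of_comp_norm (hn : 2 ≤ n) {φ : ℝ → ℝ}
    (hf : LocallyIntegrable fun x : EuclideanSpace ℝ (Fin n) => φ ‖x‖) :
    LocallyIntegrableOn φ (Ioi 0) := by
  have h1 := (locallyIntegrableOn_shell hn hf).continuousOn_mul
    (g := fun r => ((sphereMeasure n).real univ * r ^ (n - 1))⁻¹)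
    (ContinuousOn.inv₀ (by fun_prop) fun r hr =>
      (mul_pos (sphereMeasure_real_pos hn) (pow_pos hr _)).ne') isOpen_Ioi.isLocallyClosed
  refine h1.congr ((ae_restrict_iff' measurableSet_Ioi).2 (Eventually.of_forall fun r hr => ?_))
  have := sphereMeasure_real_pos hn
  have hr : 0 < r := hr
  simp only [shell_comp_norm hr]
  field_simp

namespace HasWeakDifferential

variable {u : EuclideanSpace ℝ (Fin n) → ℝ}
  {η : EuclideanSpace ℝ (Fin n) → EuclideanSpace ℝ (Fin n)}

theorem locallyIntegrable_inner (hu : HasWeakDifferential u η) (b : EuclideanSpace ℝ (Fin n)) :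
    LocallyIntegrable fun x => ⟪η x, b⟫_ℝ := by
  have := (hu.locallyIntegrable_diff.locallyIntegrableOn univ)
  rw [← locallyIntegrableOn_univ]
  have e : (fun x => ⟪η x, b⟫_ℝ) = innerSL ℝ b ∘ η := funext fun x => real_inner_comm _ _
  rw [e]
  exact (innerSL ℝ b).locallyIntegrableOn_comp this

/-- Testing with ⟪a, ·⟫ ξ gives derivatives along fields with linear coefficients: the part skew in
a, b yields rotations (`integral_skew`), the trace yields the dilation field (`integral_dilation`).
-/
theorem integral_inner_mul (hu : HasWeakDifferential u η) {ξ : EuclideanSpace ℝ (Fin n) → ℝ}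
    (hξ : ContDiff ℝ ∞ ξ) (hξc : HasCompactSupport ξ) (a b : EuclideanSpace ℝ (Fin n)) :
    ∫ x, u x * (⟪a, x⟫_ℝ * fderiv ℝ ξ x b + ⟪a, b⟫_ℝ * ξ x)
      = - ∫ x, ⟪a, x⟫_ℝ * ⟪η x, b⟫_ℝ * ξ x := by
  have hl : ContDiff ℝ ∞ fun x : EuclideanSpace ℝ (Fin n) => ⟪a, x⟫_ℝ :=
    contDiff_const.inner ℝ contDiff_id
  have h := hu.integral_eq (fun x => ⟪a, x⟫_ℝ * ξ x) (hl.mul hξ) hξc.mul_left b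
  have e : ∀ x, fderiv ℝ (fun x => ⟪a, x⟫_ℝ * ξ x) x b
      = ⟪a, x⟫_ℝ * fderiv ℝ ξ x b + ⟪a, b⟫_ℝ * ξ x := fun x => by
    have h1 : HasFDerivAt (fun x : EuclideanSpace ℝ (Fin n) => ⟪a, x⟫_ℝ) (innerSL ℝ a) x :=
      (innerSL ℝ a).hasFDerivAt
    have h2 : HasFDerivAt (fun x => ⟪a, x⟫_ℝ * ξ x) _ x :=
      h1.mul (hξ.differentiable (by simp) x).hasFDerivAt
    rw [h2.fderiv]
    simp [mul_comm]
  simp_rw [e] at h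
  rw [h]
  congr 2
  ext x
  ring

theorem integrable_mul (hu : HasWeakDifferential u η) {g : EuclideanSpace ℝ (Fin n) → ℝ}
    (hg : Continuous g) (hgc : HasCompactSupport g) : Integrable fun x => u x * g x :=
  hu.locallyIntegrable.integrable_smul_right_of_hasCompactSupport hg hgc

theorem integrable_mul_inner (hu : HasWeakDifferential u η) {ξ : EuclideanSpace ℝ (Fin n) → ℝ}
    (hξ : ContDiff ℝ ∞ ξ) (hξc : HasCompactSupport ξ) (a b : EuclideanSpace ℝ (Fin n)) :
    Integrable fun x => u x * (⟪a, x⟫_ℝ * fderiv ℝ ξ x b + ⟪a, b⟫_ℝ * ξ x) :=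
  hu.integrable_mul (((continuous_const.inner continuous_id).mul
      ((hξ.continuous_fderiv (by simp)).clm_apply continuous_const)).add
    (continuous_const.mul hξ.continuous))
    ((HasCompactSupport.mul_left (hξc.fderiv_apply ℝ b)).add (HasCompactSupport.mul_left hξc))

theorem integrable_inner_mul (hu : HasWeakDifferential u η) {ξ : EuclideanSpace ℝ (Fin n) → ℝ}
    (hξ : Continuous ξ) (hξc : HasCompactSupport ξ) (a b : EuclideanSpace ℝ (Fin n)) :
    Integrable fun x => ⟪a, x⟫_ℝ * ⟪η x, b⟫_ℝ * ξ x := by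
  have := (hu.locallyIntegrable_inner b).integrable_smul_right_of_hasCompactSupport
    (g := fun x => ⟪a, x⟫_ℝ * ξ x) ((continuous_const.inner continuous_id).mul hξ)
    (HasCompactSupport.mul_left hξc)
  refine this.congr (Eventually.of_forall fun x => ?_)
  simp only [smul_eq_mul]
  ring

theorem integral_skew (hu : HasWeakDifferential u η) {ξ : EuclideanSpace ℝ (Fin n) → ℝ}
    (hξ : ContDiff ℝ ∞ ξ) (hξc : HasCompactSupport ξ) (a b : EuclideanSpace ℝ (Fin n)) :
    ∫ x, u x * (⟪a, x⟫_ℝ * fderiv ℝ ξ x b - ⟪b, x⟫_ℝ * fderiv ℝ ξ x a)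
      = - ∫ x, (⟪a, x⟫_ℝ * ⟪η x, b⟫_ℝ - ⟪b, x⟫_ℝ * ⟪η x, a⟫_ℝ) * ξ x := by
  have hc := hu.integrable_mul_inner hξ hξc
  have hd := hu.integrable_inner_mul hξ.continuous hξc
  have h1 := hu.integral_inner_mul hξ hξc a b
  have h2 := hu.integral_inner_mul hξ hξc b a
  rw [show (fun x => u x * (⟪a, x⟫_ℝ * fderiv ℝ ξ x b - ⟪b, x⟫_ℝ * fderiv ℝ ξ x a)) =
    fun x => u x * (⟪a, x⟫_ℝ * fderiv ℝ ξ x b + ⟪a, b⟫_ℝ * ξ x)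
      - u x * (⟪b, x⟫_ℝ * fderiv ℝ ξ x a + ⟪b, a⟫_ℝ * ξ x) from funext fun x => by
      rw [real_inner_comm a b]; ring, integral_sub (hc a b) (hc b a), h1, h2]
  simp_rw [sub_mul]
  rw [integral_sub (hd a b) (hd b a)]
  ring

theorem integral_dilation (hu : HasWeakDifferential u η) {ξ : EuclideanSpace ℝ (Fin n) → ℝ}
    (hξ : ContDiff ℝ ∞ ξ) (hξc : HasCompactSupport ξ) :
    ∫ x, u x * (fderiv ℝ ξ x x + n * ξ x) = - ∫ x, ⟪η x, x⟫_ℝ * ξ x := by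
  have hc := hu.integrable_mul_inner hξ hξc
  have hd := hu.integrable_inner_mul hξ.continuous hξc
  let e := EuclideanSpace.basisFun (Fin n) ℝ
  have h := Finset.sum_congr (rfl : (Finset.univ : Finset (Fin n)) = _)
    fun i _ => hu.integral_inner_mul hξ hξc (e i) (e i)
  rw [Finset.sum_neg_distrib, ← integral_finsetSum _ fun i _ => hc _ _,
    ← integral_finsetSum _ fun i _ => hd _ _] at h
  have e1 : ∀ x, ∑ i, u x * (⟪e i, x⟫_ℝ * fderiv ℝ ξ x (e i) + ⟪e i, e i⟫_ℝ * ξ x)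
      = u x * (fderiv ℝ ξ x x + n * ξ x) := fun x => by
    rw [← Finset.mul_sum, Finset.sum_add_distrib]
    congr 2
    · have := congrArg (fderiv ℝ ξ x) (e.sum_repr' x)
      rw [map_sum] at this
      simpa only [map_smul, smul_eq_mul] using this
    · simp
  have e2 : ∀ x, ∑ i, ⟪e i, x⟫_ℝ * ⟪η x, e i⟫_ℝ * ξ x = ⟪η x, x⟫_ℝ * ξ x := fun x => by
    rw [← Finset.sum_mul, ← e.sum_inner_mul_inner (η x) x]
    simp_rw [mul_comm]
  simp_rw [e1, e2] at h
  exact h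

end HasWeakDifferential

end Radial

/-! ### The differential of a radial function is radial -/

section Radial

variable {n : ℕ}

theorem IsTestFunction.hasWeakDifferential {k : ℝ → ℝ} (hk : IsTestFunction k) :
    HasWeakDifferential (fun x : EuclideanSpace ℝ (Fin n) => k ‖x‖)
      fun x => deriv k ‖x‖ • radialDir x := by
  obtain ⟨a, b, ha, h0, -⟩ := hk.eq_zero_of_lt
  refine hasWeakDifferential_of_hasGradientAt (hasGradientAt_comp_norm hk.contDiff ha h0)
    (continuous_smul_radialDir (hk.contDiff.continuous_deriv (by simp)).continuousOn ?_)
  have : k =ᶠ[𝓝 0] fun _ => 0 := (gt_mem_nhds ha).mono fun r hr => h0 r hr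
  simpa using this.deriv_eq

/-- A rotational derivative has mean zero on spheres. Instead of integrating on the sphere,
`integral_skew` is applied to smooth radial functions k(‖x‖): their differential is radial, so the
right-hand side vanishes for every k. -/
theorem ae_shell_skew_eq_zero (hn : 2 ≤ n) {ξ : EuclideanSpace ℝ (Fin n) → ℝ}
    (hξ : ContDiff ℝ ∞ ξ) (hξc : HasCompactSupport ξ) (a b : EuclideanSpace ℝ (Fin n)) :
    ∀ᵐ r ∂(volume.restrict (Ioi (0 : ℝ))),
      shell (fun x => ⟪a, x⟫_ℝ * fderiv ℝ ξ x b - ⟪b, x⟫_ℝ * fderiv ℝ ξ x a) r = 0 := by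
  have hξ' : ∀ v, Continuous fun x => fderiv ℝ ξ x v := fun v =>
    (hξ.continuous_fderiv (by simp)).clm_apply continuous_const
  have hf : Continuous fun x => ⟪a, x⟫_ℝ * fderiv ℝ ξ x b - ⟪b, x⟫_ℝ * fderiv ℝ ξ x a :=
    ((continuous_const.inner continuous_id).mul (hξ' b)).sub
      ((continuous_const.inner continuous_id).mul (hξ' a))
  have hfc : HasCompactSupport fun x =>
      ⟪a, x⟫_ℝ * fderiv ℝ ξ x b - ⟪b, x⟫_ℝ * fderiv ℝ ξ x a :=
    (HasCompactSupport.mul_left (hξc.fderiv_apply ℝ b)).sub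
      (HasCompactSupport.mul_left (hξc.fderiv_apply ℝ a))
  refine ae_eq_zero_of_forall_isTestFunction (locallyIntegrableOn_shell hn hf.locallyIntegrable)
    fun k hk => ?_
  have h1 := (hk.hasWeakDifferential (n := n)).integral_skew hξ hξc a b
  have h2 := (hk.hasWeakDifferential (n := n)).integrable_mul hf hfc
  rw [integral_comp_norm_mul hn h2] at h1
  simp_rw [mul_comm (shell _ _)]
  rw [h1, neg_eq_zero]
  refine integral_eq_zero_of_ae (Eventually.of_forall fun x => ?_)
  simp only [radialDir, inner_smul_left, real_inner_comm, Pi.zero_apply]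
  simp only [conj_trivial, real_inner_comm x]
  ring

theorem locallyIntegrableOn_comp_norm (hn : 2 ≤ n) {f : ℝ → ℝ}
    (hf : LocallyIntegrableOn f (Ioi 0)) :
    LocallyIntegrableOn (fun x : EuclideanSpace ℝ (Fin n) => f ‖x‖) {0}ᶜ := by
  have : Nontrivial (EuclideanSpace ℝ (Fin n)) := by
    have : Nonempty (Fin n) := ⟨⟨0, by omega⟩⟩
    infer_instance
  rw [locallyIntegrableOn_iff isOpen_compl_singleton.isLocallyClosed]
  intro K hK hKc
  have hK' : IsCompact (norm '' K) := hKc.image continuous_norm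
  have hsub : norm '' K ⊆ Ioi (0 : ℝ) := by
    rintro _ ⟨x, hx, rfl⟩
    exact norm_pos_iff.2 (hK hx)
  have h1 : IntegrableOn f (norm '' K) := hf.integrableOn_compact_subset hsub hK'
  have h2 : Integrable fun x : EuclideanSpace ℝ (Fin n) => (norm '' K).indicator f ‖x‖ := by
    rw [integrable_fun_norm_addHaar]
    have h3 : IntegrableOn (fun r : ℝ => r ^ (n - 1) * f r) (norm '' K) :=
      h1.continuousOn_mul (by fun_prop) hK'
    have h4 := (h3.integrable_indicator hK'.measurableSet).integrableOn (s := Ioi 0)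
    refine h4.congr_fun (fun r _ => ?_) measurableSet_Ioi
    by_cases hr : r ∈ norm '' K
    · simp only [indicator_of_mem hr, finrank_euclideanSpace_fin, smul_eq_mul]
    · simp only [indicator_of_notMem hr, smul_zero]
  refine h2.integrableOn.congr_fun (fun x hx => ?_) hKc.measurableSet
  exact indicator_of_mem (mem_image_of_mem _ hx) _

/-- The radial derivative of a radial function with weak differential `η`. -/
def radialSlope (η : EuclideanSpace ℝ (Fin n) → EuclideanSpace ℝ (Fin n)) (r : ℝ) : ℝ :=
  ((sphereMeasure n).real univ * r ^ n)⁻¹ * shell (fun x => ⟪η x, x⟫_ℝ) r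

namespace HasWeakDifferential

variable {φ : ℝ → ℝ} {η : EuclideanSpace ℝ (Fin n) → EuclideanSpace ℝ (Fin n)}

theorem locallyIntegrable_inner_self {u : EuclideanSpace ℝ (Fin n) → ℝ}
    (hu : HasWeakDifferential u η) :
    LocallyIntegrable fun x => ⟪η x, x⟫_ℝ := by
  have e : (fun x => ⟪η x, x⟫_ℝ) = fun x => ∑ i : Fin n, x i * ⟪η x, EuclideanSpace.single i 1⟫_ℝ := by
    ext x
    simp [PiLp.inner_apply]
  rw [e]
  refine locallyIntegrable_finsetSum _ fun i _ => ?_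
  rw [← locallyIntegrableOn_univ]
  exact ((hu.locallyIntegrable_inner _).locallyIntegrableOn univ).continuousOn_mul
    (Continuous.continuousOn (by fun_prop)) isOpen_univ.isLocallyClosed

theorem locallyIntegrableOn_radialSlope (hn : 2 ≤ n) {u : EuclideanSpace ℝ (Fin n) → ℝ}
    (hu : HasWeakDifferential u η) : LocallyIntegrableOn (radialSlope η) (Ioi 0) :=
  (locallyIntegrableOn_shell hn hu.locallyIntegrable_inner_self).continuousOn_mul
    (ContinuousOn.inv₀ (by fun_prop) fun r hr =>
      (mul_pos (sphereMeasure_real_pos hn) (pow_pos hr _)).ne') isOpen_Ioi.isLocallyClosed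

/-- Against the radial function φ(‖x‖), a rotational derivative of ξ integrates to zero shell by
shell; as ξ is arbitrary, the rotational components of η vanish almost everywhere. -/
theorem ae_skew_eq_zero (hn : 2 ≤ n) (hu : HasWeakDifferential (fun x => φ ‖x‖) η)
    (a b : EuclideanSpace ℝ (Fin n)) :
    ∀ᵐ x, ⟪a, x⟫_ℝ * ⟪η x, b⟫_ℝ - ⟪b, x⟫_ℝ * ⟪η x, a⟫_ℝ = 0 := by
  have hl : ∀ a b : EuclideanSpace ℝ (Fin n), LocallyIntegrable fun x => ⟪a, x⟫_ℝ * ⟪η x, b⟫_ℝ :=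
    fun a b => by
    rw [← locallyIntegrableOn_univ]
    exact ((hu.locallyIntegrable_inner _).locallyIntegrableOn univ).continuousOn_mul
      (Continuous.continuousOn (by fun_prop)) isOpen_univ.isLocallyClosed
  refine ae_eq_zero_of_integral_contDiff_smul_eq_zero ((hl a b).sub (hl b a)) fun ξ hξ hξc => ?_
  have hξ' : ∀ v, Continuous fun x => fderiv ℝ ξ x v := fun v =>
    (hξ.continuous_fderiv (by simp)).clm_apply continuous_const
  have h1 := hu.integral_skew hξ hξc a b
  have hi := hu.integrable_mul
    (g := fun x => ⟪a, x⟫_ℝ * fderiv ℝ ξ x b - ⟪b, x⟫_ℝ * fderiv ℝ ξ x a)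
    (((continuous_const.inner continuous_id).mul (hξ' b)).sub
      ((continuous_const.inner continuous_id).mul (hξ' a)))
    ((HasCompactSupport.mul_left (f := fun x => ⟪a, x⟫_ℝ) (hξc.fderiv_apply ℝ b)).sub
      (HasCompactSupport.mul_left (f := fun x => ⟪b, x⟫_ℝ) (hξc.fderiv_apply ℝ a)))
  rw [integral_comp_norm_mul hn hi, integral_eq_zero_of_ae, eq_comm, neg_eq_zero] at h1
  · simpa only [smul_eq_mul, mul_comm (ξ _)] using h1
  · filter_upwards [ae_shell_skew_eq_zero hn hξ hξc a b] with r hr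
    exact mul_eq_zero_of_right _ hr

theorem ae_eq_smul_radialDir (hn : 2 ≤ n) (hu : HasWeakDifferential (fun x => φ ‖x‖) η) :
    ∀ᵐ x, x ≠ 0 → η x = (‖x‖⁻¹ * ⟪η x, x⟫_ℝ) • radialDir x := by
  have h := ae_all_iff.2 fun i : Fin n => ae_all_iff.2 fun j : Fin n =>
    hu.ae_skew_eq_zero hn (EuclideanSpace.single i 1) (EuclideanSpace.single j 1)
  filter_upwards [h] with x hx hx0
  have hne : ‖x‖ ≠ 0 := norm_ne_zero_iff.2 hx0
  ext j
  have h1 : ∀ i, x i * η x j = x j * η x i := fun i => by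
    have := hx i j
    simp [EuclideanSpace.inner_single_left, EuclideanSpace.inner_single_right] at this
    linarith
  have h2 : ‖x‖ ^ 2 * η x j = ⟪η x, x⟫_ℝ * x j := by
    rw [← real_inner_self_eq_norm_sq, PiLp.inner_apply, PiLp.inner_apply, Finset.sum_mul,
      Finset.sum_mul]
    refine Finset.sum_congr rfl fun i _ => ?_
    have := h1 i
    simp
    linear_combination x i * this
  simp [radialDir]
  field_simp
  linarith

theorem integral_mul_deriv (hn : 2 ≤ n) (hu : HasWeakDifferential (fun x => φ ‖x‖) η) {k : ℝ → ℝ}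
    (hk : IsTestFunction k) :
    ∫ r in Ioi (0 : ℝ), φ r * deriv k r = - ∫ r in Ioi (0 : ℝ), radialSlope η r * k r := by
  have : Nontrivial (EuclideanSpace ℝ (Fin n)) := by
    have : Nonempty (Fin n) := ⟨⟨0, by omega⟩⟩
    infer_instance
  obtain ⟨a, b, ha, h0, hb⟩ := hk.eq_zero_of_lt
  have hσ := sphereMeasure_real_pos hn
  -- With k = r^n g one has k' = r^{n-1}(r g' + n g), which is the dilation of g(‖x‖) including its
  -- divergence term and the polar density.
  set g : ℝ → ℝ := fun r => k r * (r ^ n)⁻¹ with hgdef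
  have hg0 : ∀ r < a, g r = 0 := fun r hr => by simp [hgdef, h0 r hr]
  have hg : ContDiff ℝ ∞ g := by
    refine contDiff_iff_contDiffAt.2 fun r => ?_
    rcases lt_or_ge r a with hr | hr
    · exact (contDiffAt_const (c := (0 : ℝ))).congr_of_eventuallyEq
        ((gt_mem_nhds hr).mono fun x hx => hg0 x hx)
    · exact hk.contDiff.contDiffAt.mul
        ((contDiffAt_id.pow n).inv (pow_ne_zero _ (ha.trans_le hr).ne'))
  have hkg : k = fun r => r ^ n * g r := by
    ext r
    rcases eq_or_ne r 0 with rfl | hr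
    · simp [h0 0 ha, show n ≠ 0 by omega]
    · simp only [hgdef]
      field_simp
  have hd : ∀ r, deriv k r = r ^ (n - 1) * (deriv g r * r + n * g r) := fun r => by
    have h1 : HasDerivAt (fun r => r ^ n * g r) _ r :=
      (hasDerivAt_pow n r).mul (hg.differentiable (by simp) r).hasDerivAt
    conv_lhs => rw [hkg]
    rw [h1.deriv]
    obtain ⟨m, rfl⟩ : ∃ m, n = m + 1 := ⟨n - 1, by omega⟩
    simp
    ring
  have hgc : HasCompactSupport fun x : EuclideanSpace ℝ (Fin n) => g ‖x‖ :=
    hasCompactSupport_comp_norm (b := b) fun r hr => by simp [hgdef, hb r hr]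
  have h1 := hu.integral_dilation (contDiff_comp_norm hg ha hg0) hgc
  have h2 : ∀ x : EuclideanSpace ℝ (Fin n), fderiv ℝ (fun x => g ‖x‖) x x = deriv g ‖x‖ * ‖x‖ :=
    fun x => by
    rw [(hasGradientAt_comp_norm hg ha hg0 x).hasFDerivAt.fderiv]
    rcases eq_or_ne x 0 with rfl | hx
    · simp
    · have : ‖x‖ ≠ 0 := norm_ne_zero_iff.2 hx
      simp [radialDir]
      left
      field_simp
  simp_rw [h2, mul_comm (⟪η _, _⟫_ℝ)] at h1
  have hi : Integrable fun x : EuclideanSpace ℝ (Fin n) => g ‖x‖ * ⟪η x, x⟫_ℝ :=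
    hu.locallyIntegrable_inner_self.integrable_smul_left_of_hasCompactSupport
      (contDiff_comp_norm hg ha hg0).continuous hgc
  rw [integral_comp_norm_mul hn hi,
    integral_norm (F := fun r => φ r * (deriv g r * r + n * g r))] at h1
  have h3 : ∀ r, radialSlope η r * k r
      = ((sphereMeasure n).real univ)⁻¹ * (g r * shell (fun x => ⟪η x, x⟫_ℝ) r) := fun r => by
    simp only [radialSlope, hgdef, mul_inv]
    ring
  have h4 : ∀ r, φ r * deriv k r = r ^ (n - 1) * (φ r * (deriv g r * r + n * g r)) := fun r => by
    rw [hd]; ring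
  simp_rw [h3, h4]
  rw [integral_const_mul]
  rw [← mul_neg, eq_comm, inv_mul_eq_iff_eq_mul₀ hσ.ne', eq_comm, h1]

/-- `radialSlope` is defined by a spherical mean, whereas here ξ is not radial. Applying the
one-dimensional identity on each ray to r^n ξ(rθ) shows that ⟪η x, x⟫ agrees with its mean when
tested. -/
theorem integral_radialSlope_mul (hn : 2 ≤ n) (hu : HasWeakDifferential (fun x => φ ‖x‖) η)
    {ξ : EuclideanSpace ℝ (Fin n) → ℝ} (hξ : ContDiff ℝ ∞ ξ) (hξc : HasCompactSupport ξ)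
    (hξ0 : tsupport ξ ⊆ {0}ᶜ) :
    ∫ x, ⟪η x, x⟫_ℝ * ξ x = ∫ x, radialSlope η ‖x‖ * ‖x‖ * ξ x := by
  obtain ⟨a, ha, hball⟩ := Metric.mem_nhds_iff.1
    ((isClosed_tsupport ξ).isOpen_compl.mem_nhds fun h => hξ0 h rfl)
  have ha0 : ∀ x, ‖x‖ < a → ξ x = 0 := fun x hx =>
    image_eq_zero_of_notMem_tsupport (hball (by simpa using hx))
  obtain ⟨R, -, hR⟩ := hξc.exists_pos_le_norm
  have hi : Integrable fun x => radialSlope η ‖x‖ * ‖x‖ * ξ x := by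
    have h1 : IntegrableOn (fun x => radialSlope η ‖x‖) (tsupport ξ) :=
      (locallyIntegrableOn_comp_norm hn (hu.locallyIntegrableOn_radialSlope hn)
        ).integrableOn_compact_subset hξ0 hξc.isCompact
    have h2 := h1.mul_continuousOn (g' := fun x => ‖x‖ * ξ x)
      (continuous_norm.mul hξ.continuous).continuousOn hξc.isCompact
    rw [← integrableOn_univ]
    refine (h2.of_forall_sdiff_eq_zero MeasurableSet.univ fun x hx => ?_).congr
      (Eventually.of_forall fun x => by ring)
    simp [image_eq_zero_of_notMem_tsupport hx.2]
  have hi' : Integrable fun x => φ ‖x‖ * (fderiv ℝ ξ x x + n * ξ x) := by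
    refine hu.integrable_mul ?_ ?_
    · exact ((hξ.continuous_fderiv (by simp)).clm_apply continuous_id).add
        (continuous_const.mul hξ.continuous)
    · refine HasCompactSupport.add ?_ (HasCompactSupport.mul_left hξc)
      refine (hξc.fderiv ℝ).mono fun x hx => ?_
      contrapose! hx
      simp only [Function.mem_support, not_not] at hx ⊢
      simp [hx]
  have h1 := hu.integral_dilation hξ hξc
  rw [← neg_inj, ← h1, integral_polar_sphere hn hi, integral_polar_sphere hn hi', ← integral_neg]
  refine integral_congr_ae (Eventually.of_forall fun θ => ?_)
  set e : EuclideanSpace ℝ (Fin n) := (θ : EuclideanSpace ℝ (Fin n)) with he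
  -- The cutoff only removes negative radii, where r • e meets the opposite ray: ξ already vanishes
  -- for ‖x‖ < a, and the cutoff is 1 for r ≥ a.
  set k : ℝ → ℝ := fun r => Real.smoothTransition (r / a) * (r ^ n * ξ (r • e)) with hkdef
  have hξe : ContDiff ℝ ∞ fun r : ℝ => r ^ n * ξ (r • e) :=
    (contDiff_id.pow n).mul (hξ.comp (contDiff_id.smul contDiff_const))
  have hke : ∀ r : ℝ, 0 < r → k r = r ^ n * ξ (r • e) := fun r hr => by
    rcases lt_or_ge r a with hra | hra
    · simp [hkdef, ha0 (r • e) (by rwa [norm_smul_sphere hr.le])]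
    · simp [hkdef, Real.smoothTransition.one_of_one_le ((one_le_div ha).2 hra)]
  have hk : IsTestFunction k := by
    refine ⟨(Real.smoothTransition.contDiff.comp (contDiff_id.div_const a)).mul hξe, a, R, ha,
      fun r hr => ?_⟩
    have hr0 : 0 < r := by
      by_contra h
      exact hr (by simp [hkdef, Real.smoothTransition.zero_of_nonpos
        (div_nonpos_of_nonpos_of_nonneg (not_lt.1 h) ha.le)])
    have hξr : ξ (r • e) ≠ 0 := fun h => hr (by simp [hkdef, h])
    constructor <;> by_contra h
    · exact hξr (ha0 _ (by rw [norm_smul_sphere hr0.le]; exact not_le.1 h))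
    · exact hξr (hR _ (by rw [norm_smul_sphere hr0.le]; exact (not_le.1 h).le))
  have hd : ∀ r : ℝ, 0 < r →
      deriv k r = r ^ (n - 1) * (fderiv ℝ ξ (r • e) (r • e) + n * ξ (r • e)) := fun r hr => by
    have h2 : k =ᶠ[𝓝 r] fun r => r ^ n * ξ (r • e) :=
      (lt_mem_nhds hr).mono fun x hx => hke x hx
    have h3 : HasDerivAt (fun r : ℝ => r • e) e r := by
      simpa using (hasDerivAt_id r).smul_const e
    have h4 : HasDerivAt (fun r : ℝ => r ^ n * ξ (r • e)) _ r := (hasDerivAt_pow n r).mul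
      ((hξ.differentiable (by simp) _).hasFDerivAt.comp_hasDerivAt r h3)
    rw [h2.deriv_eq, h4.deriv]
    obtain ⟨m, rfl⟩ : ∃ m, n = m + 1 := ⟨n - 1, by omega⟩
    simp
    ring
  have key := hu.integral_mul_deriv hn hk
  simp only [smul_eq_mul]
  rw [show (∫ r in Ioi (0 : ℝ), r ^ (n - 1) * (φ ‖r • e‖ * (fderiv ℝ ξ (r • e) (r • e)
      + n * ξ (r • e)))) = ∫ r in Ioi (0 : ℝ), φ r * deriv k r from
    setIntegral_congr_fun measurableSet_Ioi fun r hr => ?_, key]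
  · congr 1
    refine setIntegral_congr_fun measurableSet_Ioi fun r hr => ?_
    have hr : 0 < r := hr
    simp only [norm_smul_sphere hr.le, e, hke r hr]
    obtain ⟨m, rfl⟩ : ∃ m, n = m + 1 := ⟨n - 1, by omega⟩
    simp
    ring
  · have hr : 0 < r := hr
    simp only [norm_smul_sphere hr.le, e, hd r hr]
    ring

theorem ae_eq_radialSlope (hn : 2 ≤ n) (hu : HasWeakDifferential (fun x => φ ‖x‖) η) :
    ∀ᵐ x : EuclideanSpace ℝ (Fin n), x ≠ 0 ∧ η x = radialSlope η ‖x‖ • radialDir x := by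
  have : Nontrivial (EuclideanSpace ℝ (Fin n)) := by
    have : Nonempty (Fin n) := ⟨⟨0, by omega⟩⟩
    infer_instance
  have hl1 : LocallyIntegrableOn (fun x => ⟪η x, x⟫_ℝ) {0}ᶜ :=
    hu.locallyIntegrable_inner_self.locallyIntegrableOn _
  have hl2 : LocallyIntegrableOn (fun x : EuclideanSpace ℝ (Fin n) => radialSlope η ‖x‖ * ‖x‖) {0}ᶜ :=
    (locallyIntegrableOn_comp_norm hn (hu.locallyIntegrableOn_radialSlope hn)).mul_continuousOn
      continuous_norm.continuousOn isOpen_compl_singleton.isLocallyClosed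
  have hi : ∀ {f : EuclideanSpace ℝ (Fin n) → ℝ}, LocallyIntegrableOn f {0}ᶜ →
      ∀ ξ : EuclideanSpace ℝ (Fin n) → ℝ, Continuous ξ → HasCompactSupport ξ →
        tsupport ξ ⊆ {0}ᶜ → Integrable fun x => f x * ξ x := fun hf ξ hξ hξc hξ0 => by
    have h2 := (hf.integrableOn_compact_subset hξ0 hξc.isCompact).mul_continuousOn
      hξ.continuousOn hξc.isCompact
    rw [← integrableOn_univ]
    refine h2.of_forall_sdiff_eq_zero MeasurableSet.univ fun x hx => ?_
    simp [image_eq_zero_of_notMem_tsupport hx.2]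
  have h := isOpen_compl_singleton.ae_eq_zero_of_integral_contDiff_smul_eq_zero (hl1.sub hl2)
    (fun ξ hξ hξc hξ0 => by
      simp only [smul_eq_mul, Pi.sub_apply, mul_comm (ξ _), sub_mul]
      rw [integral_sub (hi hl1 ξ hξ.continuous hξc hξ0) (hi hl2 ξ hξ.continuous hξc hξ0),
        hu.integral_radialSlope_mul hn hξ hξc hξ0, sub_self])
  have h0 : ∀ᵐ x : EuclideanSpace ℝ (Fin n), x ≠ 0 := by simp [ae_iff]
  filter_upwards [h, h0, hu.ae_eq_smul_radialDir hn] with x h1 h2 h3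
  refine ⟨h2, ?_⟩
  have h1 := h1 h2
  have : ‖x‖ ≠ 0 := norm_ne_zero_iff.2 h2
  rw [Pi.sub_apply, sub_eq_zero] at h1
  conv_lhs => rw [h3 h2, h1]
  congr 1
  field_simp

end HasWeakDifferential

end Radial

/-! ### Weak radial solutions are profiles -/

theorem hasDerivAt_primitive {k : ℝ → ℝ} (hk : Continuous k) (c r : ℝ) :
    HasDerivAt (fun r => ∫ s in c..r, k s) (k r) r :=
  intervalIntegral.integral_hasDerivAt_right (hk.intervalIntegrable _ _)
    (hk.stronglyMeasurableAtFilter _ _) hk.continuousAt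

theorem contDiff_primitive {k : ℝ → ℝ} (hk : ContDiff ℝ ∞ k) (c : ℝ) :
    ContDiff ℝ ∞ fun r => ∫ s in c..r, k s := by
  rw [contDiff_infty_iff_deriv]
  refine ⟨fun r => (hasDerivAt_primitive hk.continuous c r).differentiableAt, ?_⟩
  rwa [show deriv (fun r => ∫ s in c..r, k s) = k from
    funext fun r => (hasDerivAt_primitive hk.continuous c r).deriv]

theorem integral_Ioi_eq_intervalIntegral {f : ℝ → ℝ} {b : ℝ} (hb : 0 ≤ b)
    (h : ∀ r, b < r → f r = 0) : ∫ r in Ioi (0 : ℝ), f r = ∫ r in (0 : ℝ)..b, f r := by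
  rw [intervalIntegral.integral_of_le hb]
  exact (setIntegral_eq_of_subset_of_forall_sdiff_eq_zero measurableSet_Ioi Ioc_subset_Ioi_self
    fun r hr => h r (by by_contra hb'; exact hr.2 ⟨hr.1, not_lt.1 hb'⟩))

/-- Here f is only integrable, since at this stage φ is only a measurable function; hence the
integration by parts for absolutely continuous functions. The boundary terms vanish since g(b) = 0
and the primitive starts at 0. -/
theorem integral_mul_eq_neg_integral_primitive_mul_deriv {f g : ℝ → ℝ} {b : ℝ} (hb : 0 ≤ b)
    (hf : IntervalIntegrable f volume 0 b) (hg : ContDiff ℝ ∞ g) (hgb : ∀ r, b ≤ r → g r = 0) :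
    ∫ r in Ioi (0 : ℝ), f r * g r
      = - ∫ r in Ioi (0 : ℝ), (∫ s in (0 : ℝ)..r, f s) * deriv g r := by
  have hgb' : ∀ r, b < r → deriv g r = 0 := fun r hr => by
    have : g =ᶠ[𝓝 r] fun _ => 0 := (lt_mem_nhds hr).mono fun x hx => hgb x hx.le
    simpa using this.deriv_eq
  rw [integral_Ioi_eq_intervalIntegral hb fun r hr => by simp [hgb r hr.le],
    integral_Ioi_eq_intervalIntegral hb fun r hr => by simp [hgb' r hr]]
  have hF := hf.absolutelyContinuousOnInterval_intervalIntegral (c := 0) left_mem_uIcc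
  have hG : AbsolutelyContinuousOnInterval g 0 b := by
    have h1 := ((hg.continuous_deriv (by simp)).intervalIntegrable (μ := volume) 0 b
      ).absolutelyContinuousOnInterval_intervalIntegral (c := 0) left_mem_uIcc
    have h2 : g = fun x => (fun _ => g 0) x + ∫ v in (0 : ℝ)..x, deriv g v := by
      ext x
      rw [intervalIntegral.integral_deriv_eq_sub
        (fun y _ => hg.differentiable (by simp) y)
        ((hg.continuous_deriv (by simp)).intervalIntegrable _ _)]
      ring
    rw [h2]
    exact AbsolutelyContinuousOnInterval.add (LipschitzOnWith.absolutelyContinuousOnInterval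
      (K := 0) (LipschitzWith.const (g 0)).lipschitzOnWith) h1
  rw [hF.integral_mul_deriv_eq_deriv_mul hG, hgb b le_rfl, intervalIntegral.integral_same]
  simp only [mul_zero, zero_mul, sub_zero, zero_sub, neg_neg]
  refine intervalIntegral.integral_congr_ae ?_
  filter_upwards [hf.ae_hasDerivAt_integral] with x hx hx'
  rw [(hx (uIoc_subset_uIcc hx') 0 left_mem_uIcc).deriv]

theorem exists_isTestFunction_integral_eq_one :
    ∃ k, IsTestFunction k ∧ ∫ r in Ioi (0 : ℝ), k r = 1 := by
  let B : ContDiffBump (2 : ℝ) := ⟨1 / 2, 1, by norm_num, by norm_num⟩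
  have hsupp : ∀ r, B.normed volume r ≠ 0 → r ∈ Icc (1 : ℝ) 3 := fun r hr => by
    have h1 : r ∈ Function.support (B.normed volume) := hr
    rw [B.support_normed_eq, Metric.mem_ball, Real.dist_eq, abs_lt] at h1
    have : B.rOut = 1 := rfl
    constructor <;> linarith [h1.1, h1.2]
  refine ⟨B.normed volume, ⟨B.contDiff_normed, 1, 3, one_pos, hsupp⟩, ?_⟩
  rw [setIntegral_eq_integral_of_forall_compl_eq_zero, B.integral_normed]
  intro r hr
  by_contra h
  exact hr (one_pos.trans_le (hsupp r h).1)

theorem IsTestFunction.integrable {k : ℝ → ℝ} (hk : IsTestFunction k) :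
    IntegrableOn k (Ioi 0) := by
  obtain ⟨a, b, -, -, hb⟩ := hk.eq_zero_of_lt
  exact integrableOn_Ioi_of_eq_zero hk.contDiff.continuous.continuousOn hb

theorem IsTestFunction.primitive {k : ℝ → ℝ} (hk : IsTestFunction k)
    (h0 : ∫ r in Ioi (0 : ℝ), k r = 0) : IsTestFunction fun r => ∫ s in (0 : ℝ)..r, k s := by
  obtain ⟨a, b, ha, hka, hkb⟩ := hk.eq_zero_of_lt
  refine ⟨contDiff_primitive hk.contDiff 0, a, b, ha, fun r hr => ?_⟩
  constructor <;> by_contra h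
  · refine hr (intervalIntegral.integral_zero_ae (Eventually.of_forall fun s hs => hka s ?_))
    exact hs.2.trans_lt (max_lt ha (not_le.1 h))
  · rcases le_or_gt 0 r with h1 | h1
    · exact hr ((integral_Ioi_eq_intervalIntegral h1
        fun s hs => hkb s ((not_le.1 h).trans hs)).symm.trans h0)
    · refine hr (intervalIntegral.integral_zero_ae (Eventually.of_forall fun s hs => hka s ?_))
      exact hs.2.trans_lt (max_lt ha (h1.trans ha))

theorem IsTestFunction.sub_const_mul {k m : ℝ → ℝ} (hk : IsTestFunction k)
    (hm : IsTestFunction m) (c : ℝ) : IsTestFunction fun r => k r - c * m r := by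
  obtain ⟨a, b, ha, hab⟩ := hk.exists_support
  obtain ⟨a', b', ha', hab'⟩ := hm.exists_support
  refine ⟨hk.contDiff.sub (contDiff_const.mul hm.contDiff), min a a', max b b', lt_min ha ha',
    fun r hr => ?_⟩
  by_cases h : k r = 0
  · have h' : m r ≠ 0 := fun h' => hr (by simp [h, h'])
    exact ⟨(min_le_right _ _).trans (hab' r h').1, (hab' r h').2.trans (le_max_right _ _)⟩
  · exact ⟨(min_le_left _ _).trans (hab r h).1, (hab r h).2.trans (le_max_left _ _)⟩

/-- The du Bois-Reymond lemma: f - V has zero weak derivative, hence is constant almost everywhere.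
-/
theorem exists_ae_eq_add {f v V : ℝ → ℝ} (hf : LocallyIntegrableOn f (Ioi 0))
    (hV : ∀ r, 0 < r → HasDerivAt V (v r) r) (hv : ContinuousOn v (Ioi 0))
    (h : ∀ k, IsTestFunction k →
      ∫ r in Ioi (0 : ℝ), f r * deriv k r = - ∫ r in Ioi (0 : ℝ), v r * k r) :
    ∃ c, ∀ᵐ r ∂(volume.restrict (Ioi 0)), f r = c + V r := by
  have hVc : ContinuousOn V (Ioi 0) := fun r hr => (hV r hr).continuousAt.continuousWithinAt
  have hVl : LocallyIntegrableOn V (Ioi 0) := hVc.locallyIntegrableOn measurableSet_Ioi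
  have hvl : LocallyIntegrableOn v (Ioi 0) := hv.locallyIntegrableOn measurableSet_Ioi
  have hd : ∀ k, IsTestFunction k → IsTestFunction (deriv k) := fun k hk => by
    obtain ⟨a, b, ha, h0, hb⟩ := hk.eq_zero_of_lt
    refine ⟨(contDiff_infty_iff_deriv.1 hk.contDiff).2, a, b, ha, fun r hr => ?_⟩
    constructor <;> by_contra hc
    · have : k =ᶠ[𝓝 r] fun _ => 0 := (gt_mem_nhds (not_le.1 hc)).mono fun x hx => h0 x hx
      exact hr (by simpa using this.deriv_eq)
    · have : k =ᶠ[𝓝 r] fun _ => 0 := (lt_mem_nhds (not_le.1 hc)).mono fun x hx => hb x hx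
      exact hr (by simpa using this.deriv_eq)
  have hparts : ∀ k, IsTestFunction k →
      ∫ r in Ioi (0 : ℝ), V r * deriv k r = - ∫ r in Ioi (0 : ℝ), v r * k r := fun k hk => by
    obtain ⟨a, b, ha, h0, hb⟩ := hk.eq_zero_of_lt
    rw [integral_Ioi_mul_deriv_eq_deriv_mul (a := 0) (a' := 0) (b' := 0) (v := k) hV
      (fun x _ => (hk.contDiff.differentiable (by simp) x).hasDerivAt)
      ((hd k hk).integrable_mul hVl) (hk.integrable_mul hvl)]
    · simp
    · refine tendsto_const_nhds.congr' ?_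
      filter_upwards [nhdsWithin_le_nhds (gt_mem_nhds ha)] with r hr
      simp [h0 r hr]
    · refine tendsto_const_nhds.congr' ?_
      filter_upwards [eventually_gt_atTop b] with r hr
      simp [hb r hr]
  have hw : ∀ k, IsTestFunction k → ∫ r in Ioi (0 : ℝ), (f r - V r) * deriv k r = 0 := by
    intro k hk
    simp_rw [sub_mul]
    rw [integral_sub ((hd k hk).integrable_mul hf) ((hd k hk).integrable_mul hVl), h k hk,
      hparts k hk, sub_self]
  have hwl : LocallyIntegrableOn (fun r => f r - V r) (Ioi 0) := hf.sub hVl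
  obtain ⟨k₀, hk₀, hk₀1⟩ := exists_isTestFunction_integral_eq_one
  set c := ∫ r in Ioi (0 : ℝ), (f r - V r) * k₀ r with hc
  have hz := ae_eq_zero_of_forall_isTestFunction
    (f := fun r => (f r - V r) - c) (hwl.sub (locallyIntegrableOn_const c)) fun k hk => ?_
  · refine ⟨c, hz.mono fun r hr => ?_⟩
    linarith
  · set m := ∫ r in Ioi (0 : ℝ), k r with hm
    -- Subtracting m k₀ makes the integral vanish, so the primitive is again a test function and k -
    -- m k₀ is an admissible derivative.
    have hK := (hk.sub_const_mul hk₀ m)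
    have hK0 : ∫ r in Ioi (0 : ℝ), (k r - m * k₀ r) = 0 := by
      rw [integral_sub hk.integrable (hk₀.integrable.const_mul m), integral_const_mul, hk₀1]
      simp [hm]
    have h1 := hw _ (hK.primitive hK0)
    have h2 : deriv (fun r => ∫ s in (0 : ℝ)..r, (k s - m * k₀ s)) = fun r => k r - m * k₀ r :=
      funext fun r => (hasDerivAt_primitive hK.contDiff.continuous 0 r).deriv
    rw [h2] at h1
    have e1 : ∀ r, (f r - V r) * (k r - m * k₀ r)
        = (f r - V r) * k r - m * ((f r - V r) * k₀ r) := fun r => by ring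
    have e2 : ∀ r, (f r - V r - c) * k r = (f r - V r) * k r - c * k r := fun r => by ring
    simp_rw [e1] at h1
    simp_rw [e2]
    rw [integral_sub (hk.integrable_mul hwl) ((hk₀.integrable_mul hwl).const_mul m),
      integral_const_mul, ← hc] at h1
    rw [integral_sub (hk.integrable_mul hwl) (hk.integrable.const_mul c), integral_const_mul, ← hm]
    linarith

/-! ### From the weak equation to the integrated radial equation -/

section WeakSolution

variable {n : ℕ} {p q : ℝ} {ψ φ : ℝ → ℝ}
  {η : EuclideanSpace ℝ (Fin n) → EuclideanSpace ℝ (Fin n)}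

theorem integrableOn_Ioc_of_integrable_vol (h : IsCartanHadamardModel ψ) (hn : 2 ≤ n)
    {F : ℝ → ℝ} {R : ℝ}
    (hF : IntegrableOn (fun x => F ‖x‖) (Metric.closedBall (0 : EuclideanSpace ℝ (Fin n)) R)
      (vol n ψ)) : IntegrableOn (fun r => ψ r ^ (n - 1) * F r) (Ioc 0 R) := by
  have h1 := hF.integrable_indicator measurableSet_closedBall
  rw [h.integrable_vol_iff (by omega)] at h1
  have h2 : IntegrableOn _ (Ioc 0 R) := (integrableOn_shell hn h1.locallyIntegrable R).const_mul
    ((sphereMeasure n).real univ)⁻¹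
  refine h2.congr_fun (fun r hr => ?_) measurableSet_Ioc
  have hr0 : 0 < r := hr.1
  have hσ := sphereMeasure_real_pos hn
  have e : shell (fun x : EuclideanSpace ℝ (Fin n) => warp ψ ‖x‖ ^ (n - 1) *
      (Metric.closedBall 0 R).indicator (fun x => F ‖x‖) x) r
      = (sphereMeasure n).real univ * (r ^ (n - 1) * (warp ψ r ^ (n - 1) * F r)) := by
    rw [← shell_comp_norm (φ := fun r => warp ψ r ^ (n - 1) * F r) hr0, shell, shell]
    refine integral_congr_ae (Eventually.of_forall fun θ => ?_)
    simp only
    rw [indicator_of_mem]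
    simpa [norm_smul_sphere hr0.le] using hr.2
  simp only
  rw [e, inv_mul_cancel_left₀ hσ.ne', ← mul_assoc, IsCartanHadamardModel.mul_warp_pow n hr0]

theorem exists_ae_le_of_memLp_top (h : IsCartanHadamardModel ψ) (hn : 2 ≤ n) {R : ℝ}
    (hm : MemLp (fun x => φ ‖x‖) ⊤
      ((vol n ψ).restrict (Metric.closedBall (0 : EuclideanSpace ℝ (Fin n)) R))) :
    ∃ C, ∀ᵐ r ∂(volume.restrict (Ioi (0 : ℝ))), r ≤ R → |φ r| ≤ C := by
  have h1 := hm.2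
  rw [eLpNorm_exponent_top] at h1
  refine ⟨(eLpNormEssSup (fun x => φ ‖x‖)
      ((vol n ψ).restrict (Metric.closedBall (0 : EuclideanSpace ℝ (Fin n)) R))).toReal, ?_⟩
  have h2 := ae_le_eLpNormEssSup (f := fun x : EuclideanSpace ℝ (Fin n) => φ ‖x‖)
    (μ := (vol n ψ).restrict (Metric.closedBall 0 R))
  rw [ae_restrict_iff' measurableSet_closedBall] at h2
  have h3 : ∀ᵐ x : EuclideanSpace ℝ (Fin n), _ :=
    (h.vol_absolutelyContinuous (n := n) (by omega)).ae_le h2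
  refine ae_of_ae_norm (P := fun r => r ≤ R → |φ r| ≤ _) hn (h3.mono fun x hx hxR => ?_)
  have h4 := hx (by simpa using hxR)
  have h5 := (ENNReal.toReal_le_toReal (by simp) h1.ne).2 h4
  simpa using h5

/-- Test functions that are constant, but not necessarily zero, near the pole are admitted. They fix
the integration constant of the flux: nothing is emitted from the pole itself. -/
theorem integral_flux_eq (h : IsCartanHadamardModel ψ) (hn : 2 ≤ n)
    (hu : HasWeakDifferential (fun x => φ ‖x‖) η) {g : ℝ → ℝ} {a b c : ℝ} (hg : ContDiff ℝ ∞ g)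
    (ha : 0 < a) (hga : ∀ r < a, g r = c) (hgb : ∀ r, b < r → g r = 0)
    (heq : ∀ ξ : EuclideanSpace ℝ (Fin n) → ℝ, ContDiff ℝ ∞ ξ → HasCompactSupport ξ →
      ∫ x, metricNorm ψ x (sharp ψ x (η x)) ^ (p - 2)
          * metric ψ x (sharp ψ x (η x)) (sharp ψ x (gradient ξ x)) ∂(vol n ψ)
        = ∫ x, φ ‖x‖ ^ q * ξ x ∂(vol n ψ)) :
    ∫ r in Ioi (0 : ℝ),
        ψ r ^ (n - 1) * (|radialSlope η r| ^ (p - 2) * radialSlope η r) * deriv g r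
      = ∫ r in Ioi (0 : ℝ), ψ r ^ (n - 1) * φ r ^ q * g r := by
  have : Nontrivial (EuclideanSpace ℝ (Fin n)) := by
    have : Nonempty (Fin n) := ⟨⟨0, by omega⟩⟩
    infer_instance
  have hn1 : 1 ≤ n := by omega
  have h1 := heq _ (contDiff_comp_norm hg ha hga) (hasCompactSupport_comp_norm hgb)
  have hac : vol n ψ ≪ volume := withDensity_absolutelyContinuous _ _
  have h2 : ∀ᵐ x ∂vol n ψ, metricNorm ψ x (sharp ψ x (η x)) ^ (p - 2)
      * metric ψ x (sharp ψ x (η x)) (sharp ψ x (gradient (fun x => g ‖x‖) x))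
      = |radialSlope η ‖x‖| ^ (p - 2) * radialSlope η ‖x‖ * deriv g ‖x‖ := by
    filter_upwards [hac.ae_le (hu.ae_eq_radialSlope hn)] with x hx
    rw [hx.2, metricNorm_sharp_radial hx.1, metric_sharp_radial (h.warp_pos (norm_nonneg x)).ne',
      (hasGradientAt_comp_norm hg ha hga x).gradient, inner_smul_right, inner_radialDir_self hx.1]
    ring
  rw [integral_congr_ae h2,
    h.integral_vol_norm hn1 (fun r => |radialSlope η r| ^ (p - 2) * radialSlope η r * deriv g r),
    h.integral_vol_norm hn1 (fun r => φ r ^ q * g r)] at h1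
  have h3 := mul_left_cancel₀ (sphereMeasure_real_pos hn).ne' h1
  simpa only [mul_assoc] using h3

/-- Radial test functions identify ψ^{n-1}|s|^{p-2}s with minus the flux, where s is the radial
slope. Solving for s makes it continuous, and φ then agrees almost everywhere with a primitive of
it, which is the profile. -/
theorem IsRadialSolution.exists_isProfile (hs : IsRadialSolution n p q ψ φ)
    (h : IsCartanHadamardModel ψ) (hn : 2 ≤ n) (hp : 1 < p) (hq : 0 ≤ q) :
    ∃ u, IsProfile n p q ψ u ∧ ∀ᵐ r ∂(volume.restrict (Ioi (0 : ℝ))), φ r = u r := by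
  have : Nontrivial (EuclideanSpace ℝ (Fin n)) := by
    have : Nonempty (Fin n) := ⟨⟨0, by omega⟩⟩
    infer_instance
  obtain ⟨hpos, η, hu, hm, heq⟩ := hs
  have hn1 : 1 ≤ n := by omega
  have hp1 : 0 < p - 1 := by linarith
  have hφpos : ∀ r, 0 ≤ r → 0 < φ r := fun r hr => by
    obtain ⟨x, hx⟩ := exists_norm_eq (EuclideanSpace ℝ (Fin n)) hr
    exact hx ▸ hpos x
  have hφl := locallyIntegrableOn_of_comp_norm hn hu.locallyIntegrable
  have hφm : AEStronglyMeasurable φ (volume.restrict (Ioi 0)) := hφl.aestronglyMeasurable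
  set s : ℝ → ℝ := radialSlope η with hs_def
  have hsl : LocallyIntegrableOn s (Ioi 0) := hu.locallyIntegrableOn_radialSlope hn
  have hsm : AEStronglyMeasurable s (volume.restrict (Ioi 0)) := hsl.aestronglyMeasurable
  have hψm : ∀ R, AEStronglyMeasurable (fun r => ψ r ^ (n - 1)) (volume.restrict (Ioc 0 R)) :=
    fun R => ((h.continuousOn_pow _).mono fun r hr => le_of_lt hr.1).aestronglyMeasurable
      measurableSet_Ioc
  have hφi : ∀ R, 0 ≤ R → IntervalIntegrable (fun r => ψ r ^ (n - 1) * φ r ^ q) volume 0 R := by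
    intro R hR
    rw [intervalIntegrable_iff_integrableOn_Ioc_of_le hR]
    obtain ⟨C, hC⟩ := exists_ae_le_of_memLp_top h hn (hm _ (isCompact_closedBall 0 R)).2.2
    have hψi : IntegrableOn (fun r => ψ r ^ (n - 1)) (Ioc 0 R) :=
      ((h.continuousOn_pow _).mono Icc_subset_Ici_self).integrableOn_Icc.mono_set
        Ioc_subset_Icc_self
    refine hψi.mul_bdd (c := C ^ q) ?_ ?_
    · exact ((hφm.mono_measure (Measure.restrict_mono Ioc_subset_Ioi_self le_rfl)
        ).aemeasurable.pow_const q).aestronglyMeasurable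
    · filter_upwards [ae_restrict_of_ae_restrict_of_subset Ioc_subset_Ioi_self hC,
        ae_restrict_mem measurableSet_Ioc] with r hr hrR
      have h0 := hφpos r hrR.1.le
      rw [Real.norm_of_nonneg (Real.rpow_nonneg h0.le _)]
      exact Real.rpow_le_rpow h0.le ((le_abs_self _).trans (hr hrR.2)) hq
  set W : ℝ → ℝ := fun r => ψ r ^ (n - 1) * (|s r| ^ (p - 2) * s r) with hW
  have habs : ∀ r, ‖|s r| ^ (p - 2) * s r‖ = |s r| ^ (p - 1) := fun r => by
    rw [norm_mul, Real.norm_eq_abs, Real.norm_eq_abs,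
      abs_of_nonneg (Real.rpow_nonneg (abs_nonneg _) _)]
    rcases eq_or_ne (s r) 0 with h0 | h0
    · simp [h0, hp1.ne']
    · rw [← Real.rpow_add_one (abs_pos.2 h0).ne']
      ring_nf
  -- The bound |s|^{p-1} ≤ 1 + |s|^p reduces this to the local p-integrability of the differential.
  have hWl : LocallyIntegrableOn W (Ioi 0) := by
    refine locallyIntegrableOn_of_integrableOn_Ioc fun R => ?_
    have hp0 : ENNReal.ofReal p ≠ 0 := by simp; linarith
    have h1 := (hm _ (isCompact_closedBall 0 R)).2.1.integrable_norm_rpow hp0 (by simp)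
    rw [ENNReal.toReal_ofReal (by linarith)] at h1
    have h2 : IntegrableOn (fun x => |s ‖x‖| ^ p)
        (Metric.closedBall (0 : EuclideanSpace ℝ (Fin n)) R) (vol n ψ) := by
      refine h1.congr ?_
      have hac : (vol n ψ).restrict (Metric.closedBall 0 R) ≪ volume :=
        Measure.restrict_le_self.absolutelyContinuous.trans (withDensity_absolutelyContinuous _ _)
      filter_upwards [hac.ae_le (hu.ae_eq_radialSlope hn)] with x hx
      rw [hx.2, metricNorm_sharp_radial hx.1, Real.norm_eq_abs, abs_abs]
    have h3 := integrableOn_Ioc_of_integrable_vol (F := fun r => |s r| ^ p) h hn h2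
    have hψi : IntegrableOn (fun r => ψ r ^ (n - 1)) (Ioc 0 R) :=
      ((h.continuousOn_pow _).mono Icc_subset_Ici_self).integrableOn_Icc.mono_set
        Ioc_subset_Icc_self
    have hsm' := (hsm.mono_measure (Measure.restrict_mono
      (Ioc_subset_Ioi_self : Ioc 0 R ⊆ Ioi 0) le_rfl)).aemeasurable
    refine Integrable.mono (hψi.add h3) ((hψm R).mul
      ((hsm'.abs.pow_const _).mul hsm').aestronglyMeasurable) ?_
    filter_upwards [ae_restrict_mem measurableSet_Ioc] with r hr
    have hψ0 := pow_nonneg (h.nonneg hr.1.le) (n - 1)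
    have hsp : 0 ≤ |s r| ^ p := Real.rpow_nonneg (abs_nonneg _) _
    rw [norm_mul, habs, Real.norm_of_nonneg hψ0, Pi.add_apply,
      Real.norm_of_nonneg (add_nonneg hψ0 (mul_nonneg hψ0 hsp)), ← mul_one_add]
    refine mul_le_mul_of_nonneg_left ?_ hψ0
    rcases le_total |s r| 1 with h1 | h1
    · exact (Real.rpow_le_one (abs_nonneg _) h1 hp1.le).trans (by linarith)
    · exact (Real.rpow_le_rpow_of_exponent_le h1 (sub_le_self p zero_le_one)).trans
        (le_add_of_nonneg_left zero_le_one)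
  have hFc : ∀ r, 0 < r → ContinuousAt (flux n q ψ φ) r := fun r hr => by
    have := intervalIntegral.continuousOn_primitive_interval' (hφi (r + 1) (by linarith)) left_mem_uIcc
    rw [uIcc_of_le (by linarith)] at this
    exact (this r ⟨hr.le, by linarith⟩).continuousAt (Icc_mem_nhds hr (by linarith))
  have hFcon : ContinuousOn (flux n q ψ φ) (Ioi 0) := fun r hr => (hFc r hr).continuousWithinAt
  have hFpos : ∀ r, 0 < r → 0 < flux n q ψ φ r := fun r hr =>
    intervalIntegral.intervalIntegral_pos_of_pos_on (hφi r hr.le) (fun x hx => mul_pos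
      (pow_pos (h.pos hx.1) _) (Real.rpow_pos_of_pos (hφpos x hx.1.le) _)) hr
  have hFl : LocallyIntegrableOn (flux n q ψ φ) (Ioi 0) :=
    hFcon.locallyIntegrableOn measurableSet_Ioi
  have hWF : ∀ᵐ r ∂(volume.restrict (Ioi (0 : ℝ))), W r + flux n q ψ φ r = 0 := by
    refine ae_eq_zero_of_forall_isTestFunction (hWl.add hFl) fun k hk => ?_
    obtain ⟨a, b, ha, hka, hkb⟩ := hk.eq_zero_of_lt
    -- The primitive of k that vanishes at large radii. It is a generally nonzero constant near the
    -- pole, and this is why W + F vanishes exactly and not only up to a constant.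
    set g : ℝ → ℝ := fun r => ∫ s in (max b 0)..r, k s with hg
    have hgd : deriv g = k :=
      funext fun r => (hasDerivAt_primitive hk.contDiff.continuous _ r).deriv
    have hgb : ∀ r, max b 0 ≤ r → g r = 0 := fun r hr =>
      intervalIntegral.integral_zero_ae (Eventually.of_forall fun s hs => hkb s
        ((le_max_left b 0).trans_lt (by rw [uIoc_of_le hr] at hs; exact hs.1)))
    have hga : ∀ r < a, g r = g 0 := fun r hr => by
      have h1 : g 0 + ∫ s in (0 : ℝ)..r, k s = g r :=
        intervalIntegral.integral_add_adjacent_intervals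
          (hk.contDiff.continuous.intervalIntegrable _ _)
          (hk.contDiff.continuous.intervalIntegrable _ _)
      rw [← h1, intervalIntegral.integral_zero_ae, add_zero]
      exact Eventually.of_forall fun s hs => hka s (hs.2.trans_lt (max_lt ha hr))
    have h1 := integral_flux_eq h hn hu (contDiff_primitive hk.contDiff (max b 0)) ha hga
      (fun r hr => hgb r hr.le) heq
    have h2 := integral_mul_eq_neg_integral_primitive_mul_deriv (le_max_right b 0)
      (hφi (max b 0) (le_max_right b 0)) (contDiff_primitive hk.contDiff (max b 0)) hgb
    change _ = - ∫ r in Ioi (0 : ℝ), flux n q ψ φ r * deriv g r at h2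
    rw [h2] at h1
    change ∫ r in Ioi (0 : ℝ), W r * deriv g r = _ at h1
    rw [hgd] at h1
    simp_rw [add_mul]
    rw [integral_add (hk.integrable_mul hWl) (hk.integrable_mul hFl), h1]
    ring
  have hs_eq : ∀ᵐ r ∂(volume.restrict (Ioi (0 : ℝ))), s r = -speed n p q ψ φ r := by
    filter_upwards [hWF, ae_restrict_mem measurableSet_Ioi] with r hr hr0
    have hr0 : 0 < r := hr0
    have hψ0 := pow_pos (h.pos hr0) (n - 1)
    have hF := hFpos r hr0
    have h1 : |s r| ^ (p - 2) * s r = -(flux n q ψ φ r / ψ r ^ (n - 1)) := by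
      rw [← neg_div, eq_div_iff hψ0.ne']
      simp only [hW] at hr
      linarith
    have hdiv : 0 < flux n q ψ φ r / ψ r ^ (n - 1) := div_pos hF hψ0
    have h2 : |s r| ^ (p - 1) = flux n q ψ φ r / ψ r ^ (n - 1) := by
      rw [← habs, h1, norm_neg, Real.norm_of_nonneg hdiv.le]
    have h3 : |s r| = speed n p q ψ φ r := by
      rw [speed, ← h2, ← Real.rpow_mul (abs_nonneg _), mul_one_div_cancel hp1.ne', Real.rpow_one]
    have h4 : s r ≤ 0 := by
      by_contra hc
      have := mul_nonneg (Real.rpow_nonneg (abs_nonneg (s r)) (p - 2)) (not_le.1 hc).le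
      linarith
    rw [← h3, abs_of_nonpos h4, neg_neg]
  have hvc : ContinuousOn (fun r => -speed n p q ψ φ r) (Ioi 0) :=
    (ContinuousOn.rpow_const (hFcon.div ((h.continuousOn_pow _).mono Ioi_subset_Ici_self)
      fun r hr => (pow_pos (h.pos hr) _).ne') fun r hr => Or.inr (by positivity)).neg
  have hV : ∀ r, 0 < r → HasDerivAt (fun r => ∫ t in (1 : ℝ)..r, -speed n p q ψ φ t)
      (-speed n p q ψ φ r) r := fun r hr => by
    refine hasDerivAt_integral_of_continuousOn isOpen_Ioi hvc hr
      (ContinuousOn.intervalIntegrable (hvc.mono fun t ht => ?_))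
    exact (lt_min one_pos hr).trans_le ht.1
  obtain ⟨c, hc⟩ := exists_ae_eq_add hφl hV hvc fun k hk => by
    rw [hu.integral_mul_deriv hn hk]
    congr 1
    refine integral_congr_ae (hs_eq.mono fun r hr => ?_)
    simp only
    rw [← hs_def, hr]
  set u : ℝ → ℝ := fun r => c + ∫ t in (1 : ℝ)..r, -speed n p q ψ φ t with hu_def
  have hflux : ∀ r, 0 < r → flux n q ψ u r = flux n q ψ φ r := fun r hr => by
    refine intervalIntegral.integral_congr_ae ?_
    filter_upwards [(ae_restrict_iff' measurableSet_Ioi).1 hc] with t ht ht'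
    rw [uIoc_of_le hr.le] at ht'
    rw [ht ht'.1]
  have hspeed : ∀ r, 0 < r → speed n p q ψ u r = speed n p q ψ φ r := fun r hr => by
    rw [speed, speed, hflux r hr]
  have hud : ∀ r, 0 < r → HasDerivAt u (-speed n p q ψ u r) r := fun r hr => by
    rw [hspeed r hr]
    exact (hV r hr).const_add c
  have huc : ContinuousOn u (Ioi 0) := fun r hr => (hud r hr).continuousAt.continuousWithinAt
  have hunn : ∀ r, 0 < r → 0 ≤ u r := fun r hr => by
    by_contra hneg
    have h1 : ∀ᶠ t in 𝓝 r, u t < 0 ∧ 0 < t :=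
      ((hud r hr).continuousAt.eventually_lt continuousAt_const (not_le.1 hneg)).and
        (lt_mem_nhds hr)
    have h2 : ∀ᵐ t, ¬ (u t < 0 ∧ 0 < t) := by
      filter_upwards [(ae_restrict_iff' measurableSet_Ioi).1 hc] with t ht ⟨h3, h4⟩
      have := hφpos t h4.le
      rw [ht h4] at this
      exact lt_asymm this h3
    exact (Measure.measure_pos_of_mem_nhds volume h1).ne' (by simpa [ae_iff] using h2)
  refine ⟨u, ⟨fun r hr => ?_, fun r hr => ?_, hud⟩, hc⟩
  · have hlt : u (r + 1) < u r := by
      have hanti : StrictAntiOn u (Icc r (r + 1)) := by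
        refine strictAntiOn_of_deriv_neg (convex_Icc _ _)
          (huc.mono fun t ht => hr.trans_le ht.1) fun t ht => ?_
        rw [interior_Icc] at ht
        have ht0 : 0 < t := hr.trans ht.1
        rw [(hud t ht0).deriv, hspeed t ht0, neg_lt_zero]
        exact Real.rpow_pos_of_pos (div_pos (hFpos t ht0) (pow_pos (h.pos ht0) _)) _
      exact hanti (left_mem_Icc.2 (by linarith)) (right_mem_Icc.2 (by linarith)) (by linarith)
    exact (hunn (r + 1) (by linarith)).trans_lt hlt
  · refine (hφi r hr.le).congr_ae ?_
    rw [uIoc_of_le hr.le]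
    filter_upwards [ae_restrict_of_ae_restrict_of_subset Ioc_subset_Ioi_self hc] with t ht
    rw [ht]

end WeakSolution

/-! ### Completeness and failure of the asymptotic formula -/

theorem LiminfCondition.pStochasticallyComplete {n : ℕ} {p : ℝ} {ψ : ℝ → ℝ}
    (hL : LiminfCondition n p ψ) (h : IsCartanHadamardModel ψ) (hp : 1 < p) :
    PStochasticallyComplete n p ψ := by
  obtain ⟨ε, hε, hr⟩ := hL.exists_le_ratio
  exact h.pStochasticallyComplete (h.tendsto_thetaInt_of_le_ratio hp hε hr)

theorem IsRadialSolution.not_tendsto_rescaled {n : ℕ} {p q : ℝ} {ψ φ : ℝ → ℝ}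
    (hs : IsRadialSolution n p q ψ φ) (h : IsCartanHadamardModel ψ) (hL : LiminfCondition n p ψ)
    (hn : 2 ≤ n) (hp : 1 < p) (hpq : p - 1 < q) :
    ¬ Tendsto (rescaled n p q ψ φ) atTop
      (𝓝 (((p - 1) / (q + 1 - p)) ^ ((p - 1) / (q + 1 - p)))) := by
  intro hlim
  have hp1 : 0 < p - 1 := by linarith
  have hqp : 0 < q + 1 - p := by linarith
  have hk := decayExp_pos hp hpq
  obtain ⟨ε, hε, hr⟩ := hL.exists_le_ratio
  obtain ⟨u, hu, hφu⟩ := hs.exists_isProfile h hn hp (by linarith)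
  obtain ⟨δ, hδ0, hδ1, hδ⟩ := exists_frequently_rpow_mul_thetaInt_le hp hpq hε
  have hfreq := hδ n ψ u h hu hr
  have he : (p - 1) / (q + 1 - p) = 1 / decayExp p q := by rw [decayExp, one_div_div]
  have he0 : 0 < (p - 1) / (q + 1 - p) := by positivity
  set e := (p - 1) / (q + 1 - p) with hedef
  have hlt : ((1 - δ) / decayExp p q) ^ e < e ^ e := by
    refine Real.rpow_lt_rpow (div_nonneg (by linarith) hk.le) ?_ he0
    rw [he]
    exact div_lt_div_of_pos_right (by linarith) hk
  obtain ⟨M, hM1, hM2⟩ := exists_between hlt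
  obtain ⟨R, hR⟩ := eventually_atTop.1 (hlim.eventually_const_lt hM2)
  have hcont : ∀ r, 0 < r → ContinuousAt (rescaled n p q ψ u) r := fun r hr0 =>
    ((h.hasDerivAt_thetaInt hp hr0).continuousAt.rpow_const (Or.inr he0.le)).mul
      (hu.hasDerivAt r hr0).continuousAt
  -- The oscillation is known for the profile u, the assumed limit concerns φ, and the two agree
  -- only almost everywhere. A strict lower bound for φ passes to u as a weak one by continuity of
  -- u.
  have hge : ∀ r, 0 < r → R < r → M ≤ rescaled n p q ψ u r := fun r hr0 hrR => by
    by_contra hneg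
    have h1 : ∀ᶠ t in 𝓝 r, rescaled n p q ψ u t < M ∧ 0 < t ∧ R < t :=
      ((hcont r hr0).eventually_lt continuousAt_const (not_le.1 hneg)).and
        ((lt_mem_nhds hr0).and (lt_mem_nhds hrR))
    have h2 : ∀ᵐ t, ¬ (rescaled n p q ψ u t < M ∧ 0 < t ∧ R < t) := by
      filter_upwards [(ae_restrict_iff' measurableSet_Ioi).1 hφu] with t ht ⟨h3, h4, h5⟩
      have h6 := hR t h5.le
      rw [rescaled, ht h4] at h6
      exact lt_asymm h6 h3
    exact (Measure.measure_pos_of_mem_nhds volume h1).ne' (by simpa [ae_iff] using h2)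
  obtain ⟨r, hr1, hr0, hrR⟩ := (hfreq.and_eventually
    ((eventually_gt_atTop 0).and (eventually_gt_atTop R))).exists
  have h1 := hge r hr0 hrR
  have hupos := (hu.pos r hr0).le
  rw [rescaled_eq h hp hpq hr0 hupos] at h1
  have h2 := Real.rpow_le_rpow (mul_nonneg (Real.rpow_nonneg hupos _) (h.thetaInt_pos hp hr0).le)
    hr1 he0.le
  linarith

end CHModel

end

theorem mainTheorem5 (n : ℕ) (p q : ℝ) (hp : 1 < p) (hpn : p < n)
    (hq : (n : ℝ) * p / ((n : ℝ) - p) - 1 ≤ q) :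
    (∀ ψ : ℝ → ℝ, CHModel.IsCartanHadamardModel ψ →
      (CHModel.LiminfCondition n p ψ →
        CHModel.PStochasticallyComplete n p ψ ∧
        ∀ φ : ℝ → ℝ, CHModel.IsRadialSolution n p q ψ φ →
          ¬ Tendsto (CHModel.rescaled n p q ψ φ) atTop
            (𝓝 (((p - 1) / (q + 1 - p)) ^ ((p - 1) / (q + 1 - p))))) ∧
      ((∃ l : ℝ, 0 < l ∧ Tendsto (fun r => r * deriv ψ r / ψ r) atTop (𝓝 l)) →
        CHModel.LiminfCondition n p ψ)) ∧
    (∀ α : ℝ, 0 < α → ∃ ψ φ : ℝ → ℝ,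
      CHModel.IsCartanHadamardModel ψ ∧ ContDiff ℝ ∞ ψ ∧ Function.Odd ψ ∧
      CHModel.PStochasticallyComplete n p ψ ∧
      (∀ l : ℝ, 0 < l →
        limsup (fun r : ℝ => ((ψ r / Real.exp (l * r) : ℝ) : EReal)) atTop = ⊤) ∧
      CHModel.IsRadialSolution n p q ψ φ ∧ ContinuousOn φ (Ici 0) ∧ φ 0 = α ∧
      ¬ ∃ L : EReal,
        Tendsto (fun r : ℝ => ((CHModel.rescaled n p q ψ φ r : ℝ) : EReal)) atTop (𝓝 L)) := by
  have hn : 2 ≤ n := by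
    have : (1 : ℝ) < n := hp.trans hpn
    exact_mod_cast this
  have hpq := CHModel.critical_lt hp hpn hq
  refine ⟨fun ψ h => ⟨fun hL => ⟨hL.pStochasticallyComplete h hp, fun φ hφ =>
    hφ.not_tendsto_rescaled h hL hn hp hpq⟩, ?_⟩, fun α hα => ?_⟩
  · rintro ⟨l, -, hl⟩
    obtain ⟨ε, hε, hr⟩ := CHModel.exists_le_ratio_of_tendsto (l := l) n hp
    exact CHModel.LiminfCondition.of_le_ratio hε (hr ψ h hl)
  · obtain ⟨ψ, u, h, hsm, hodd, hst, hgr, hu, hc, h0, hosc⟩ :=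
      CHModel.exists_oscillating_model hp hpn hq hα
    exact ⟨ψ, u, h, hsm, hodd, hst, hgr,
      hu.isRadialSolution h hn hp (by linarith) hc (by rwa [h0]), hc, h0, hosc⟩
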